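/- Let $(\Omega,\mathcal F,(\mathcal F_t)_{t\ge0},\mathbb P)$ be a filtered probability space carrying an $m$-dimensional $(\mathcal F_t)$-Brownian motion $B=(B^1,\dots,B^m)$, let $x_0\in\mathbb R^d$, and let $f:\mathbb R^d\to\mathbb R^d$, $g=(g_1,\dots,g_m):\mathbb R^d\to\mathbb R^{d\times m}$, where the columns $g_j=(g_{1,j},\dots,g_{d,j})^T$ have partial derivatives $G_j^l=\partial g_j/\partial x^l$ everywhere. Put $L^{j_1}g_{j_2}=\sum_{l=1}^d g_{l,j_1}G_{j_2}^l$ and assume: (i) $L^{j_1}g_{j_2}=L^{j_2}g_{j_1}$ for all $j_1,j_2$ (commutativity); (ii) $f(0)=0$, $g(0)=0$, and for every $R>0$ there is $K_R>0$ with $|f(x)-f(y)|\vee|g_j(x)-g_j(y)|\vee|L^{j_1}g_{j_2}(x)-L^{j_1}g_{j_2}(y)|\le K_R|x-y|$ for all $|x|\vee|y|\le R$ and all $j,j_1,j_2$; (iii) for some $\lambda>0$ and some $p$, where $p\ge2$ (or merely $p>0$ if $d=1$), $\langle x,f(x)\rangle+\frac{p-1}{2}\sum_{j=1}^m|g_j(x)|^2\le-\lambda|x|^2$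 for all $x\in\mathbb R^d$. Let $\Delta_0\in(0,1]$ and let $h:(0,\Delta_0]\to(0,\infty)$ be strictly decreasing with $h(\Delta)\to\infty$ and $K_{h(\Delta)}^6\Delta\to0$ as $\Delta\to0$. For $\Delta\in(0,\Delta_0]$ define $\tilde f(x)=f(x)$, $\tilde g(x)=g(x)$ if $|x|\le h(\Delta)$ and $\tilde f(x)=\frac{|x|}{h(\Delta)}f\big(h(\Delta)\frac{x}{|x|}\big)$, $\tilde g(x)=\frac{|x|}{h(\Delta)}g\big(h(\Delta)\frac{x}{|x|}\big)$ if $|x|>h(\Delta)$; $\tilde G_j^l(x)=G_j^l\big((|x|\wedge h(\Delta))\frac{x}{|x|}\big)$ (with $\frac{x}{|x|}=0$ at $x=0$); and $L^{j_1}\tilde g_{j_2}=\sum_l\tilde g_{l,j_1}\tilde G_{j_2}^l$. The modified truncated Milstein scheme is $Y_0=x_0$ and, with $\Delta B_k^j=B^j((k+1)\Delta)-B^j(k\Delta)$, $$Y_{k+1}=Y_k+\tilde f(Y_k)\Delta+\sum_{j}\tilde g_j(Y_k)\Delta B_k^j+\tfrac12\sum_{j_1,j_2}L^{j_1}\tilde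 g_{j_2}(Y_k)\,\Delta B_k^{j_2}\Delta B_k^{j_1}-\tfrac12\sum_{j}L^{j}\tilde g_j(Y_k)\Delta .$$ With $\bar Y(t)=Y_k$ and $\Delta B^j(t)=B^j(t)-B^j(k\Delta)$ for $t\in[k\Delta,(k+1)\Delta)$, its continuous-time interpolation is $$Y(t)=x_0+\int_0^t\tilde f(\bar Y(s))\,ds+\sum_{j}\int_0^t\tilde g_j(\bar Y(s))\,dB^j(s)+\sum_{j_1}\int_0^t\sum_{j_2}L^{j_1}\tilde g_{j_2}(\bar Y(s))\,\Delta B^{j_2}(s)\,dB^{j_1}(s),$$ with Itô integrals. Then for every $\varepsilon>0$ there is $\Delta^*\in(0,\Delta_0]$ such that for every $\Delta\in(0,\Delta^*)$ (with $\log0=-\infty$) $$\limsup_{k\to\infty}\frac{\log\mathbb E|Y_k|^p}{k\Delta}\le-p(\lambda-\varepsilon)\qquad\text{and}\qquad\limsup_{t\to\infty}\frac{\log\mathbb E|Y(t)|^p}{t}\le-p(\lambda-\varepsilon).$$ -/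

import Mathlib

open MeasureTheory ProbabilityTheory Filter Topology
open scoped NNReal ENNReal

noncomputable section

namespace MTMilstein

/-! ### Brownian motion with respect to a filtration and the Itô integral -/

section Ito

variable {Ω : Type*} {mΩ : MeasurableSpace Ω} {m d : ℕ}

/-- `B = (B¹, …, Bᵐ)` is an `m`-dimensional Brownian motion with respect to the filtration `ℱ`:
its coordinates are independent real Brownian motions (started at `0`, almost surely continuous),
it is adapted, and `B t - B s` is independent of `ℱ s` for `s ≤ t`. -/
structure IsBrownianMotion (ℱ : Filtration ℝ≥0 mΩ) (P : Measure Ω)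
    (B : ℝ≥0 → Ω → (Fin m → ℝ)) : Prop where
  isBrownianReal : ∀ j, IsBrownianReal (fun t ω => B t ω j) P
  indep_coord : iIndepFun (fun (j : Fin m) (ω : Ω) (t : ℝ≥0) => B t ω j) P
  adapted : ∀ t, Measurable[ℱ t] (B t)
  indep_increment : ∀ s t : ℝ≥0, s ≤ t →
    Indep (MeasurableSpace.comap (fun ω => B t ω - B s ω) inferInstance) (ℱ s) P

/-- A simple (elementary predictable) process `∑_{i<n} ξ_i 1_{(t_i, t_{i+1}]}` with bounded,
`ℱ (t_i)`-measurable coefficients `ξ_i`. -/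
structure SimpleProcess (ℱ : Filtration ℝ≥0 mΩ) (d : ℕ) where
  n : ℕ
  time : ℕ → ℝ≥0
  mono : Monotone time
  coeff : ℕ → Ω → EuclideanSpace ℝ (Fin d)
  measurable_coeff : ∀ i, Measurable[ℱ (time i)] (coeff i)
  bounded_coeff : ∀ i, ∃ C : ℝ, ∀ ω, ‖coeff i ω‖ ≤ C

/-- The value of a simple process at time `s`. -/
def SimpleProcess.eval {ℱ : Filtration ℝ≥0 mΩ} (φ : SimpleProcess ℱ d) (s : ℝ≥0) (ω : Ω) :
    EuclideanSpace ℝ (Fin d) :=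
  ∑ i ∈ Finset.range φ.n, (Set.Ioc (φ.time i) (φ.time (i + 1))).indicator (fun _ => φ.coeff i ω) s

/-- The elementary stochastic integral `∫₀ᵗ φ dW = ∑ ξ_i (W_{t ∧ t_{i+1}} - W_{t ∧ t_i})`. -/
def SimpleProcess.integral {ℱ : Filtration ℝ≥0 mΩ} (φ : SimpleProcess ℱ d) (W : ℝ≥0 → Ω → ℝ)
    (t : ℝ≥0) (ω : Ω) : EuclideanSpace ℝ (Fin d) :=
  ∑ i ∈ Finset.range φ.n,
    (W (min t (φ.time (i + 1))) ω - W (min t (φ.time i)) ω) • φ.coeff i ω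

/-- `I` is (a version of) the Itô integral `∫₀ᵗ X dW`: there are simple processes converging to `X`
in `L²(Ω × [0,t])` whose elementary integrals converge to `I` in `L²(Ω)`. -/
def IsItoIntegral (ℱ : Filtration ℝ≥0 mΩ) (P : Measure Ω) (W : ℝ≥0 → Ω → ℝ)
    (X : ℝ≥0 → Ω → EuclideanSpace ℝ (Fin d)) (t : ℝ≥0)
    (I : Ω → EuclideanSpace ℝ (Fin d)) : Prop :=
  MemLp (fun z : Ω × ℝ => X z.2.toNNReal z.1) 2
      (P.prod ((volume : Measure ℝ).restrict (Set.Ioc 0 (t : ℝ)))) ∧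
  MemLp I 2 P ∧
  ∃ φ : ℕ → SimpleProcess ℱ d,
    Tendsto (fun n => eLpNorm
        (fun z : Ω × ℝ => (φ n).eval z.2.toNNReal z.1 - X z.2.toNNReal z.1) 2
        (P.prod ((volume : Measure ℝ).restrict (Set.Ioc 0 (t : ℝ))))) atTop (𝓝 0) ∧
    Tendsto (fun n => eLpNorm (fun ω => (φ n).integral W t ω - I ω) 2 P) atTop (𝓝 0)

open Classical in
/-- The Itô integral `∫₀ᵗ X dW` (unique up to a null set whenever `W` is an `ℱ`-Brownian motion and
`X` is an `L²(Ω × [0,t])`-limit of simple processes; `0` for integrands outside that class). -/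
def itoIntegral (ℱ : Filtration ℝ≥0 mΩ) (P : Measure Ω) (W : ℝ≥0 → Ω → ℝ)
    (X : ℝ≥0 → Ω → EuclideanSpace ℝ (Fin d)) (t : ℝ≥0) : Ω → EuclideanSpace ℝ (Fin d) :=
  if hX : ∃ I, IsItoIntegral ℱ P W X t I then hX.choose else 0

end Ito

/-! ### The coefficients and their truncations

The diffusion matrix is given by its columns `g j`, so that `g_{l,j}(x) = g j x l`. -/

section Coefficients

variable {m d : ℕ}

/-- `G_j^l(x) = ∂g_j(x)/∂x^l`. -/
def dcol (g : Fin m → EuclideanSpace ℝ (Fin d) → EuclideanSpace ℝ (Fin d)) (j : Fin m) (l : Fin d)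
    (x : EuclideanSpace ℝ (Fin d)) : EuclideanSpace ℝ (Fin d) :=
  lineDeriv ℝ (g j) x (EuclideanSpace.single l 1)

/-- `L^{j₁} g_{j₂}(x) = ∑_l g_{l,j₁}(x) ∂g_{j₂}(x)/∂x^l`. -/
def Lop (g : Fin m → EuclideanSpace ℝ (Fin d) → EuclideanSpace ℝ (Fin d)) (j₁ j₂ : Fin m)
    (x : EuclideanSpace ℝ (Fin d)) : EuclideanSpace ℝ (Fin d) :=
  ∑ l : Fin d, (g j₁ x l) • dcol g j₂ l x

/-- The modified truncation of a vector field at radius `r > 0`. -/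
def trunc (r : ℝ) (F : EuclideanSpace ℝ (Fin d) → EuclideanSpace ℝ (Fin d))
    (x : EuclideanSpace ℝ (Fin d)) : EuclideanSpace ℝ (Fin d) :=
  if ‖x‖ ≤ r then F x else (‖x‖ / r) • F ((r / ‖x‖) • x)

/-- The truncated derivative `G̃_j^l(x) = G_j^l((|x| ∧ r) x/|x|)`, with `x/|x| = 0` for `x = 0`. -/
def truncDcol (r : ℝ) (g : Fin m → EuclideanSpace ℝ (Fin d) → EuclideanSpace ℝ (Fin d))
    (j : Fin m) (l : Fin d) (x : EuclideanSpace ℝ (Fin d)) : EuclideanSpace ℝ (Fin d) :=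
  dcol g j l ((min ‖x‖ r / ‖x‖) • x)

/-- `L^{j₁} g̃_{j₂}(x) = ∑_l g̃_{l,j₁}(x) G̃_{j₂}^l(x)`. -/
def truncLop (r : ℝ) (g : Fin m → EuclideanSpace ℝ (Fin d) → EuclideanSpace ℝ (Fin d))
    (j₁ j₂ : Fin m) (x : EuclideanSpace ℝ (Fin d)) : EuclideanSpace ℝ (Fin d) :=
  ∑ l : Fin d, (trunc r (g j₁) x l) • truncDcol r g j₂ l x

end Coefficients

/-! ### The modified truncated Milstein method -/

section Scheme

variable {Ω : Type*} {mΩ : MeasurableSpace Ω} {m d : ℕ}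

/-- The modified truncated Milstein scheme `Y_k` with step size `Δ`, truncation radius `r`
(equal to `h(Δ)` in use) and initial value `x₀`. -/
def milstein (f : EuclideanSpace ℝ (Fin d) → EuclideanSpace ℝ (Fin d))
    (g : Fin m → EuclideanSpace ℝ (Fin d) → EuclideanSpace ℝ (Fin d))
    (r : ℝ) (Δ : ℝ≥0) (x₀ : EuclideanSpace ℝ (Fin d)) (B : ℝ≥0 → Ω → (Fin m → ℝ)) :
    ℕ → Ω → EuclideanSpace ℝ (Fin d)
  | 0, _ => x₀
  | k + 1, ω =>
    let y := milstein f g r Δ x₀ B k ω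
    let dB : Fin m → ℝ := fun j => B (((k + 1 : ℕ) : ℝ≥0) * Δ) ω j - B ((k : ℝ≥0) * Δ) ω j
    y + (Δ : ℝ) • trunc r f y + ∑ j : Fin m, dB j • trunc r (g j) y
      + (1 / 2 : ℝ) • ∑ j₁ : Fin m, ∑ j₂ : Fin m, ∑ l : Fin d,
          (trunc r (g j₁) y l * dB j₂ * dB j₁) • truncDcol r g j₂ l y
      - (1 / 2 : ℝ) • ∑ j : Fin m, ∑ l : Fin d,
          (trunc r (g j) y l * (Δ : ℝ)) • truncDcol r g j l y

/-- The piecewise constant interpolation: `Ȳ(t) = Y_k` for `t ∈ [kΔ, (k+1)Δ)`. -/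
def milsteinStep (f : EuclideanSpace ℝ (Fin d) → EuclideanSpace ℝ (Fin d))
    (g : Fin m → EuclideanSpace ℝ (Fin d) → EuclideanSpace ℝ (Fin d))
    (r : ℝ) (Δ : ℝ≥0) (x₀ : EuclideanSpace ℝ (Fin d)) (B : ℝ≥0 → Ω → (Fin m → ℝ))
    (t : ℝ≥0) (ω : Ω) : EuclideanSpace ℝ (Fin d) :=
  milstein f g r Δ x₀ B ⌊t / Δ⌋₊ ω

/-- `ΔB^j(s) = B^j(s) - B^j(kΔ)` for `s ∈ [kΔ, (k+1)Δ)`. -/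
def stepIncrement (Δ : ℝ≥0) (B : ℝ≥0 → Ω → (Fin m → ℝ)) (j : Fin m) (s : ℝ≥0) (ω : Ω) : ℝ :=
  B s ω j - B ((⌊s / Δ⌋₊ : ℝ≥0) * Δ) ω j

/-- The continuous-time interpolation
`Y(t) = x₀ + ∫₀ᵗ f̃(Ȳ(s)) ds + ∑_j ∫₀ᵗ g̃_j(Ȳ(s)) dB^j(s)
  + ∑_{j₁} ∫₀ᵗ ∑_{j₂} L^{j₁} g̃_{j₂}(Ȳ(s)) ΔB^{j₂}(s) dB^{j₁}(s)`. -/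
def milsteinCont (ℱ : Filtration ℝ≥0 mΩ) (P : Measure Ω)
    (f : EuclideanSpace ℝ (Fin d) → EuclideanSpace ℝ (Fin d))
    (g : Fin m → EuclideanSpace ℝ (Fin d) → EuclideanSpace ℝ (Fin d))
    (r : ℝ) (Δ : ℝ≥0) (x₀ : EuclideanSpace ℝ (Fin d)) (B : ℝ≥0 → Ω → (Fin m → ℝ))
    (t : ℝ≥0) (ω : Ω) : EuclideanSpace ℝ (Fin d) :=
  x₀ + (∫ s in (0 : ℝ)..(t : ℝ), trunc r f (milsteinStep f g r Δ x₀ B s.toNNReal ω))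
    + ∑ j : Fin m, itoIntegral ℱ P (fun s ω' => B s ω' j)
        (fun s ω' => trunc r (g j) (milsteinStep f g r Δ x₀ B s ω')) t ω
    + ∑ j₁ : Fin m, itoIntegral ℱ P (fun s ω' => B s ω' j₁)
        (fun s ω' => ∑ j₂ : Fin m, stepIncrement Δ B j₂ s ω' •
          truncLop r g j₁ j₂ (milsteinStep f g r Δ x₀ B s ω')) t ω

end Scheme

end MTMilstein

end

/-! Beyond radius `h Δ` the truncation extends a vector field radially and homogeneously of degree
one. The truncated drift and diffusion therefore satisfy the dissipativity inequality everywhere,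
and all truncated coefficients grow at most linearly with constant `K = K (h Δ)`. The truncated
operator is itself the truncation of `Lop` (`truncLop_eq_trunc`), so it inherits this growth bound
and the commutativity.

Discrete estimate. Given `Y_k = y ≠ 0`, divide by `‖y‖` and write the Brownian increment as `s z`
with `s = √Δ` and `z` standard Gaussian. One step becomes `e + s A + s² B` with `‖e‖ = 1`, where `A`
is linear in `z` and `B` is the drift plus the Milstein correction. Expanding `‖·‖ ^ p` to second
order in `s` (`norm_rpow_le_expansion`) leaves an error `(K s)³` times a power of a Gaussian weight.
In expectation the linear terms vanish, the Milstein correction is centred, and the second order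
terms form the dissipativity expression, so a step multiplies the `p`-th moment by at most `exp (-p
λ Δ + C (K √Δ)³)` (`lintegral_step_le`). Independence of the increments allows iteration
(`lintegral_milstein_le`). Since `K⁶ Δ → 0`, the error `C K³ √Δ · Δ` is at most `p ε Δ` for small
`Δ`, which gives the rate.

Continuous time. Almost surely `Y(t)` is one step of length `t - kΔ` started at `Y_k`, where `k =
⌊t/Δ⌋` (`milsteinCont_ae_eq`). This is the classical formula for iterated Itô integrals with
symmetric coefficients: summation by parts on a fine mesh (`sum_grid`) turns Riemann sums of the
double integral into the Milstein correction minus covariation defects, and these defects vanish in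
`L²` (`meshDefect_bound`). Identifying the abstract Itô integrals as limits of such sums rests on
the isometry and on `IsIntegrator.tendsto_itoIntegral`. A shortened step multiplies the moment by at
most a constant independent of `t`, which disappears in `log / t`. -/

noncomputable section

namespace MTMilstein

/-! ### Second order expansion of powers of the norm -/

/-- Taylor's formula for `(1 + u) ^ q`, with a remainder valid on the whole half-line `u ≥ -1`. -/
lemma one_add_rpow_le_taylor {q : ℝ} (hq : 0 < q) {n : ℕ} (hn : 2 ≤ n) (hqn : q ≤ n) :
    ∃ C : ℝ, 0 ≤ C ∧ ∀ u : ℝ, -1 ≤ u →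
      (1 + u) ^ q ≤ 1 + q * u + q * (q - 1) / 2 * u ^ 2 + C * (|u| ^ 3 * (1 + |u|) ^ n) := by
  have hO := (Real.one_add_rpow_hasFPowerSeriesAt_zero (a := q)).isBigO_sub_partialSum_pow 3
  obtain ⟨c, hc⟩ := hO.bound
  obtain ⟨δ, hδ, hball⟩ := Metric.eventually_nhds_iff.1 hc
  have hps : ∀ u : ℝ, (binomialSeries ℝ q).partialSum 3 u
      = 1 + q * u + q * (q - 1) / 2 * u ^ 2 := by
    intro u
    have h2 : Ring.choose q 2 = q * (q - 1) / 2 := by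
      have := Ring.descPochhammer_eq_factorial_smul_choose q 2
      simp [descPochhammer_succ_right, Polynomial.smeval_mul, Polynomial.smeval_sub] at this
      linarith
    simp [FormalMultilinearSeries.partialSum, Finset.sum_range_succ, binomialSeries,
      FormalMultilinearSeries.coeff_ofScalars, h2]
    ring
  -- The term `|c|` serves `|u| < δ`, where the binomial series controls the remainder. For `|u| ≥
  -- δ` the numerators `1`, `q`, `q (q + 1)` bound the power, the linear and the quadratic term by
  -- multiples of `(1 + |u|) ^ n`, and `|u|³ / δ³ ≥ 1` supplies the cubic factor.
  refine ⟨|c| + (1 + q + q * (q + 1)) / δ ^ 3, by positivity, fun u hu => ?_⟩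
  have hW : (1 : ℝ) ≤ (1 + |u|) ^ n := one_le_pow₀ (by linarith [abs_nonneg u])
  have hu3 : 0 ≤ |u| ^ 3 := by positivity
  rcases lt_or_ge |u| δ with h | h
  · have := hball (y := u) (by simpa using h)
    rw [hps, zero_add, Real.norm_eq_abs, Real.norm_eq_abs, Real.norm_eq_abs,
      abs_of_nonneg hu3] at this
    have h1 := (abs_le.1 this).2
    have h2 : c * |u| ^ 3 ≤ |c| * (|u| ^ 3 * (1 + |u|) ^ n) := by
      have : |u| ^ 3 ≤ |u| ^ 3 * (1 + |u|) ^ n := le_mul_of_one_le_right hu3 hW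
      exact mul_le_mul (le_abs_self c) this hu3 (abs_nonneg c)
    have h3 : 0 ≤ (1 + q + q * (q + 1)) / δ ^ 3 * (|u| ^ 3 * (1 + |u|) ^ n) := by positivity
    rw [add_mul]
    linarith
  · have h1 : (1 + u) ^ q ≤ (1 + |u|) ^ n := by
      calc (1 + u) ^ q ≤ (1 + |u|) ^ q :=
            Real.rpow_le_rpow (by linarith) (by linarith [le_abs_self u]) hq.le
        _ ≤ (1 + |u|) ^ (n : ℝ) :=
            Real.rpow_le_rpow_of_exponent_le (by linarith [abs_nonneg u]) hqn
        _ = _ := Real.rpow_natCast _ _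
    have h2 : (1 + |u|) ^ 2 ≤ (1 + |u|) ^ n :=
      pow_le_pow_right₀ (by linarith [abs_nonneg u]) hn
    have h3 : |u| ≤ (1 + |u|) ^ n := by nlinarith [abs_nonneg u]
    have h4 : u ^ 2 ≤ (1 + |u|) ^ n := by nlinarith [abs_nonneg u, sq_abs u]
    have h5 : -(q * u) ≤ q * (1 + |u|) ^ n := by
      nlinarith [neg_abs_le u]
    have h6 : -(q * (q - 1) / 2 * u ^ 2) ≤ q * (q + 1) * (1 + |u|) ^ n := by
      have : -(q * (q - 1) / 2 * u ^ 2) ≤ q * (q + 1) * u ^ 2 := by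
        nlinarith [sq_nonneg u, mul_nonneg hq.le (sq_nonneg u),
          mul_nonneg (mul_nonneg hq.le hq.le) (sq_nonneg u)]
      exact this.trans (mul_le_mul_of_nonneg_left h4 (by positivity))
    have h7 : (1 + q + q * (q + 1)) * (1 + |u|) ^ n
        ≤ (1 + q + q * (q + 1)) / δ ^ 3 * (|u| ^ 3 * (1 + |u|) ^ n) := by
      have : δ ^ 3 ≤ |u| ^ 3 := pow_le_pow_left₀ hδ.le h 3
      rw [div_mul_eq_mul_div, le_div_iff₀ (by positivity)]
      have : (1 + |u|) ^ n * δ ^ 3 ≤ |u| ^ 3 * (1 + |u|) ^ n := by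
        rw [mul_comm]; exact mul_le_mul_of_nonneg_right this (by positivity)
      calc _ = (1 + q + q * (q + 1)) * ((1 + |u|) ^ n * δ ^ 3) := by ring
        _ ≤ _ := mul_le_mul_of_nonneg_left this (by positivity)
    have h8 : 0 ≤ |c| * (|u| ^ 3 * (1 + |u|) ^ n) := by positivity
    rw [add_mul]
    nlinarith

/-- Expansion of `‖e + s A + s² B‖ ^ p` up to third order in `s`. -/
lemma norm_rpow_le_expansion {E : Type*} [NormedAddCommGroup E] [InnerProductSpace ℝ E]
    {p : ℝ} (hp : 0 < p) {C₁ : ℝ} (hC₁ : 0 ≤ C₁) :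
    ∃ C : ℝ, 0 ≤ C ∧ ∃ N : ℕ, ∀ (e A B : E) (K s w : ℝ), ‖e‖ = 1 → 1 ≤ K → 0 ≤ s → s ≤ 1 →
      K * s ≤ 1 → 1 ≤ w → ‖A‖ ≤ K * w → ‖B‖ ≤ C₁ * K * w ^ 2 →
      ‖e + (s • A + s ^ 2 • B)‖ ^ p ≤ 1
        + p / 2 * (2 * s * inner ℝ e A + 2 * s ^ 2 * inner ℝ e B + s ^ 2 * ‖A‖ ^ 2)
        + p / 2 * (p / 2 - 1) / 2 * (4 * s ^ 2 * (inner ℝ e A) ^ 2)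
        + C * (K * s) ^ 3 * w ^ N := by
  obtain ⟨n, hn⟩ := exists_nat_ge (p / 2 + 2)
  have hn2 : 2 ≤ n := by
    have : (2 : ℝ) ≤ n := by linarith
    exact_mod_cast this
  obtain ⟨C, hC, hT⟩ := one_add_rpow_le_taylor (q := p / 2) (by positivity) hn2 (by linarith)
  obtain ⟨D, hD⟩ : ∃ D : ℝ, D = (3 + C₁) ^ 2 := ⟨_, rfl⟩
  have hD0 : 0 ≤ D := by rw [hD]; positivity
  have hDe : D = 9 + 6 * C₁ + C₁ ^ 2 := by rw [hD]; ring
  have hC2 : 0 ≤ C₁ ^ 2 := sq_nonneg _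
  -- The three summands pay for the third order part of `u`, for replacing `u²` by its leading part,
  -- and for the Taylor remainder. The exponent `12 + 4 * n` comes from `|u|³ (1 + |u|) ^ n` with
  -- `u` of order `w⁴`.
  refine ⟨p / 2 * D + p / 2 * (p / 2 + 1) / 2 * (4 * D + D ^ 2) + C * (D ^ 3 * (1 + D) ^ n),
    by positivity, 12 + 4 * n, ?_⟩
  intro e A B K s w he hK hs hs1 hKs hw hA hB
  obtain ⟨η, hη⟩ : ∃ η : ℝ, η = K * s := ⟨_, rfl⟩
  rw [← hη] at hKs ⊢
  have hη0 : 0 ≤ η := by rw [hη]; positivity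
  have hsη : s ≤ η := hη ▸ le_mul_of_one_le_left hs hK
  have hw0 : 0 ≤ w := by linarith
  have hα : |inner ℝ e A| ≤ K * w := by
    have := abs_real_inner_le_norm e A
    rw [he, one_mul] at this; exact this.trans hA
  have hβ : |inner ℝ e B| ≤ C₁ * K * w ^ 2 := by
    have := abs_real_inner_le_norm e B
    rw [he, one_mul] at this; exact this.trans hB
  have hAB : |inner ℝ A B| ≤ (K * w) * (C₁ * K * w ^ 2) :=
    (abs_real_inner_le_norm A B).trans (mul_le_mul hA hB (norm_nonneg _) (by positivity))
  have hpow : ∀ i j : ℕ, i ≤ j → w ^ i ≤ w ^ j := fun i j h => pow_le_pow_right₀ hw h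
  have hηpow : ∀ i j : ℕ, i ≤ j → η ^ j ≤ η ^ i := fun i j h => pow_le_pow_of_le_one hη0 hKs h
  -- the third order terms of `u = ‖e + sA + s²B‖² - 1`
  obtain ⟨r, hr⟩ : ∃ r, r = 2 * s ^ 3 * inner ℝ A B + s ^ 4 * ‖B‖ ^ 2 := ⟨_, rfl⟩
  have hr1 : |2 * s ^ 3 * inner ℝ A B| ≤ 2 * C₁ * (η ^ 3 * w ^ 4) := by
    rw [abs_mul, abs_of_nonneg (by positivity : 0 ≤ 2 * s ^ 3)]
    calc 2 * s ^ 3 * |inner ℝ A B| ≤ 2 * s ^ 3 * ((K * w) * (C₁ * K * w ^ 2)) := by gcongr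
      _ = 2 * C₁ * (η ^ 2 * s * w ^ 3) := by rw [hη]; ring
      _ ≤ 2 * C₁ * (η ^ 2 * η * w ^ 4) := by
        have := hpow 3 4 (by norm_num)
        gcongr
      _ = _ := by ring
  have hr2 : |s ^ 4 * ‖B‖ ^ 2| ≤ C₁ ^ 2 * (η ^ 3 * w ^ 4) := by
    rw [abs_of_nonneg (by positivity)]
    calc s ^ 4 * ‖B‖ ^ 2 ≤ s ^ 4 * (C₁ * K * w ^ 2) ^ 2 := by gcongr
      _ = C₁ ^ 2 * (η ^ 2 * s * s * w ^ 4) := by rw [hη]; ring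
      _ ≤ C₁ ^ 2 * (η ^ 2 * η * 1 * w ^ 4) := by gcongr
      _ = _ := by ring
  have hr3 : |r| ≤ (2 * C₁ + C₁ ^ 2) * (η ^ 3 * w ^ 4) :=
    hr ▸ (abs_add_le _ _).trans (by linarith)
  have hX3 : 0 ≤ η ^ 3 * w ^ 4 := by positivity
  have hX23 : η ^ 3 * w ^ 4 ≤ η ^ 2 * w ^ 4 := by
    have := hηpow 2 3 (by norm_num); gcongr
  have hX12 : η ^ 2 * w ^ 4 ≤ η * w ^ 4 := by
    have := hηpow 1 2 (by norm_num); rw [pow_one] at this; gcongr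
  -- Up to the factor `w⁴`, `r` has order `η³`, `ρ` order `η²` and `u = 2 s ⟨e, A⟩ + ρ` order `η`.
  -- So `u²` differs from `4 s² ⟨e, A⟩²` only at order `η³`.
  obtain ⟨ρ, hρ⟩ : ∃ ρ, ρ = 2 * s ^ 2 * inner ℝ e B + s ^ 2 * ‖A‖ ^ 2 + r := ⟨_, rfl⟩
  have hρ1 : |2 * s ^ 2 * inner ℝ e B| ≤ 2 * C₁ * (η ^ 2 * w ^ 4) := by
    rw [abs_mul, abs_of_nonneg (by positivity : 0 ≤ 2 * s ^ 2)]
    calc 2 * s ^ 2 * |inner ℝ e B| ≤ 2 * s ^ 2 * (C₁ * K * w ^ 2) := by gcongr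
      _ = 2 * C₁ * (η * s * w ^ 2) := by rw [hη]; ring
      _ ≤ 2 * C₁ * (η * η * w ^ 4) := by
        have := hpow 2 4 (by norm_num)
        gcongr
      _ = _ := by ring
  have hρ2 : |s ^ 2 * ‖A‖ ^ 2| ≤ η ^ 2 * w ^ 4 := by
    rw [abs_of_nonneg (by positivity)]
    calc s ^ 2 * ‖A‖ ^ 2 ≤ s ^ 2 * (K * w) ^ 2 := by gcongr
      _ = η ^ 2 * w ^ 2 := by rw [hη]; ring
      _ ≤ η ^ 2 * w ^ 4 := by
        have := hpow 2 4 (by norm_num)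
        gcongr
  have hρD : |ρ| ≤ (2 * C₁ + 1 + (2 * C₁ + C₁ ^ 2)) * (η ^ 2 * w ^ 4) := by
    rw [hρ]
    refine (abs_add_three _ _ _).trans ?_
    have : (2 * C₁ + C₁ ^ 2) * (η ^ 3 * w ^ 4) ≤ (2 * C₁ + C₁ ^ 2) * (η ^ 2 * w ^ 4) := by gcongr
    linarith
  have hsα : |s * inner ℝ e A| ≤ η * w := by
    rw [abs_mul, abs_of_nonneg hs]
    calc s * |inner ℝ e A| ≤ s * (K * w) := by gcongr
      _ = _ := by rw [hη]; ring
  have hww : w ≤ w ^ 4 := by simpa using hpow 1 4 (by norm_num)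
  obtain ⟨u, hu⟩ : ∃ u, u = 2 * (s * inner ℝ e A) + ρ := ⟨_, rfl⟩
  have huD : |u| ≤ D * (η * w ^ 4) := by
    rw [hu]
    refine (abs_add_le _ _).trans ?_
    rw [abs_mul, abs_two]
    have h1 : η * w ≤ η * w ^ 4 := by gcongr
    have h2 : (2 * C₁ + 1 + (2 * C₁ + C₁ ^ 2)) * (η ^ 2 * w ^ 4)
        ≤ (2 * C₁ + 1 + (2 * C₁ + C₁ ^ 2)) * (η * w ^ 4) := by gcongr
    have h3 : (2 + (2 * C₁ + 1 + (2 * C₁ + C₁ ^ 2))) * (η * w ^ 4) ≤ D * (η * w ^ 4) := by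
      gcongr
      linarith [hDe, hC2]
    linarith
  have hρD' : |ρ| ≤ D * (η ^ 2 * w ^ 4) := by
    refine hρD.trans ?_
    gcongr
    linarith [hDe, hC2]
  have hrD' : |r| ≤ D * (η ^ 3 * w ^ 4) := by
    refine hr3.trans ?_
    gcongr
    linarith [hDe, hC2]
  have hnorm : ‖e + (s • A + s ^ 2 • B)‖ ^ 2 = 1 + u := by
    rw [norm_add_sq_real, he, norm_add_sq_real, inner_add_right, inner_smul_right,
      inner_smul_right, inner_smul_left, inner_smul_right, norm_smul, norm_smul,
      Real.norm_of_nonneg hs, Real.norm_of_nonneg (by positivity : 0 ≤ s ^ 2)]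
    simp only [conj_trivial]
    rw [hu, hρ, hr]; ring
  have hu1 : -1 ≤ u := by
    have := sq_nonneg ‖e + (s • A + s ^ 2 • B)‖
    linarith
  have hlhs : ‖e + (s • A + s ^ 2 • B)‖ ^ p = (1 + u) ^ (p / 2) := by
    rw [← hnorm, ← Real.rpow_natCast_mul (norm_nonneg _)]
    congr 1
    push_cast; ring
  rw [hlhs]
  refine (hT u hu1).trans ?_
  have hw48 : w ^ 4 ≤ w ^ (12 + 4 * n) := hpow _ _ (by omega)
  have hw8 : w ^ 8 ≤ w ^ (12 + 4 * n) := hpow _ _ (by omega)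
  -- the remainder of Taylor's formula
  have hE1 : |u| ^ 3 * (1 + |u|) ^ n ≤ D ^ 3 * (1 + D) ^ n * (η ^ 3 * w ^ (12 + 4 * n)) := by
    have h1 : |u| ^ 3 ≤ (D * (η * w ^ 4)) ^ 3 := by gcongr
    have h2 : (1 + |u|) ≤ (1 + D) * w ^ 4 := by
      have : D * (η * w ^ 4) ≤ D * (1 * w ^ 4) := by gcongr
      have h4 : 1 ≤ w ^ 4 := one_le_pow₀ hw
      linarith
    have h3 : (1 + |u|) ^ n ≤ ((1 + D) * w ^ 4) ^ n := by gcongr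
    calc |u| ^ 3 * (1 + |u|) ^ n ≤ (D * (η * w ^ 4)) ^ 3 * ((1 + D) * w ^ 4) ^ n := by gcongr
      _ = _ := by rw [mul_pow, mul_pow (1 + D), ← pow_mul, pow_add, pow_mul, mul_pow]; ring
  have hE2 : p / 2 * r ≤ p / 2 * D * (η ^ 3 * w ^ (12 + 4 * n)) := by
    have h1 : r ≤ D * (η ^ 3 * w ^ (12 + 4 * n)) :=
      (le_abs_self r).trans (hrD'.trans (by gcongr))
    calc p / 2 * r ≤ p / 2 * (D * (η ^ 3 * w ^ (12 + 4 * n))) := by gcongr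
      _ = _ := by ring
  have hE3 : |u ^ 2 - 4 * s ^ 2 * (inner ℝ e A) ^ 2|
      ≤ (4 * D + D ^ 2) * (η ^ 3 * w ^ (12 + 4 * n)) := by
    have h0 : u ^ 2 - 4 * s ^ 2 * (inner ℝ e A) ^ 2 = 4 * ((s * inner ℝ e A) * ρ) + ρ ^ 2 := by
      rw [hu]; ring
    rw [h0]
    refine (abs_add_le _ _).trans ?_
    have h1 : |4 * ((s * inner ℝ e A) * ρ)| ≤ 4 * ((η * w ^ 4) * (D * (η ^ 2 * w ^ 4))) := by
      rw [abs_mul, abs_mul, abs_of_pos (by norm_num : (0 : ℝ) < 4)]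
      have : |s * inner ℝ e A| ≤ η * w ^ 4 := hsα.trans (by gcongr)
      gcongr
    have h2 : |ρ ^ 2| ≤ D ^ 2 * (η ^ 3 * w ^ 8) := by
      rw [abs_pow]
      calc |ρ| ^ 2 ≤ (D * (η ^ 2 * w ^ 4)) ^ 2 := by gcongr
        _ = D ^ 2 * (η ^ 4 * w ^ 8) := by ring
        _ ≤ D ^ 2 * (η ^ 3 * w ^ 8) := by
          have := hηpow 3 4 (by norm_num)
          gcongr
    calc _ ≤ 4 * ((η * w ^ 4) * (D * (η ^ 2 * w ^ 4))) + D ^ 2 * (η ^ 3 * w ^ 8) := by linarith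
      _ = (4 * D + D ^ 2) * (η ^ 3 * w ^ 8) := by ring
      _ ≤ _ := by gcongr
  have hE4 : p / 2 * (p / 2 - 1) / 2 * (u ^ 2 - 4 * s ^ 2 * (inner ℝ e A) ^ 2)
      ≤ p / 2 * (p / 2 + 1) / 2 * ((4 * D + D ^ 2) * (η ^ 3 * w ^ (12 + 4 * n))) := by
    refine (le_abs_self _).trans ?_
    rw [abs_mul]
    have : |p / 2 * (p / 2 - 1) / 2| ≤ p / 2 * (p / 2 + 1) / 2 := by
      rw [abs_le]
      have := sq_nonneg p
      constructor <;> linarith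
    gcongr
  have hE1' := mul_le_mul_of_nonneg_left hE1 hC
  have : p / 2 * u = p / 2 * (2 * s * inner ℝ e A + 2 * s ^ 2 * inner ℝ e B + s ^ 2 * ‖A‖ ^ 2)
      + p / 2 * r := by
    rw [hu, hρ]; ring
  linarith [hE1', hE2, hE4, this]

/-! ### The standard Gaussian measure on `Fin m → ℝ` -/

section Gaussian

variable {m : ℕ}

/-- The standard Gaussian measure on `Fin m → ℝ`. -/
def stdGauss (m : ℕ) : Measure (Fin m → ℝ) := Measure.pi fun _ => gaussianReal 0 1

instance : IsProbabilityMeasure (stdGauss m) := by unfold stdGauss; infer_instance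

/-- The weight `1 + ∑ |z_j|`. -/
def wt (z : Fin m → ℝ) : ℝ := 1 + ∑ j, |z j|

lemma one_le_wt (z : Fin m → ℝ) : 1 ≤ wt z := by
  have : 0 ≤ ∑ j, |z j| := Finset.sum_nonneg fun j _ => abs_nonneg _
  unfold wt; linarith

lemma measurable_wt : Measurable (wt : (Fin m → ℝ) → ℝ) := by
  unfold wt; fun_prop

lemma memLp_eval_stdGauss (j : Fin m) (q : ℝ≥0∞) (hq : q ≠ ∞) :
    MemLp (fun z : Fin m → ℝ => z j) q (stdGauss m) :=
  (memLp_id_gaussianReal' q hq).comp_measurePreserving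
    (measurePreserving_eval (fun _ : Fin m => gaussianReal 0 1) j)

lemma integrable_wt_pow (n : ℕ) : Integrable (fun z => wt z ^ n) (stdGauss m) := by
  have h : MemLp (wt : (Fin m → ℝ) → ℝ) n (stdGauss m) := by
    have h1 : MemLp (fun _ : Fin m → ℝ => (1 : ℝ)) n (stdGauss m) := memLp_const 1
    have h2 : MemLp (fun z : Fin m → ℝ => ∑ j, |z j|) n (stdGauss m) :=
      memLp_finsetSum _ fun j _ => (memLp_eval_stdGauss j n (by simp)).abs
    exact h1.add h2
  simpa [abs_of_nonneg (zero_le_one.trans (one_le_wt _))] using h.integrable_norm_pow'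

lemma integrable_eval_stdGauss (j : Fin m) :
    Integrable (fun z : Fin m → ℝ => z j) (stdGauss m) :=
  (memLp_eval_stdGauss j 1 (by simp)).integrable le_rfl

lemma integrable_eval_mul_eval_stdGauss (i j : Fin m) :
    Integrable (fun z : Fin m → ℝ => z i * z j) (stdGauss m) :=
  (memLp_eval_stdGauss i 2 (by simp)).integrable_mul (memLp_eval_stdGauss j 2 (by simp))

lemma integral_eval_stdGauss (j : Fin m) : ∫ z, z j ∂(stdGauss m) = 0 := by
  unfold stdGauss
  rw [integral_eval (μ := fun _ : Fin m => gaussianReal 0 1) (i := j)]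
  exact integral_id_gaussianReal

lemma integral_eval_mul_eval_stdGauss (i j : Fin m) :
    ∫ z, z i * z j ∂(stdGauss m) = if i = j then 1 else 0 := by
  split_ifs with h
  · subst h
    have h1 : ∫ z, z i * z i ∂(stdGauss m) = ∫ x, x * x ∂(gaussianReal 0 1) := by
      unfold stdGauss
      exact integral_comp_eval (μ := fun _ : Fin m => gaussianReal 0 1) (f := fun x => x * x)
        (by fun_prop)
    have h2 := variance_fun_id_gaussianReal (μ := 0) (v := 1)
    rw [variance_eq_integral (by fun_prop), integral_id_gaussianReal] at h2
    rw [h1]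
    simpa [sq] using h2
  · have hind : iIndepFun (fun (j : Fin m) (z : Fin m → ℝ) => z j) (stdGauss m) :=
      iIndepFun_pi (μ := fun _ : Fin m => gaussianReal 0 1) (X := fun _ x => x) (by fun_prop)
    rw [(hind.indepFun h).integral_fun_mul_eq_mul_integral
      (measurable_pi_apply i).aestronglyMeasurable (measurable_pi_apply j).aestronglyMeasurable,
      integral_eval_stdGauss, zero_mul]

/-- Expectation of a quadratic polynomial plus a power of the weight. -/
lemma integral_quadratic_stdGauss (c₀ c : ℝ) (a : Fin m → ℝ) (M : Fin m → Fin m → ℝ) (N : ℕ) :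
    Integrable (fun z => c₀ + ∑ j, a j * z j + ∑ i, ∑ j, M i j * (z i * z j) + c * wt z ^ N)
      (stdGauss m) ∧
    ∫ z, (c₀ + ∑ j, a j * z j + ∑ i, ∑ j, M i j * (z i * z j) + c * wt z ^ N) ∂(stdGauss m)
      = c₀ + ∑ i, M i i + c * ∫ z, wt z ^ N ∂(stdGauss m) := by
  have h1 : ∀ j ∈ Finset.univ, Integrable (fun z => a j * z j) (stdGauss m) :=
    fun j _ => (integrable_eval_stdGauss j).const_mul _
  have h2 : ∀ i ∈ Finset.univ, ∀ j ∈ Finset.univ,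
      Integrable (fun z => M i j * (z i * z j)) (stdGauss m) :=
    fun i _ j _ => (integrable_eval_mul_eval_stdGauss i j).const_mul _
  have h3 : ∀ i ∈ Finset.univ,
      Integrable (fun z => ∑ j, M i j * (z i * z j)) (stdGauss m) :=
    fun i hi => integrable_finsetSum _ (h2 i hi)
  have h4 : Integrable (fun z => c₀ + ∑ j, a j * z j) (stdGauss m) :=
    (integrable_const _).add (integrable_finsetSum _ h1)
  have h5 := h4.add (integrable_finsetSum _ h3)
  have h6 : Integrable (fun z => c * wt z ^ N) (stdGauss m) := (integrable_wt_pow N).const_mul c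
  refine ⟨h5.add h6, ?_⟩
  have e1 := integral_add h5 h6
  have e2 := integral_add h4 (integrable_finsetSum _ h3)
  have e3 := integral_add (integrable_const c₀) (integrable_finsetSum _ h1)
  simp only [Pi.add_apply] at e1 e2 e3
  rw [e1, e2, e3, integral_finsetSum _ h1, integral_finsetSum _ h3, integral_const_mul]
  congr 1
  have : ∀ i : Fin m, ∫ z, ∑ j, M i j * (z i * z j) ∂(stdGauss m) = M i i := by
    intro i
    rw [integral_finsetSum _ (h2 i (Finset.mem_univ _))]
    simp [integral_const_mul, integral_eval_mul_eval_stdGauss]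
  simp [this, integral_const_mul, integral_eval_stdGauss]

end Gaussian

/-! ### One step of the scheme -/

section Step

variable {m d : ℕ}

/-- One step of length `τ` of a Milstein type scheme, with Brownian increment `b`. -/
def step (F : EuclideanSpace ℝ (Fin d) → EuclideanSpace ℝ (Fin d))
    (G : Fin m → EuclideanSpace ℝ (Fin d) → EuclideanSpace ℝ (Fin d))
    (L : Fin m → Fin m → EuclideanSpace ℝ (Fin d) → EuclideanSpace ℝ (Fin d))
    (τ : ℝ) (y : EuclideanSpace ℝ (Fin d)) (b : Fin m → ℝ) : EuclideanSpace ℝ (Fin d) :=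
  y + τ • F y + ∑ j, b j • G j y
    + (1 / 2 : ℝ) • ∑ i, ∑ j, (b i * b j - if i = j then τ else 0) • L i j y

variable {F : EuclideanSpace ℝ (Fin d) → EuclideanSpace ℝ (Fin d)}
  {G : Fin m → EuclideanSpace ℝ (Fin d) → EuclideanSpace ℝ (Fin d)}
  {L : Fin m → Fin m → EuclideanSpace ℝ (Fin d) → EuclideanSpace ℝ (Fin d)}

lemma measurable_step (hF : Measurable F) (hG : ∀ j, Measurable (G j))
    (hL : ∀ i j, Measurable (L i j)) (τ : ℝ) :
    Measurable fun z : EuclideanSpace ℝ (Fin d) × (Fin m → ℝ) => step F G L τ z.1 z.2 := by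
  unfold step
  fun_prop

lemma norm_sum_smul_le {v : Fin m → EuclideanSpace ℝ (Fin d)} {K : ℝ} (hK : 0 ≤ K)
    (hv : ∀ j, ‖v j‖ ≤ K) (z : Fin m → ℝ) : ‖∑ j, z j • v j‖ ≤ K * wt z := by
  calc ‖∑ j, z j • v j‖ ≤ ∑ j, |z j| * K := by
        refine (norm_sum_le _ _).trans (Finset.sum_le_sum fun j _ => ?_)
        rw [norm_smul, Real.norm_eq_abs]
        exact mul_le_mul_of_nonneg_left (hv j) (abs_nonneg _)
    _ = K * ∑ j, |z j| := by rw [← Finset.sum_mul, mul_comm]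
    _ ≤ K * wt z := by unfold wt; gcongr; linarith

/-- The `m` in the constant counts the diagonal compensators. This supplies the constant `C₁ = 2 +
m` for `norm_rpow_le_expansion`. -/
lemma norm_add_sum_sum_smul_le {u : EuclideanSpace ℝ (Fin d)}
    {v : Fin m → Fin m → EuclideanSpace ℝ (Fin d)} {K : ℝ} (hK : 0 ≤ K)
    (hu : ‖u‖ ≤ K) (hv : ∀ i j, ‖v i j‖ ≤ K) (z : Fin m → ℝ) :
    ‖u + (1 / 2 : ℝ) • ∑ i, ∑ j, (z i * z j - if i = j then 1 else 0) • v i j‖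
      ≤ (2 + m) * K * wt z ^ 2 := by
  have h1 : ‖∑ i, ∑ j, (z i * z j - if i = j then 1 else 0) • v i j‖
      ≤ ∑ i, ∑ j, (|z i| * |z j| + if i = j then 1 else 0) * K := by
    refine (norm_sum_le _ _).trans (Finset.sum_le_sum fun i _ => ?_)
    refine (norm_sum_le _ _).trans (Finset.sum_le_sum fun j _ => ?_)
    rw [norm_smul, Real.norm_eq_abs]
    have : |z i * z j - if i = j then 1 else 0| ≤ |z i| * |z j| + if i = j then 1 else 0 := by
      refine (abs_sub _ _).trans ?_
      rw [abs_mul]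
      split_ifs <;> simp
    exact mul_le_mul this (hv i j) (norm_nonneg _) (by split_ifs <;> positivity)
  have h2 : ∑ i, ∑ j, (|z i| * |z j| + if i = j then 1 else 0) * K
      = ((∑ j, |z j|) ^ 2 + m) * K := by
    simp_rw [← Finset.sum_mul, Finset.sum_add_distrib, ← Finset.mul_sum, ← Finset.sum_mul]
    simp [sq]
  have hS : 0 ≤ ∑ j, |z j| := Finset.sum_nonneg fun j _ => abs_nonneg _
  have hw : (∑ j, |z j|) ^ 2 ≤ wt z ^ 2 := by
    unfold wt; gcongr; linarith
  have hw1 : 1 ≤ wt z ^ 2 := one_le_pow₀ (one_le_wt z)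
  calc _ ≤ ‖u‖ + ‖(1 / 2 : ℝ) • ∑ i, ∑ j, (z i * z j - if i = j then 1 else 0) • v i j‖ :=
        norm_add_le _ _
    _ ≤ K + (1 / 2) * (((∑ j, |z j|) ^ 2 + m) * K) := by
        rw [norm_smul, Real.norm_of_nonneg (by norm_num : (0 : ℝ) ≤ 1 / 2), ← h2]
        gcongr
    _ ≤ 1 * K * wt z ^ 2 + (1 / 2) * ((wt z ^ 2 + m * wt z ^ 2) * K) := by
        have h5 : (m : ℝ) * 1 ≤ m * wt z ^ 2 := by gcongr
        have h6 : K * 1 ≤ K * wt z ^ 2 := by gcongr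
        have h7 : ((∑ j, |z j|) ^ 2 + m) * K ≤ (wt z ^ 2 + m * wt z ^ 2) * K := by
          gcongr; linarith
        linarith
    _ ≤ _ := by
        have h8 : 0 ≤ K * wt z ^ 2 := by positivity
        have h9 : 0 ≤ (m : ℝ) * (K * wt z ^ 2) := by positivity
        linarith

/-- Brownian scaling separates the orders: the noise enters at order `s`, while the drift and the
Milstein correction both enter at order `s²`. This is the shape required by
`norm_rpow_le_expansion`. -/
lemma step_scaled (s : ℝ) (y : EuclideanSpace ℝ (Fin d)) (z : Fin m → ℝ) :
    step F G L (s ^ 2) y (s • z) = y + (s • ∑ j, z j • G j y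
      + s ^ 2 • (F y + (1 / 2 : ℝ) • ∑ i, ∑ j, (z i * z j - if i = j then 1 else 0) • L i j y)) := by
  have h1 : ∑ j, (s • z) j • G j y = s • ∑ j, z j • G j y := by
    rw [Finset.smul_sum]
    exact Finset.sum_congr rfl fun j _ => by rw [Pi.smul_apply, smul_eq_mul, mul_smul]
  have h2 : ∑ i, ∑ j, ((s • z) i * (s • z) j - if i = j then s ^ 2 else 0) • L i j y
      = s ^ 2 • ∑ i, ∑ j, (z i * z j - if i = j then 1 else 0) • L i j y := by
    rw [Finset.smul_sum]
    refine Finset.sum_congr rfl fun i _ => ?_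
    rw [Finset.smul_sum]
    refine Finset.sum_congr rfl fun j _ => ?_
    rw [smul_smul]
    congr 1
    simp only [Pi.smul_apply, smul_eq_mul]
    split_ifs <;> ring
  rw [step, h1, h2]
  module

/-- A crude bound for a single step: the scheme has linear growth. -/
lemma norm_step_le {K : ℝ} (hK : 0 ≤ K) {s : ℝ} (hs : 0 ≤ s) (hs1 : s ≤ 1)
    {y : EuclideanSpace ℝ (Fin d)}
    (hF : ‖F y‖ ≤ K * ‖y‖) (hG : ∀ j, ‖G j y‖ ≤ K * ‖y‖) (hL : ∀ i j, ‖L i j y‖ ≤ K * ‖y‖)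
    (z : Fin m → ℝ) :
    ‖step F G L (s ^ 2) y (s • z)‖ ≤ (1 + (3 + m) * K) * ‖y‖ * wt z ^ 2 := by
  have hw := one_le_wt z
  have hKy : 0 ≤ K * ‖y‖ := by positivity
  have h1 := norm_sum_smul_le hKy hG z
  have h2 := norm_add_sum_sum_smul_le hKy hF hL z
  have h3 : wt z ≤ wt z ^ 2 := by nlinarith
  have hs2 : s ^ 2 ≤ 1 := pow_le_one₀ hs hs1
  rw [step_scaled]
  calc _ ≤ ‖y‖ + (‖s • ∑ j, z j • G j y‖ + ‖s ^ 2 • (F y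
        + (1 / 2 : ℝ) • ∑ i, ∑ j, (z i * z j - if i = j then 1 else 0) • L i j y)‖) :=
        (norm_add_le _ _).trans (by gcongr; exact norm_add_le _ _)
    _ ≤ ‖y‖ * wt z ^ 2 + (1 * (K * ‖y‖ * wt z ^ 2) + 1 * ((2 + m) * (K * ‖y‖) * wt z ^ 2)) := by
        rw [norm_smul, norm_smul, Real.norm_of_nonneg hs, Real.norm_of_nonneg (sq_nonneg s)]
        have h4 : ‖y‖ * 1 ≤ ‖y‖ * wt z ^ 2 := by gcongr; nlinarith
        have h5 : ‖∑ j, z j • G j y‖ ≤ K * ‖y‖ * wt z ^ 2 := h1.trans (by gcongr)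
        gcongr
        linarith
    _ = _ := by ring

/-- One step of the scheme from a unit vector contracts the `p`-th moment. -/
lemma lintegral_unit_step_le {p : ℝ} (hp : 0 < p) (m d : ℕ) :
    ∃ C : ℝ, 0 ≤ C ∧ ∀ (e F : EuclideanSpace ℝ (Fin d)) (G : Fin m → EuclideanSpace ℝ (Fin d))
      (L : Fin m → Fin m → EuclideanSpace ℝ (Fin d)) (K s lam : ℝ), ‖e‖ = 1 → 1 ≤ K → 0 ≤ s →
      s ≤ 1 → K * s ≤ 1 → ‖F‖ ≤ K → (∀ j, ‖G j‖ ≤ K) → (∀ i j, ‖L i j‖ ≤ K) →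
      inner ℝ e F + 1 / 2 * ∑ j, ‖G j‖ ^ 2 + (p / 2 - 1) * ∑ j, (inner ℝ e (G j)) ^ 2 ≤ -lam →
      ∫⁻ z, ‖e + (s • ∑ j, z j • G j + s ^ 2 • (F
        + (1 / 2 : ℝ) • ∑ i, ∑ j, (z i * z j - if i = j then 1 else 0) • L i j))‖ₑ ^ p
        ∂(stdGauss m) ≤ ENNReal.ofReal (1 - p * lam * s ^ 2 + C * (K * s) ^ 3) := by
  obtain ⟨C, hC, N, hexp⟩ := norm_rpow_le_expansion (E := EuclideanSpace ℝ (Fin d)) hp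
    (C₁ := 2 + m) (by positivity)
  set W := ∫ z, wt z ^ N ∂(stdGauss m) with hW
  have hW0 : 0 ≤ W := integral_nonneg fun z => pow_nonneg (zero_le_one.trans (one_le_wt z)) _
  refine ⟨C * W, by positivity, ?_⟩
  intro e F G L K s lam he hK hs hs1 hKs hF hG hL hdiss
  have hK0 : 0 ≤ K := by linarith
  -- The majorant is sorted by degree in `z`. After integration `a` disappears and only the diagonal
  -- of `M` remains; its terms `⟨e, L i i⟩` cancel those in `c₀`, because the Milstein correction is
  -- centred.
  set c₀ : ℝ := 1 + p / 2 * (2 * s ^ 2 * inner ℝ e F - s ^ 2 * ∑ i, inner ℝ e (L i i)) with hc₀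
  set a : Fin m → ℝ := fun j => p / 2 * (2 * s * inner ℝ e (G j)) with ha
  set M : Fin m → Fin m → ℝ := fun i j => p / 2 * (s ^ 2 * inner ℝ e (L i j)
    + s ^ 2 * inner ℝ (G i) (G j)) + p / 2 * (p / 2 - 1) / 2 * (4 * s ^ 2 *
      (inner ℝ e (G i) * inner ℝ e (G j))) with hM
  obtain ⟨hint, hval⟩ := integral_quadratic_stdGauss c₀ (C * (K * s) ^ 3) a M N
  have hpt : ∀ z : Fin m → ℝ, ‖e + (s • ∑ j, z j • G j + s ^ 2 • (F
        + (1 / 2 : ℝ) • ∑ i, ∑ j, (z i * z j - if i = j then 1 else 0) • L i j))‖ ^ p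
      ≤ c₀ + ∑ j, a j * z j + ∑ i, ∑ j, M i j * (z i * z j) + C * (K * s) ^ 3 * wt z ^ N := by
    intro z
    refine (hexp e _ _ K s (wt z) he hK hs hs1 hKs (one_le_wt z) (norm_sum_smul_le hK0 hG z)
      (norm_add_sum_sum_smul_le hK0 hF hL z)).trans (le_of_eq ?_)
    have i1 : inner ℝ e (∑ j, z j • G j) = ∑ j, z j * inner ℝ e (G j) := by
      simp [inner_sum, inner_smul_right]
    have i2 : inner ℝ e (F + (1 / 2 : ℝ) • ∑ i, ∑ j, (z i * z j - if i = j then 1 else 0) • L i j)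
        = inner ℝ e F + 1 / 2 * (∑ i, ∑ j, (z i * z j) * inner ℝ e (L i j)
          - ∑ i, inner ℝ e (L i i)) := by
      simp [inner_add_right, inner_sum, inner_smul_right, sub_mul, Finset.sum_sub_distrib]
    have i3 : ‖∑ j, z j • G j‖ ^ 2 = ∑ i, ∑ j, (z i * z j) * inner ℝ (G i) (G j) := by
      rw [← real_inner_self_eq_norm_sq, sum_inner]
      refine Finset.sum_congr rfl fun i _ => ?_
      rw [inner_sum]
      refine Finset.sum_congr rfl fun j _ => ?_
      rw [inner_smul_left, inner_smul_right]; simp; ring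
    have i4 : (∑ j, z j * inner ℝ e (G j)) ^ 2
        = ∑ i, ∑ j, (z i * z j) * (inner ℝ e (G i) * inner ℝ e (G j)) := by
      rw [sq, Finset.sum_mul_sum]
      exact Finset.sum_congr rfl fun i _ => Finset.sum_congr rfl fun j _ => by ring
    have j1 : ∑ j, a j * z j = p / 2 * (2 * s * ∑ j, z j * inner ℝ e (G j)) := by
      simp only [ha, Finset.mul_sum]
      exact Finset.sum_congr rfl fun j _ => by ring
    have j2 : ∑ i, ∑ j, M i j * (z i * z j)
        = p / 2 * (s ^ 2 * ∑ i, ∑ j, (z i * z j) * inner ℝ e (L i j)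
          + s ^ 2 * ∑ i, ∑ j, (z i * z j) * inner ℝ (G i) (G j))
          + p / 2 * (p / 2 - 1) / 2 * (4 * s ^ 2 *
            ∑ i, ∑ j, (z i * z j) * (inner ℝ e (G i) * inner ℝ e (G j))) := by
      simp only [hM, Finset.mul_sum, ← Finset.sum_add_distrib]
      exact Finset.sum_congr rfl fun i _ => Finset.sum_congr rfl fun j _ => by ring
    rw [i1, i2, i3, i4, j1, j2, hc₀]
    ring
  calc _ ≤ ∫⁻ z, ENNReal.ofReal (c₀ + ∑ j, a j * z j + ∑ i, ∑ j, M i j * (z i * z j)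
        + C * (K * s) ^ 3 * wt z ^ N) ∂(stdGauss m) := by
        refine lintegral_mono fun z => ?_
        rw [← ofReal_norm, ENNReal.ofReal_rpow_of_nonneg (norm_nonneg _) hp.le]
        exact ENNReal.ofReal_le_ofReal (hpt z)
    _ = ENNReal.ofReal (c₀ + ∑ i, M i i + C * (K * s) ^ 3 * W) := by
        rw [← ofReal_integral_eq_lintegral_ofReal hint, hval]
        -- The majorant is nonnegative because it dominates a power of a norm.
        exact ae_of_all _ fun z => le_trans (by positivity) (hpt z)
    _ ≤ _ := by
        refine ENNReal.ofReal_le_ofReal ?_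
        have j3 : ∑ i, M i i = p / 2 * (s ^ 2 * ∑ i, inner ℝ e (L i i)
          + s ^ 2 * ∑ j, ‖G j‖ ^ 2) + p / 2 * (p / 2 - 1) / 2 * (4 * s ^ 2 *
            ∑ j, (inner ℝ e (G j)) ^ 2) := by
          simp only [hM, Finset.mul_sum, ← Finset.sum_add_distrib, real_inner_self_eq_norm_sq]
          exact Finset.sum_congr rfl fun i _ => by ring
        rw [j3, hc₀]
        -- The surviving second order coefficient is exactly `p s²` times the left side of `hdiss`.
        have := mul_le_mul_of_nonneg_left hdiss (by positivity : 0 ≤ p * s ^ 2)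
        nlinarith [this]

end Step

/-! ### One-step moment bounds from an arbitrary starting point. -/

section StepMoments

variable {m d : ℕ}
  {F : EuclideanSpace ℝ (Fin d) → EuclideanSpace ℝ (Fin d)}
  {G : Fin m → EuclideanSpace ℝ (Fin d) → EuclideanSpace ℝ (Fin d)}
  {L : Fin m → Fin m → EuclideanSpace ℝ (Fin d) → EuclideanSpace ℝ (Fin d)}

/-- Here the alternative `2 ≤ p` or `d = 1` takes effect. As `1/2 + (p/2 - 1) = (p - 1)/2`, it
suffices to replace `⟨e, G j⟩²` by `‖G j‖²`. For `p ≥ 2` this is Cauchy–Schwarz with a nonnegative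
coefficient; for `d = 1` Cauchy–Schwarz is an equality and the sign of `p/2 - 1` is irrelevant. -/
lemma sum_norm_inner_le {p lam : ℝ} (hpd : 2 ≤ p ∨ d = 1)
    {e F : EuclideanSpace ℝ (Fin d)} {G : Fin m → EuclideanSpace ℝ (Fin d)} (he : ‖e‖ = 1)
    (hdiss : inner ℝ e F + (p - 1) / 2 * ∑ j, ‖G j‖ ^ 2 ≤ -lam) :
    inner ℝ e F + 1 / 2 * ∑ j, ‖G j‖ ^ 2 + (p / 2 - 1) * ∑ j, (inner ℝ e (G j)) ^ 2 ≤ -lam := by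
  have key : (p / 2 - 1) * ∑ j, (inner ℝ e (G j)) ^ 2 ≤ (p / 2 - 1) * ∑ j, ‖G j‖ ^ 2 := by
    rcases hpd with hp | rfl
    · refine mul_le_mul_of_nonneg_left (Finset.sum_le_sum fun j _ => ?_) (by linarith)
      rw [← sq_abs (inner ℝ e (G j))]
      have := abs_real_inner_le_norm e (G j)
      rw [he, one_mul] at this
      gcongr
    · refine le_of_eq ?_
      congr 1
      refine Finset.sum_congr rfl fun j _ => ?_
      have h2 : ‖e‖ ^ 2 = 1 := by rw [he]; norm_num
      simp only [EuclideanSpace.norm_sq_eq, PiLp.inner_apply, Fin.sum_univ_one, Real.norm_eq_abs,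
        sq_abs, RCLike.inner_apply, conj_trivial] at h2 ⊢
      rw [mul_pow, h2, mul_one]
  linarith

/-- One step of the scheme contracts the `p`-th moment. -/
lemma lintegral_step_le {p : ℝ} (hp : 0 < p) (m d : ℕ) (hpd : 2 ≤ p ∨ d = 1) :
    ∃ C : ℝ, 0 ≤ C ∧ ∀ (F : EuclideanSpace ℝ (Fin d) → EuclideanSpace ℝ (Fin d))
      (G : Fin m → EuclideanSpace ℝ (Fin d) → EuclideanSpace ℝ (Fin d))
      (L : Fin m → Fin m → EuclideanSpace ℝ (Fin d) → EuclideanSpace ℝ (Fin d))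
      (K s lam : ℝ) (y : EuclideanSpace ℝ (Fin d)), 1 ≤ K → 0 ≤ s → s ≤ 1 → K * s ≤ 1 →
      ‖F y‖ ≤ K * ‖y‖ → (∀ j, ‖G j y‖ ≤ K * ‖y‖) → (∀ i j, ‖L i j y‖ ≤ K * ‖y‖) →
      inner ℝ y (F y) + (p - 1) / 2 * ∑ j, ‖G j y‖ ^ 2 ≤ -lam * ‖y‖ ^ 2 →
      ∫⁻ z, ‖step F G L (s ^ 2) y (s • z)‖ₑ ^ p ∂(stdGauss m)
        ≤ ‖y‖ₑ ^ p * ENNReal.ofReal (Real.exp (-p * lam * s ^ 2 + C * (K * s) ^ 3)) := by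
  obtain ⟨C, hC, h⟩ := lintegral_unit_step_le hp m d
  refine ⟨C, hC, ?_⟩
  intro F G L K s lam y hK hs hs1 hKs hF hG hL hdiss
  -- The origin cannot be normalised, but linear growth makes it a fixed point of the step.
  rcases eq_or_ne y 0 with rfl | hy
  · have hw : ∀ z, ‖step F G L (s ^ 2) 0 (s • z)‖ₑ ^ p = 0 := fun z => by
      have := norm_step_le (by linarith) hs hs1 hF hG hL z
      rw [norm_zero, mul_zero, zero_mul] at this
      rw [norm_le_zero_iff.1 this]
      simp [hp]
    simp [hw]
  have hr : 0 < ‖y‖ := norm_pos_iff.2 hy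
  set r := ‖y‖ with hrdef
  have hn : ∀ v : EuclideanSpace ℝ (Fin d), ‖v‖ ≤ K * r → ‖r⁻¹ • v‖ ≤ K := fun v hv => by
    rw [norm_smul, norm_inv, Real.norm_of_nonneg hr.le, inv_mul_le_iff₀ hr, mul_comm r]
    exact hv
  have he : ‖r⁻¹ • y‖ = 1 := by
    rw [norm_smul, norm_inv, Real.norm_of_nonneg hr.le, ← hrdef, inv_mul_cancel₀ hr.ne']
  have hd : inner ℝ (r⁻¹ • y) (r⁻¹ • F y) + (p - 1) / 2 * ∑ j, ‖r⁻¹ • G j y‖ ^ 2 ≤ -lam := by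
    have : inner ℝ (r⁻¹ • y) (r⁻¹ • F y) + (p - 1) / 2 * ∑ j, ‖r⁻¹ • G j y‖ ^ 2
        = (inner ℝ y (F y) + (p - 1) / 2 * ∑ j, ‖G j y‖ ^ 2) / r ^ 2 := by
      simp only [inner_smul_left, inner_smul_right, norm_smul, norm_inv,
        Real.norm_of_nonneg hr.le, mul_pow, ← Finset.mul_sum, conj_trivial]
      field_simp
    rw [this, div_le_iff₀ (by positivity)]
    exact hdiss
  have := h (r⁻¹ • y) (r⁻¹ • F y) (fun j => r⁻¹ • G j y) (fun i j => r⁻¹ • L i j y) K s lam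
    he hK hs hs1 hKs (hn _ hF) (fun j => hn _ (hG j)) (fun i j => hn _ (hL i j))
    (sum_norm_inner_le hpd he hd)
  have hstep : ∀ z, ‖step F G L (s ^ 2) y (s • z)‖ₑ ^ p = ‖y‖ₑ ^ p *
      ‖r⁻¹ • y + (s • ∑ j, z j • r⁻¹ • G j y + s ^ 2 • (r⁻¹ • F y
        + (1 / 2 : ℝ) • ∑ i, ∑ j, (z i * z j - if i = j then 1 else 0) • r⁻¹ • L i j y))‖ₑ ^ p := by
    intro z
    have e1 : ∑ j, z j • r⁻¹ • G j y = r⁻¹ • ∑ j, z j • G j y := by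
      simp_rw [smul_comm _ r⁻¹, ← Finset.smul_sum]
    have e2 : ∑ i, ∑ j, (z i * z j - if i = j then 1 else 0) • r⁻¹ • L i j y
        = r⁻¹ • ∑ i, ∑ j, (z i * z j - if i = j then 1 else 0) • L i j y := by
      simp_rw [smul_comm _ r⁻¹, ← Finset.smul_sum]
    have e3 : step F G L (s ^ 2) y (s • z) = r • (r⁻¹ • y + (s • ∑ j, z j • r⁻¹ • G j y
        + s ^ 2 • (r⁻¹ • F y + (1 / 2 : ℝ) • ∑ i, ∑ j,
          (z i * z j - if i = j then 1 else 0) • r⁻¹ • L i j y))) := by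
      rw [step_scaled, e1, e2, smul_comm s, smul_comm (1 / 2 : ℝ), ← smul_add, smul_comm (s ^ 2),
        ← smul_add, ← smul_add, smul_inv_smul₀ hr.ne']
    rw [e3, enorm_smul, ENNReal.mul_rpow_of_nonneg _ _ hp.le, hrdef, enorm_norm]
  simp_rw [hstep]
  rw [lintegral_const_mul' _ _ (ENNReal.rpow_ne_top_of_nonneg hp.le enorm_ne_top)]
  gcongr
  refine this.trans (ENNReal.ofReal_le_ofReal ?_)
  -- The exponential form `1 + x ≤ exp x` is what makes iteration over the steps multiplicative.
  have := Real.add_one_le_exp (-p * lam * s ^ 2 + C * (K * s) ^ 3)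
  linarith

/-- One step of the scheme preserves finiteness of moments of all orders. -/
lemma lintegral_step_le_mul {q : ℝ} (hq : 0 ≤ q) (m : ℕ) {K : ℝ} (hK : 0 ≤ K) :
    ∃ M : ℝ≥0∞, M ≠ ∞ ∧ ∀ (d : ℕ) (F : EuclideanSpace ℝ (Fin d) → EuclideanSpace ℝ (Fin d))
      (G : Fin m → EuclideanSpace ℝ (Fin d) → EuclideanSpace ℝ (Fin d))
      (L : Fin m → Fin m → EuclideanSpace ℝ (Fin d) → EuclideanSpace ℝ (Fin d))
      (s : ℝ) (y : EuclideanSpace ℝ (Fin d)), 0 ≤ s → s ≤ 1 →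
      ‖F y‖ ≤ K * ‖y‖ → (∀ j, ‖G j y‖ ≤ K * ‖y‖) → (∀ i j, ‖L i j y‖ ≤ K * ‖y‖) →
      ∫⁻ z, ‖step F G L (s ^ 2) y (s • z)‖ₑ ^ q ∂(stdGauss m) ≤ ‖y‖ₑ ^ q * M := by
  -- The weight is at least `1`, so the exponent may be raised to a natural number, for which
  -- Gaussian integrability is known.
  obtain ⟨n, hn⟩ := exists_nat_ge q
  set c := ENNReal.ofReal (1 + (3 + m) * K) with hc
  refine ⟨c ^ q * ENNReal.ofReal (∫ z, wt z ^ (2 * n) ∂(stdGauss m)),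
    ENNReal.mul_ne_top (ENNReal.rpow_ne_top_of_nonneg hq ENNReal.ofReal_ne_top)
      ENNReal.ofReal_ne_top, ?_⟩
  intro d F G L s y hs hs1 hF hG hL
  have hpt : ∀ z, ‖step F G L (s ^ 2) y (s • z)‖ₑ ^ q
      ≤ ‖y‖ₑ ^ q * c ^ q * ENNReal.ofReal (wt z ^ (2 * n)) := by
    intro z
    have hw := one_le_wt z
    have h1 : ‖step F G L (s ^ 2) y (s • z)‖ₑ ≤ ‖y‖ₑ * c * ENNReal.ofReal (wt z ^ 2) := by
      rw [← ofReal_norm, ← ofReal_norm, hc, ← ENNReal.ofReal_mul (norm_nonneg _),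
        ← ENNReal.ofReal_mul (by positivity)]
      refine ENNReal.ofReal_le_ofReal ((norm_step_le hK hs hs1 hF hG hL z).trans (le_of_eq ?_))
      ring
    calc _ ≤ (‖y‖ₑ * c * ENNReal.ofReal (wt z ^ 2)) ^ q := ENNReal.rpow_le_rpow h1 hq
      _ = ‖y‖ₑ ^ q * c ^ q * ENNReal.ofReal (wt z ^ 2) ^ q := by
        rw [ENNReal.mul_rpow_of_nonneg _ _ hq, ENNReal.mul_rpow_of_nonneg _ _ hq]
      _ ≤ ‖y‖ₑ ^ q * c ^ q * ENNReal.ofReal (wt z ^ 2) ^ (n : ℝ) := by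
        gcongr
        rw [ENNReal.one_le_ofReal]
        exact one_le_pow₀ hw
      _ = _ := by
        rw [ENNReal.rpow_natCast, ← ENNReal.ofReal_pow (by positivity), ← pow_mul]
  calc _ ≤ ∫⁻ z, ‖y‖ₑ ^ q * c ^ q * ENNReal.ofReal (wt z ^ (2 * n)) ∂(stdGauss m) :=
        lintegral_mono hpt
    _ = _ := by
      rw [lintegral_const_mul _ ((measurable_wt.pow_const _).ennreal_ofReal),
        ofReal_integral_eq_lintegral_ofReal (integrable_wt_pow _), mul_assoc]
      exact ae_of_all _ fun z => pow_nonneg (zero_le_one.trans (one_le_wt z)) _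

end StepMoments

/-! ### Increments of Brownian motion -/

section Increments

variable {Ω : Type*} {mΩ : MeasurableSpace Ω} {P : Measure Ω} {ℱ : Filtration ℝ≥0 mΩ} {m d : ℕ}
  {B : ℝ≥0 → Ω → (Fin m → ℝ)}

lemma IsBrownianMotion.measurable (hB : IsBrownianMotion ℱ P B) (t : ℝ≥0) : Measurable (B t) :=
  (hB.adapted t).mono (ℱ.le t) le_rfl

lemma IsBrownianMotion.measurable_sub (hB : IsBrownianMotion ℱ P B) (s t : ℝ≥0) :
    Measurable fun ω => B t ω - B s ω :=
  (hB.measurable t).sub (hB.measurable s)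

lemma stdGauss_map_smul (c : ℝ) :
    (stdGauss m).map (fun z => c • z)
      = Measure.pi fun _ => gaussianReal 0 (NNReal.mk (c ^ 2) (sq_nonneg c)) := by
  have h : (gaussianReal 0 1).map (fun x => c * x) = gaussianReal 0 (NNReal.mk (c ^ 2) (sq_nonneg c)) := by
    rw [gaussianReal_map_const_mul]; simp
  have : SigmaFinite ((gaussianReal 0 1).map (fun x => c * x)) := by rw [h]; infer_instance
  have h2 := Measure.pi_map_pi (μ := fun _ : Fin m => gaussianReal 0 1)
    (f := fun _ x => c * x) (by fun_prop)
  simp only [h] at h2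
  exact h2

/-- Independent coordinates with Gaussian increments give a product law. Writing it as the image of
the fixed measure `stdGauss` under scaling lets increments of every length be treated with one set
of Gaussian moments, including `s = t`. -/
lemma IsBrownianMotion.map_sub [IsProbabilityMeasure P] (hB : IsBrownianMotion ℱ P B) {s t : ℝ≥0}
    (hst : s ≤ t) :
    P.map (fun ω => B t ω - B s ω) = (stdGauss m).map (fun z => √((t : ℝ) - s) • z) := by
  have hind : iIndepFun (fun (j : Fin m) ω => B t ω j - B s ω j) P :=
    hB.indep_coord.comp (fun _ x => x t - x s) (fun _ => by fun_prop)
  have hm : ∀ j : Fin m, Measurable fun ω => B t ω j - B s ω j := fun j =>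
    (measurable_pi_apply j).comp (hB.measurable_sub s t)
  have h1 := (iIndepFun_iff_map_fun_eq_pi_map (fun j => (hm j).aemeasurable)).1 hind
  rw [stdGauss_map_smul]
  refine Eq.trans h1 ?_
  congr 1
  funext j
  have := ((hB.isBrownianReal j).hasLaw_sub t s).map_eq
  refine Eq.trans this ?_
  congr 1
  ext
  have h0 : (0 : ℝ) ≤ t - s := sub_nonneg.2 (by exact_mod_cast hst)
  change |(t : ℝ) - s| = √((t : ℝ) - s) ^ 2
  rw [abs_of_nonneg h0, Real.sq_sqrt h0]

lemma IsBrownianMotion.indepFun_sub (hB : IsBrownianMotion ℱ P B) {s t : ℝ≥0} (hst : s ≤ t)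
    {E : Type*} [MeasurableSpace E] {X : Ω → E} (hX : Measurable[ℱ s] X) :
    IndepFun X (fun ω => B t ω - B s ω) P := by
  rw [IndepFun_iff_Indep]
  exact indep_of_indep_of_le_left (hB.indep_increment s t hst).symm hX.comap_le

/-- The Markov property in the form used below: the joint law of `X` and the later increment is a
product, so `X` may be frozen. Lower integrals make this free of integrability conditions. -/
lemma IsBrownianMotion.lintegral_comp [IsProbabilityMeasure P] (hB : IsBrownianMotion ℱ P B)
    {s t : ℝ≥0} (hst : s ≤ t) {E : Type*} [MeasurableSpace E] {X : Ω → E} (hX : Measurable[ℱ s] X)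
    {Ψ : E × (Fin m → ℝ) → ℝ≥0∞} (hΨ : Measurable Ψ) :
    ∫⁻ ω, Ψ (X ω, B t ω - B s ω) ∂P
      = ∫⁻ ω, ∫⁻ z, Ψ (X ω, √((t : ℝ) - s) • z) ∂(stdGauss m) ∂P := by
  have hX' : Measurable X := hX.mono (ℱ.le s) le_rfl
  have h1 := (indepFun_iff_map_prod_eq_prod_map_map hX'.aemeasurable
    (hB.measurable_sub s t).aemeasurable).1 (hB.indepFun_sub hst hX)
  have hsm : Measurable fun z : Fin m → ℝ => √((t : ℝ) - s) • z := by fun_prop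
  have : IsProbabilityMeasure (P.map X) := Measure.isProbabilityMeasure_map hX'.aemeasurable
  have : IsProbabilityMeasure ((stdGauss m).map fun z => √((t : ℝ) - s) • z) :=
    Measure.isProbabilityMeasure_map hsm.aemeasurable
  calc ∫⁻ ω, Ψ (X ω, B t ω - B s ω) ∂P
      = ∫⁻ x, Ψ x ∂(P.map fun ω => (X ω, B t ω - B s ω)) :=
        (lintegral_map hΨ (hX'.prodMk (hB.measurable_sub s t))).symm
    _ = ∫⁻ x, ∫⁻ b, Ψ (x, b) ∂((stdGauss m).map fun z => √((t : ℝ) - s) • z) ∂(P.map X) := by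
        rw [h1, hB.map_sub hst, lintegral_prod _ hΨ.aemeasurable]
    _ = ∫⁻ ω, ∫⁻ b, Ψ (X ω, b) ∂((stdGauss m).map fun z => √((t : ℝ) - s) • z) ∂P :=
        lintegral_map hΨ.lintegral_prod_right' hX'
    _ = _ := by
        refine lintegral_congr fun ω => ?_
        exact lintegral_map (hΨ.comp measurable_prodMk_left) hsm

end Increments

/-! ### Truncated coefficients -/

section Trunc

variable {m d : ℕ}

/-- Outside the ball `trunc r (g i)` contributes the factor `‖x‖ / r`, while the derivative is
evaluated at the projected point without rescaling. The product therefore has the same radial form,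
and bounds and symmetry of `Lop` pass to the truncated operator. -/
lemma truncLop_eq_trunc (r : ℝ)
    (g : Fin m → EuclideanSpace ℝ (Fin d) → EuclideanSpace ℝ (Fin d)) (i j : Fin m) :
    truncLop r g i j = trunc r (Lop g i j) := by
  funext x
  unfold truncLop trunc truncDcol Lop
  by_cases hx : ‖x‖ ≤ r
  · simp only [hx, if_true, min_eq_left]
    rcases eq_or_ne x 0 with rfl | h0
    · simp
    · rw [div_self (norm_ne_zero_iff.2 h0), one_smul]
  · simp only [hx, if_false, min_eq_right (le_of_not_ge hx)]
    rw [Finset.smul_sum]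
    refine Finset.sum_congr rfl fun l _ => ?_
    rw [PiLp.smul_apply, smul_eq_mul, mul_smul]

variable {r K : ℝ} {F : EuclideanSpace ℝ (Fin d) → EuclideanSpace ℝ (Fin d)}

/-- A Lipschitz field vanishing at `0` is linearly bounded on the ball, and a radial extension of
degree one keeps the same constant. -/
lemma norm_trunc_le (hr : 0 < r) (hF0 : F 0 = 0)
    (hF : ∀ x y, ‖x‖ ≤ r → ‖y‖ ≤ r → ‖F x - F y‖ ≤ K * ‖x - y‖)
    (x : EuclideanSpace ℝ (Fin d)) : ‖trunc r F x‖ ≤ K * ‖x‖ := by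
  have h0 : ∀ y, ‖y‖ ≤ r → ‖F y‖ ≤ K * ‖y‖ := fun y hy => by
    simpa [hF0] using hF y 0 hy (by simpa using hr.le)
  unfold trunc
  split_ifs with hx
  · exact h0 x hx
  · have hx0 : 0 < ‖x‖ := hr.trans (not_le.1 hx)
    have hn : ‖(r / ‖x‖) • x‖ = r := by
      rw [norm_smul, Real.norm_of_nonneg (by positivity), div_mul_cancel₀ _ hx0.ne']
    rw [norm_smul, Real.norm_of_nonneg (by positivity)]
    calc ‖x‖ / r * ‖F ((r / ‖x‖) • x)‖ ≤ ‖x‖ / r * (K * r) := by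
          have := h0 _ hn.le
          rw [hn] at this
          gcongr
      _ = K * ‖x‖ := by field_simp

lemma measurable_trunc (hr : 0 < r)
    (hF : ∀ x y, ‖x‖ ≤ r → ‖y‖ ≤ r → ‖F x - F y‖ ≤ K * ‖x - y‖) : Measurable (trunc r F) := by
  have hcont : ContinuousOn F (Metric.closedBall 0 r) := by
    have : LipschitzOnWith K.toNNReal F (Metric.closedBall 0 r) :=
      LipschitzOnWith.of_dist_le_mul fun x hx y hy => by
        rw [dist_eq_norm, dist_eq_norm]
        refine (hF x y (by simpa using hx) (by simpa using hy)).trans ?_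
        gcongr
        exact Real.le_coe_toNNReal K
    exact this.continuousOn
  have hmeas : Measurable ((Metric.closedBall (0 : EuclideanSpace ℝ (Fin d)) r).indicator F) :=
    by
    classical
    rw [← Set.piecewise_eq_indicator]
    exact hcont.measurable_piecewise continuousOn_const measurableSet_closedBall
  -- `F` is known to be continuous only on the ball, but `trunc` evaluates it only there, so the
  -- measurable indicator version can replace it.
  have heq : trunc r F = fun x => if ‖x‖ ≤ r then
      (Metric.closedBall (0 : EuclideanSpace ℝ (Fin d)) r).indicator F x
      else (‖x‖ / r) • (Metric.closedBall (0 : EuclideanSpace ℝ (Fin d)) r).indicator F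
        ((r / ‖x‖) • x) := by
    funext x
    unfold trunc
    split_ifs with hx
    · rw [Set.indicator_of_mem (by simpa using hx)]
    · have hx0 : 0 < ‖x‖ := hr.trans (not_le.1 hx)
      rw [Set.indicator_of_mem]
      rw [mem_closedBall_zero_iff, norm_smul, Real.norm_of_nonneg (by positivity),
        div_mul_cancel₀ _ hx0.ne']
  rw [heq]
  refine Measurable.ite (measurableSet_le measurable_norm measurable_const) hmeas ?_
  exact (measurable_norm.div_const r).smul
    (hmeas.comp ((measurable_const.div measurable_norm).smul measurable_id))

/-- The truncated coefficients inherit the dissipativity condition. -/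
lemma trunc_dissipative (hr : 0 < r) {G : Fin m → EuclideanSpace ℝ (Fin d) →
    EuclideanSpace ℝ (Fin d)} {c lam : ℝ}
    (h : ∀ x, inner ℝ x (F x) + c * ∑ j, ‖G j x‖ ^ 2 ≤ -lam * ‖x‖ ^ 2)
    (x : EuclideanSpace ℝ (Fin d)) :
    inner ℝ x (trunc r F x) + c * ∑ j, ‖trunc r (G j) x‖ ^ 2 ≤ -lam * ‖x‖ ^ 2 := by
  unfold trunc
  by_cases hx : ‖x‖ ≤ r
  · simpa only [hx, if_true] using h x
  · have hx0 : 0 < ‖x‖ := hr.trans (not_le.1 hx)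
    simp only [hx, if_false]
    have hxy : x = (‖x‖ / r) • (r / ‖x‖) • x := by
      rw [smul_smul, div_mul_div_cancel₀ hr.ne', div_self hx0.ne', one_smul]
    have hn : ‖(r / ‖x‖) • x‖ = r := by
      rw [norm_smul, Real.norm_of_nonneg (by positivity), div_mul_cancel₀ _ hx0.ne']
    set y := (r / ‖x‖) • x with hy
    -- Every term of the inequality at `x` is `(‖x‖ / r)²` times the corresponding term at the
    -- projected point `y`.
    have h1 : inner ℝ x ((‖x‖ / r) • F y) = (‖x‖ / r) ^ 2 * inner ℝ y (F y) := by
      nth_rewrite 1 [hxy]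
      rw [inner_smul_left, inner_smul_right]
      simp; ring
    have h2 : ∑ j, ‖(‖x‖ / r) • G j y‖ ^ 2 = (‖x‖ / r) ^ 2 * ∑ j, ‖G j y‖ ^ 2 := by
      rw [Finset.mul_sum]
      refine Finset.sum_congr rfl fun j _ => ?_
      rw [norm_smul, mul_pow, Real.norm_of_nonneg (by positivity)]
    have h3 := mul_le_mul_of_nonneg_left (h y) (sq_nonneg (‖x‖ / r))
    rw [hn] at h3
    have h4 : (‖x‖ / r) ^ 2 * (-lam * r ^ 2) = -lam * ‖x‖ ^ 2 := by field_simp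
    rw [h1, h2]
    linarith

end Trunc

/-! ### The scheme as a Markov chain and its moments -/

section Chain

variable {Ω : Type*} {mΩ : MeasurableSpace Ω} {P : Measure Ω} {ℱ : Filtration ℝ≥0 mΩ} {m d : ℕ}
  {B : ℝ≥0 → Ω → (Fin m → ℝ)}

/-- Measurable coefficients of linear growth. -/
structure LinearGrowth (F : EuclideanSpace ℝ (Fin d) → EuclideanSpace ℝ (Fin d))
    (G : Fin m → EuclideanSpace ℝ (Fin d) → EuclideanSpace ℝ (Fin d))
    (L : Fin m → Fin m → EuclideanSpace ℝ (Fin d) → EuclideanSpace ℝ (Fin d)) (K : ℝ) : Prop where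
  measurable_drift : Measurable F
  measurable_diffusion : ∀ j, Measurable (G j)
  measurable_second : ∀ i j, Measurable (L i j)
  norm_drift_le : ∀ y, ‖F y‖ ≤ K * ‖y‖
  norm_diffusion_le : ∀ j y, ‖G j y‖ ≤ K * ‖y‖
  norm_second_le : ∀ i j y, ‖L i j y‖ ≤ K * ‖y‖

section Abstract

variable {F : EuclideanSpace ℝ (Fin d) → EuclideanSpace ℝ (Fin d)}
  {G : Fin m → EuclideanSpace ℝ (Fin d) → EuclideanSpace ℝ (Fin d)}
  {L : Fin m → Fin m → EuclideanSpace ℝ (Fin d) → EuclideanSpace ℝ (Fin d)} {K : ℝ}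

lemma LinearGrowth.measurable_step {𝒜 : MeasurableSpace Ω} (hL : LinearGrowth F G L K)
    {X : Ω → EuclideanSpace ℝ (Fin d)} {b : Ω → Fin m → ℝ} (hX : Measurable X) (hb : Measurable b)
    (τ : ℝ) : Measurable fun ω => step F G L τ (X ω) (b ω) := by
  have h1 := MTMilstein.measurable_step hL.measurable_drift hL.measurable_diffusion
    hL.measurable_second τ
  have h2 : Measurable fun ω => (X ω, b ω) := hX.prodMk hb
  exact Measurable.comp (f := fun ω => (X ω, b ω)) h1 h2

lemma LinearGrowth.lintegral_step_eq [IsProbabilityMeasure P] (hL : LinearGrowth F G L K)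
    (hB : IsBrownianMotion ℱ P B) {s t : ℝ≥0} (hst : s ≤ t)
    {X : Ω → EuclideanSpace ℝ (Fin d)} (hX : Measurable[ℱ s] X) (q : ℝ) :
    ∫⁻ ω, ‖step F G L ((t : ℝ) - s) (X ω) (B t ω - B s ω)‖ₑ ^ q ∂P
      = ∫⁻ ω, ∫⁻ z, ‖step F G L (√((t : ℝ) - s) ^ 2) (X ω) (√((t : ℝ) - s) • z)‖ₑ ^ q
          ∂(stdGauss m) ∂P := by
  rw [Real.sq_sqrt (sub_nonneg.2 (by exact_mod_cast hst))]
  exact hB.lintegral_comp hst hX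
    (((MTMilstein.measurable_step hL.measurable_drift hL.measurable_diffusion hL.measurable_second
      ((t : ℝ) - s)).enorm).pow_const q)

/-- The constant depends neither on the times nor on `X`. It serves twice: for finiteness of moments
along the scheme, and for control of the interpolation inside a step. -/
lemma LinearGrowth.exists_moment_bound [IsProbabilityMeasure P] (hL : LinearGrowth F G L K)
    (hK : 0 ≤ K) (hB : IsBrownianMotion ℱ P B) {q : ℝ} (hq : 0 ≤ q) :
    ∃ M : ℝ≥0∞, M ≠ ∞ ∧ ∀ (s t : ℝ≥0) (X : Ω → EuclideanSpace ℝ (Fin d)), s ≤ t →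
      (t : ℝ) - s ≤ 1 → Measurable[ℱ s] X →
      ∫⁻ ω, ‖step F G L ((t : ℝ) - s) (X ω) (B t ω - B s ω)‖ₑ ^ q ∂P
        ≤ M * ∫⁻ ω, ‖X ω‖ₑ ^ q ∂P := by
  obtain ⟨M, hM, h⟩ := lintegral_step_le_mul hq m hK
  refine ⟨M, hM, fun s t X hst hst1 hX => ?_⟩
  rw [hL.lintegral_step_eq hB hst hX q, mul_comm, ← lintegral_mul_const' _ _ hM]
  exact lintegral_mono fun ω => h d F G L _ (X ω) (Real.sqrt_nonneg _)
    (Real.sqrt_le_one.2 hst1) (hL.norm_drift_le _)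
    (fun j => hL.norm_diffusion_le j _) (fun i j => hL.norm_second_le i j _)

end Abstract

variable (f : EuclideanSpace ℝ (Fin d) → EuclideanSpace ℝ (Fin d))
  (g : Fin m → EuclideanSpace ℝ (Fin d) → EuclideanSpace ℝ (Fin d))
  (r : ℝ) (Δ : ℝ≥0) (x₀ : EuclideanSpace ℝ (Fin d))

/-- The separate correction with `Δ` in the scheme is the diagonal part of the compensated products
`b i * b j - δ_ij Δ` in `step`. -/
lemma milstein_succ (B : ℝ≥0 → Ω → (Fin m → ℝ)) (k : ℕ) (ω : Ω) :
    milstein f g r Δ x₀ B (k + 1) ω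
      = step (trunc r f) (fun j => trunc r (g j)) (truncLop r g) Δ (milstein f g r Δ x₀ B k ω)
          (B (((k + 1 : ℕ) : ℝ≥0) * Δ) ω - B ((k : ℝ≥0) * Δ) ω) := by
  rw [milstein, step]
  simp only [truncLop, Pi.sub_apply]
  rw [add_sub_assoc, ← smul_sub]
  congr 2
  rw [← Finset.sum_sub_distrib]
  refine Finset.sum_congr rfl fun i _ => ?_
  have h1 : ∑ l, (trunc r (g i) (milstein f g r Δ x₀ B k ω) l * (Δ : ℝ)) •
      truncDcol r g i l (milstein f g r Δ x₀ B k ω) = ∑ j, (if i = j then (Δ : ℝ) else 0) •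
        ∑ l, trunc r (g i) (milstein f g r Δ x₀ B k ω) l •
          truncDcol r g j l (milstein f g r Δ x₀ B k ω) := by
    simp only [ite_smul, zero_smul, Finset.sum_ite_eq, Finset.mem_univ, if_true]
    rw [Finset.smul_sum]
    exact Finset.sum_congr rfl fun l _ => by rw [smul_smul, mul_comm]
  rw [h1, ← Finset.sum_sub_distrib]
  refine Finset.sum_congr rfl fun j _ => ?_
  rw [sub_smul]
  congr 1
  rw [Finset.smul_sum]
  refine Finset.sum_congr rfl fun l _ => ?_
  rw [smul_smul]
  congr 1
  ring

variable {f g r Δ x₀} {K : ℝ}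

lemma natCast_mul_le_succ (Δ : ℝ≥0) (k : ℕ) : (k : ℝ≥0) * Δ ≤ ((k + 1 : ℕ) : ℝ≥0) * Δ := by
  gcongr; simp

lemma succ_mul_sub (Δ : ℝ≥0) (k : ℕ) :
    ((((k + 1 : ℕ) : ℝ≥0) * Δ : ℝ≥0) : ℝ) - ((k : ℝ≥0) * Δ : ℝ≥0) = Δ := by
  push_cast; ring

lemma measurable_milstein (hB : IsBrownianMotion ℱ P B)
    (hL : LinearGrowth (trunc r f) (fun j => trunc r (g j)) (truncLop r g) K) (k : ℕ) :
    Measurable[ℱ ((k : ℝ≥0) * Δ)] (milstein f g r Δ x₀ B k) := by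
  induction k with
  | zero => exact measurable_const
  | succ k ih =>
    have h0 : milstein f g r Δ x₀ B (k + 1) = fun ω => step (trunc r f) (fun j => trunc r (g j))
        (truncLop r g) Δ (milstein f g r Δ x₀ B k ω)
          (B (((k + 1 : ℕ) : ℝ≥0) * Δ) ω - B ((k : ℝ≥0) * Δ) ω) :=
      funext fun ω => milstein_succ f g r Δ x₀ B k ω
    rw [h0]
    have hle := ℱ.mono (natCast_mul_le_succ Δ k)
    exact hL.measurable_step (ih.mono hle le_rfl)
      ((hB.adapted _).sub ((hB.adapted _).mono hle le_rfl)) _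

lemma lintegral_milstein_lt_top [IsProbabilityMeasure P] (hB : IsBrownianMotion ℱ P B)
    (hL : LinearGrowth (trunc r f) (fun j => trunc r (g j)) (truncLop r g) K) (hK : 0 ≤ K)
    (hΔ : Δ ≤ 1) {q : ℝ} (hq : 0 ≤ q) (k : ℕ) :
    ∫⁻ ω, ‖milstein f g r Δ x₀ B k ω‖ₑ ^ q ∂P < ∞ := by
  induction k with
  | zero => simpa [milstein] using ENNReal.rpow_lt_top_of_nonneg hq enorm_ne_top
  | succ k ih =>
    obtain ⟨M, hM, h⟩ := hL.exists_moment_bound hK hB hq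
    have := h _ _ _ (natCast_mul_le_succ Δ k) (by rw [succ_mul_sub]; exact_mod_cast hΔ)
      (measurable_milstein (x₀ := x₀) hB hL k)
    rw [succ_mul_sub] at this
    simp_rw [milstein_succ]
    exact this.trans_lt (ENNReal.mul_lt_top hM.lt_top ih)

lemma memLp_milstein [IsProbabilityMeasure P] (hB : IsBrownianMotion ℱ P B)
    (hL : LinearGrowth (trunc r f) (fun j => trunc r (g j)) (truncLop r g) K) (hK : 0 ≤ K)
    (hΔ : Δ ≤ 1) (k : ℕ) : MemLp (milstein f g r Δ x₀ B k) 2 P := by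
  refine ⟨((measurable_milstein hB hL k).mono (ℱ.le _) le_rfl).aestronglyMeasurable, ?_⟩
  rw [eLpNorm_lt_top_iff_lintegral_rpow_enorm_lt_top (by norm_num) (by norm_num)]
  exact lintegral_milstein_lt_top hB hL hK hΔ (by norm_num) k

/-- Exponential decay (up to the discretization error) of the moments of the scheme. -/
lemma lintegral_milstein_le [IsProbabilityMeasure P] {p : ℝ} (hp : 0 < p) (m d : ℕ)
    (hpd : 2 ≤ p ∨ d = 1) :
    ∃ C : ℝ, 0 ≤ C ∧ ∀ (B : ℝ≥0 → Ω → (Fin m → ℝ)) (x₀ : EuclideanSpace ℝ (Fin d))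
      (f : EuclideanSpace ℝ (Fin d) → EuclideanSpace ℝ (Fin d))
      (g : Fin m → EuclideanSpace ℝ (Fin d) → EuclideanSpace ℝ (Fin d))
      (r K lam : ℝ) (Δ : ℝ≥0), IsBrownianMotion ℱ P B →
      LinearGrowth (trunc r f) (fun j => trunc r (g j)) (truncLop r g) K →
      1 ≤ K → Δ ≤ 1 → K * √Δ ≤ 1 →
      (∀ y, inner ℝ y (trunc r f y) + (p - 1) / 2 * ∑ j, ‖trunc r (g j) y‖ ^ 2
        ≤ -lam * ‖y‖ ^ 2) → ∀ k : ℕ,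
      ∫⁻ ω, ‖milstein f g r Δ x₀ B k ω‖ₑ ^ p ∂P
        ≤ ‖x₀‖ₑ ^ p * ENNReal.ofReal (Real.exp (k * (-p * lam * Δ + C * (K * √Δ) ^ 3))) := by
  obtain ⟨C, hC, h⟩ := lintegral_step_le hp m d hpd
  refine ⟨C, hC, ?_⟩
  intro B x₀ f g r K lam Δ hB hL hK hΔ hKΔ hdiss k
  induction k with
  | zero => simp [milstein]
  | succ k ih =>
    have h1 := hL.lintegral_step_eq hB (natCast_mul_le_succ Δ k)
      (measurable_milstein (x₀ := x₀) hB hL k) p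
    rw [succ_mul_sub] at h1
    simp_rw [milstein_succ]
    rw [h1]
    calc _ ≤ ∫⁻ ω, ‖milstein f g r Δ x₀ B k ω‖ₑ ^ p *
          ENNReal.ofReal (Real.exp (-p * lam * Δ + C * (K * √Δ) ^ 3)) ∂P := by
          refine lintegral_mono fun ω => ?_
          have := h (trunc r f) (fun j => trunc r (g j)) (truncLop r g) K (√Δ) lam
            (milstein f g r Δ x₀ B k ω) hK (Real.sqrt_nonneg _)
            (Real.sqrt_le_one.2 (by exact_mod_cast hΔ)) hKΔ (hL.norm_drift_le _)
            (fun j => hL.norm_diffusion_le j _) (fun i j => hL.norm_second_le i j _) (hdiss _)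
          rwa [Real.sq_sqrt Δ.coe_nonneg] at this ⊢
      _ ≤ (‖x₀‖ₑ ^ p * ENNReal.ofReal (Real.exp (k * (-p * lam * Δ + C * (K * √Δ) ^ 3)))) *
          ENNReal.ofReal (Real.exp (-p * lam * Δ + C * (K * √Δ) ^ 3)) := by
          rw [lintegral_mul_const' _ _ ENNReal.ofReal_ne_top]
          gcongr
      _ = _ := by
          rw [mul_assoc, ← ENNReal.ofReal_mul (Real.exp_nonneg _), ← Real.exp_add]
          congr 3
          push_cast; ring

end Chain

/-! ### The Itô isometry -/

section Isometry

variable {Ω : Type*} {mΩ : MeasurableSpace Ω} {P : Measure Ω} {ℱ : Filtration ℝ≥0 mΩ} {d : ℕ}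
  {W : ℝ≥0 → Ω → ℝ}

/-- The properties of a one-dimensional Brownian motion used for stochastic integration. -/
structure IsIntegrator (ℱ : Filtration ℝ≥0 mΩ) (P : Measure Ω) (W : ℝ≥0 → Ω → ℝ) : Prop where
  adapted : ∀ t, Measurable[ℱ t] (W t)
  indep : ∀ s t, s ≤ t →
    Indep (MeasurableSpace.comap (fun ω => W t ω - W s ω) inferInstance) (ℱ s) P
  memLp_sub : ∀ s t, s ≤ t → MemLp (fun ω => W t ω - W s ω) 2 P
  integral_sub : ∀ s t, s ≤ t → ∫ ω, (W t ω - W s ω) ∂P = 0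
  integral_sub_sq : ∀ s t, s ≤ t → ∫ ω, (W t ω - W s ω) ^ 2 ∂P = (t : ℝ) - s

lemma IsIntegrator.measurable (hW : IsIntegrator ℱ P W) (t : ℝ≥0) : Measurable (W t) :=
  (hW.adapted t).mono (ℱ.le t) le_rfl

lemma IsIntegrator.measurable_sub (hW : IsIntegrator ℱ P W) (s t : ℝ≥0) :
    Measurable fun ω => W t ω - W s ω := (hW.measurable t).sub (hW.measurable s)

lemma IsIntegrator.measurable_sub_le (hW : IsIntegrator ℱ P W) {s t u : ℝ≥0} (hs : s ≤ u)
    (ht : t ≤ u) : Measurable[ℱ u] fun ω => W t ω - W s ω :=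
  ((hW.adapted t).mono (ℱ.mono ht) le_rfl).sub ((hW.adapted s).mono (ℱ.mono hs) le_rfl)

lemma IsIntegrator.indepFun (hW : IsIntegrator ℱ P W) {s t : ℝ≥0} (hst : s ≤ t)
    {E : Type*} [MeasurableSpace E] {X : Ω → E} (hX : Measurable[ℱ s] X) :
    IndepFun X (fun ω => W t ω - W s ω) P := by
  rw [IndepFun_iff_Indep]
  exact indep_of_indep_of_le_left (hW.indep s t hst).symm hX.comap_le

lemma IsIntegrator.integral_mul_sub (hW : IsIntegrator ℱ P W) {s t : ℝ≥0} (hst : s ≤ t)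
    {Z : Ω → ℝ} (hZ : Measurable[ℱ s] Z) : ∫ ω, Z ω * (W t ω - W s ω) ∂P = 0 := by
  -- For independent factors the product formula needs only measurability, so `Z` need not be
  -- integrable.
  rw [(hW.indepFun hst hZ).integral_fun_mul_eq_mul_integral
    (hZ.mono (ℱ.le s) le_rfl).aestronglyMeasurable (hW.measurable_sub s t).aestronglyMeasurable,
    hW.integral_sub s t hst, mul_zero]

lemma IsIntegrator.integral_mul_sub_sq (hW : IsIntegrator ℱ P W) {s t : ℝ≥0} (hst : s ≤ t)
    {Z : Ω → ℝ} (hZ : Measurable[ℱ s] Z) :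
    ∫ ω, Z ω * (W t ω - W s ω) ^ 2 ∂P = (∫ ω, Z ω ∂P) * ((t : ℝ) - s) := by
  have h := (hW.indepFun hst hZ).comp (φ := id) (ψ := fun x => x ^ 2) measurable_id (by fun_prop)
  have h2 := h.integral_fun_mul_eq_mul_integral
    (hZ.mono (ℱ.le s) le_rfl).aestronglyMeasurable
    ((hW.measurable_sub s t).pow_const 2).aestronglyMeasurable
  rw [← hW.integral_sub_sq s t hst]
  exact h2

lemma IsIntegrator.integrable_mul_sub_mul_sub (hW : IsIntegrator ℱ P W) {a b c e : ℝ≥0}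
    (hab : a ≤ b) (hce : c ≤ e) {Z : Ω → ℝ} (hZ : Measurable Z) {C : ℝ} (hC : ∀ ω, |Z ω| ≤ C) :
    Integrable (fun ω => Z ω * ((W b ω - W a ω) * (W e ω - W c ω))) P :=
  ((hW.memLp_sub a b hab).integrable_mul (hW.memLp_sub c e hce)).bdd_mul (c := C)
    hZ.aestronglyMeasurable (ae_of_all _ hC)

/-- Split the longer increment at `u`: the part after `u` is centred and independent of everything
before, leaving a squared increment. -/
lemma IsIntegrator.integral_mul_sub_mul_sub_of_le (hW : IsIntegrator ℱ P W) {c u v : ℝ≥0}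
    (hcu : c ≤ u) (huv : u ≤ v) {Z : Ω → ℝ} (hZ : Measurable[ℱ c] Z) {C : ℝ}
    (hC : ∀ ω, |Z ω| ≤ C) :
    ∫ ω, Z ω * ((W u ω - W c ω) * (W v ω - W c ω)) ∂P = (∫ ω, Z ω ∂P) * ((u : ℝ) - c) := by
  have hZ' := hZ.mono (ℱ.le c) le_rfl
  have h1 : ∀ ω, Z ω * ((W u ω - W c ω) * (W v ω - W c ω))
      = Z ω * ((W u ω - W c ω) * (W u ω - W c ω)) + Z ω * ((W u ω - W c ω) * (W v ω - W u ω)) :=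
    fun ω => by ring
  simp_rw [h1]
  rw [integral_add (hW.integrable_mul_sub_mul_sub hcu hcu hZ' hC)
    (hW.integrable_mul_sub_mul_sub hcu huv hZ' hC)]
  have h2 := hW.integral_mul_sub huv (Z := fun ω => Z ω * (W u ω - W c ω))
    ((hZ.mono (ℱ.mono hcu) le_rfl).mul (hW.measurable_sub_le hcu le_rfl))
  simp_rw [mul_assoc] at h2
  have h3 := hW.integral_mul_sub_sq hcu hZ
  simp_rw [sq] at h3
  rw [h2, h3, add_zero]

/-- Covariance of two weighted increments, on the time interval `[0, t]`. -/
lemma IsIntegrator.integral_mul_sub_mul_sub (hW : IsIntegrator ℱ P W) (t : ℝ≥0) {a b c e : ℝ≥0}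
    (hab : a ≤ b) (hce : c ≤ e) (hac : a ≤ c) {Z : Ω → ℝ} (hZ : Measurable[ℱ c] Z) {C : ℝ}
    (hC : ∀ ω, |Z ω| ≤ C) :
    ∫ ω, Z ω * ((W (min t b) ω - W (min t a) ω) * (W (min t e) ω - W (min t c) ω)) ∂P
      = (∫ ω, Z ω ∂P) * max (min (t : ℝ) (min b e) - max (a : ℝ) c) 0 := by
  have hZ' := hZ.mono (ℱ.le c) le_rfl
  rw [max_eq_right (by exact_mod_cast hac : (a : ℝ) ≤ c)]
  rcases le_or_gt t c with htc | hct
  · rw [min_eq_left htc, min_eq_left (htc.trans hce), max_eq_right]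
    · simp
    · have : (t : ℝ) ≤ c := by exact_mod_cast htc
      linarith [min_le_left (t : ℝ) (min b e)]
  rw [min_eq_right hct.le, min_eq_right (hac.trans hct.le)]
  have hmin : min (t : ℝ) (min b e) = min ((min t b : ℝ≥0) : ℝ) ((min t e : ℝ≥0) : ℝ) := by
    push_cast
    rw [min_min_min_comm, min_self]
  rw [hmin]
  set b' := min t b with hb'
  set e' := min t e with he'
  have hab' : a ≤ b' := le_min (hac.trans hct.le) hab
  have hce' : c ≤ e' := le_min hct.le hce
  rcases le_or_gt b' c with hbc | hcb
  · rw [max_eq_right, mul_zero]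
    · have h2 := hW.integral_mul_sub hce' (Z := fun ω => Z ω * (W b' ω - W a ω))
        (hZ.mul (hW.measurable_sub_le hac hbc))
      simp_rw [mul_assoc] at h2
      exact h2
    · have : (b' : ℝ) ≤ c := by exact_mod_cast hbc
      linarith [min_le_left (b' : ℝ) (e' : ℝ)]
  -- For overlapping intervals the first increment is cut at `c`. Its part before `c` is `ℱ
  -- c`-measurable, hence uncorrelated with the second increment.
  · have h1 : ∀ ω, Z ω * ((W b' ω - W a ω) * (W e' ω - W c ω))
        = Z ω * ((W c ω - W a ω) * (W e' ω - W c ω))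
          + Z ω * ((W b' ω - W c ω) * (W e' ω - W c ω)) := fun ω => by ring
    simp_rw [h1]
    rw [integral_add (hW.integrable_mul_sub_mul_sub hac hce' hZ' hC)
      (hW.integrable_mul_sub_mul_sub hcb.le hce' hZ' hC)]
    have h2 := hW.integral_mul_sub hce' (Z := fun ω => Z ω * (W c ω - W a ω))
      (hZ.mul (hW.measurable_sub_le hac le_rfl))
    simp_rw [mul_assoc] at h2
    rw [h2, zero_add, max_eq_left]
    · rcases le_total b' e' with h | h
      · rw [min_eq_left (by exact_mod_cast h)]
        exact hW.integral_mul_sub_mul_sub_of_le hcb.le h hZ hC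
      · rw [min_eq_right (by exact_mod_cast h)]
        rw [← hW.integral_mul_sub_mul_sub_of_le hce' h hZ hC]
        simp_rw [mul_comm]
    · have h3 : (c : ℝ) ≤ b' := by exact_mod_cast hcb.le
      have h4 : (c : ℝ) ≤ e' := by exact_mod_cast hce'
      linarith [le_min h3 h4]

/-- Lebesgue measure on `(0, t]`. -/
abbrev timeMeasure (t : ℝ≥0) : Measure ℝ := (volume : Measure ℝ).restrict (Set.Ioc 0 (t : ℝ))

lemma measurableSet_toNNReal_Ioc (a b : ℝ≥0) :
    MeasurableSet {s : ℝ | s.toNNReal ∈ Set.Ioc a b} :=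
  measurable_real_toNNReal measurableSet_Ioc

/-- The overlap length is the covariance factor in `integral_mul_sub_mul_sub`, so the two sides of
the isometry agree term by term. -/
lemma timeMeasure_real_inter (t a b c e : ℝ≥0) :
    (timeMeasure t).real ({s : ℝ | s.toNNReal ∈ Set.Ioc a b} ∩ {s | s.toNNReal ∈ Set.Ioc c e})
      = max (min (t : ℝ) (min b e) - max (a : ℝ) c) 0 := by
  rw [measureReal_restrict_apply
    ((measurableSet_toNNReal_Ioc a b).inter (measurableSet_toNNReal_Ioc c e))]
  have : {s : ℝ | s.toNNReal ∈ Set.Ioc a b} ∩ {s | s.toNNReal ∈ Set.Ioc c e}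
      ∩ Set.Ioc 0 (t : ℝ) = Set.Ioc (max (a : ℝ) c) (min (t : ℝ) (min b e)) := by
    ext s
    simp only [Set.mem_inter_iff, Set.mem_ofPred_eq, Set.mem_Ioc, max_lt_iff, le_min_iff,
      Real.toNNReal_le_iff_le_coe, Real.lt_toNNReal_iff_coe_lt]
    constructor
    · rintro ⟨⟨⟨h1, h2⟩, h3, h4⟩, h5, h6⟩
      exact ⟨⟨h1, h3⟩, h6, h2, h4⟩
    · rintro ⟨⟨h1, h3⟩, h6, h2, h4⟩
      have h5 : 0 < s := lt_of_le_of_lt a.coe_nonneg h1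
      exact ⟨⟨⟨h1, h2⟩, h3, h4⟩, h5, h6⟩
  rw [this, Real.volume_real_Ioc]

variable [IsProbabilityMeasure P]

/-- The Itô isometry for finite sums of weighted increments. -/
lemma IsIntegrator.isometry (hW : IsIntegrator ℱ P W) (t : ℝ≥0) {ι : Type*} (s : Finset ι)
    (a b : ι → ℝ≥0) (hab : ∀ i, a i ≤ b i) (ξ : ι → Ω → EuclideanSpace ℝ (Fin d))
    (hξ : ∀ i, Measurable[ℱ (a i)] (ξ i)) (hC : ∀ i, ∃ C : ℝ, ∀ ω, ‖ξ i ω‖ ≤ C) :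
    ∫ ω, ‖∑ i ∈ s, (W (min t (b i)) ω - W (min t (a i)) ω) • ξ i ω‖ ^ 2 ∂P
      = ∫ z : Ω × ℝ, ‖∑ i ∈ s, (Set.Ioc (a i) (b i)).indicator (fun _ => ξ i z.1)
          z.2.toNNReal‖ ^ 2 ∂(P.prod (timeMeasure t)) := by
  choose C hC using hC
  have hξm : ∀ i, Measurable (ξ i) := fun i => (hξ i).mono (ℱ.le _) le_rfl
  have hmin : ∀ i, min t (a i) ≤ min t (b i) := fun i => min_le_min_left t (hab i)
  have hZ : ∀ i j, Measurable fun ω => (inner ℝ (ξ i ω) (ξ j ω) : ℝ) :=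
    fun i j => (hξm i).inner (hξm j)
  have hZC : ∀ i j ω, |(inner ℝ (ξ i ω) (ξ j ω) : ℝ)| ≤ C i * C j := fun i j ω =>
    (abs_real_inner_le_norm _ _).trans (mul_le_mul (hC i ω) (hC j ω) (norm_nonneg _)
      ((norm_nonneg _).trans (hC i ω)))
  have hZi : ∀ i j, Integrable (fun ω => (inner ℝ (ξ i ω) (ξ j ω) : ℝ)) P := fun i j =>
    Integrable.of_bound (hZ i j).aestronglyMeasurable (C i * C j) (ae_of_all _ (hZC i j))
  -- Both sides are compared as double sums over pairs of intervals. The intervals may overlap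
  -- arbitrarily.
  have hexp : ∀ v : ι → EuclideanSpace ℝ (Fin d),
      ‖∑ i ∈ s, v i‖ ^ 2 = ∑ i ∈ s, ∑ j ∈ s, inner ℝ (v i) (v j) := fun v => by
    rw [← real_inner_self_eq_norm_sq, sum_inner]
    exact Finset.sum_congr rfl fun i _ => inner_sum _ _ _
  set S : ι → Set ℝ := fun i => {u : ℝ | u.toNNReal ∈ Set.Ioc (a i) (b i)} with hS
  have hSm : ∀ i, MeasurableSet (S i) := fun i => measurableSet_toNNReal_Ioc _ _
  have hl : ∀ ω, ‖∑ i ∈ s, (W (min t (b i)) ω - W (min t (a i)) ω) • ξ i ω‖ ^ 2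
      = ∑ i ∈ s, ∑ j ∈ s, inner ℝ (ξ i ω) (ξ j ω) *
        ((W (min t (b i)) ω - W (min t (a i)) ω) * (W (min t (b j)) ω - W (min t (a j)) ω)) := by
    intro ω
    rw [hexp]
    refine Finset.sum_congr rfl fun i _ => Finset.sum_congr rfl fun j _ => ?_
    rw [inner_smul_left, inner_smul_right]
    simp only [conj_trivial]
    ring
  have hr : ∀ z : Ω × ℝ, ‖∑ i ∈ s, (Set.Ioc (a i) (b i)).indicator (fun _ => ξ i z.1)
          z.2.toNNReal‖ ^ 2 = ∑ i ∈ s, ∑ j ∈ s, inner ℝ (ξ i z.1) (ξ j z.1) *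
            (S i ∩ S j).indicator (fun _ => (1 : ℝ)) z.2 := by
    intro z
    rw [hexp]
    refine Finset.sum_congr rfl fun i _ => Finset.sum_congr rfl fun j _ => ?_
    by_cases h1 : z.2.toNNReal ∈ Set.Ioc (a i) (b i) <;>
      by_cases h2 : z.2.toNNReal ∈ Set.Ioc (a j) (b j) <;>
      simp only [hS, Set.indicator, h1, h2, Set.mem_inter_iff, Set.mem_ofPred_eq, if_true, if_false,
        inner_zero_left, inner_zero_right, mul_zero, mul_one, and_true, and_false]
  have hSi : ∀ i j, Integrable ((S i ∩ S j).indicator (fun _ => (1 : ℝ))) (timeMeasure t) :=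
    fun i j => (integrable_const 1).indicator ((hSm i).inter (hSm j))
  simp_rw [hl, hr]
  rw [integral_finsetSum, integral_finsetSum]
  rotate_left
  · exact fun i _ => integrable_finsetSum _ fun j _ => (hZi i j).mul_prod (hSi i j)
  · exact fun i _ => integrable_finsetSum _ fun j _ =>
      hW.integrable_mul_sub_mul_sub (hmin i) (hmin j) (hZ i j) (hZC i j)
  refine Finset.sum_congr rfl fun i _ => ?_
  rw [integral_finsetSum, integral_finsetSum]
  rotate_left
  · exact fun j _ => (hZi i j).mul_prod (hSi i j)
  · exact fun j _ => hW.integrable_mul_sub_mul_sub (hmin i) (hmin j) (hZ i j) (hZC i j)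
  refine Finset.sum_congr rfl fun j _ => ?_
  have hprod := integral_prod_mul (μ := P) (ν := timeMeasure t)
    (fun ω => (inner ℝ (ξ i ω) (ξ j ω) : ℝ)) ((S i ∩ S j).indicator fun _ => (1 : ℝ))
  refine Eq.trans ?_ hprod.symm
  have hone : ∫ u, (S i ∩ S j).indicator (fun _ => (1 : ℝ)) u ∂(timeMeasure t)
      = (timeMeasure t).real (S i ∩ S j) := integral_indicator_one ((hSm i).inter (hSm j))
  rw [hone, hS, timeMeasure_real_inter]
  rcases le_total (a i) (a j) with h | h
  · exact hW.integral_mul_sub_mul_sub t (hab i) (hab j) h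
      (((hξ i).mono (ℱ.mono h) le_rfl).inner (hξ j)) (hZC i j)
  · rw [max_comm (a i : ℝ), min_comm (b i : ℝ),
      ← hW.integral_mul_sub_mul_sub t (hab j) (hab i) h
      ((hξ i).inner ((hξ j).mono (ℱ.mono h) le_rfl)) (hZC i j)]
    refine integral_congr_ae (ae_of_all _ fun ω => ?_)
    simp only
    ring

end Isometry

/-! ### Itô integrals of limits of step processes -/

section Limit

variable {Ω : Type*} {mΩ : MeasurableSpace Ω} {P : Measure Ω} {ℱ : Filtration ℝ≥0 mΩ} {d : ℕ}
  {W : ℝ≥0 → Ω → ℝ}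

lemma eLpNorm_two_eq_of_integral_eq {α β E F : Type*} {mα : MeasurableSpace α}
    {mβ : MeasurableSpace β} {μ : Measure α} {ν : Measure β} [NormedAddCommGroup E]
    [NormedAddCommGroup F] {f : α → E} {g : β → F} (hf : MemLp f 2 μ) (hg : MemLp g 2 ν)
    (h : ∫ x, ‖f x‖ ^ 2 ∂μ = ∫ y, ‖g y‖ ^ 2 ∂ν) : eLpNorm f 2 μ = eLpNorm g 2 ν := by
  rw [hf.eLpNorm_eq_integral_rpow_norm (by norm_num) (by norm_num),
    hg.eLpNorm_eq_integral_rpow_norm (by norm_num) (by norm_num)]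
  simp only [ENNReal.toReal_ofNat, Real.rpow_ofNat, h]

lemma eLpNorm_two_sq {α E : Type*} {mα : MeasurableSpace α} {μ : Measure α}
    [NormedAddCommGroup E] (f : α → E) : eLpNorm f 2 μ ^ 2 = ∫⁻ x, ‖f x‖ₑ ^ 2 ∂μ := by
  have := eLpNorm_nnreal_pow_eq_lintegral (f := f) (μ := μ) (p := 2) (by norm_num)
  simpa only [NNReal.coe_ofNat, ENNReal.coe_ofNat, ENNReal.rpow_ofNat] using this

lemma eLpNorm_two_smul_of_indepFun {X : Ω → ℝ} {η : Ω → EuclideanSpace ℝ (Fin d)}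
    (hX : Measurable X) (hη : Measurable η) (h : IndepFun X η P) :
    eLpNorm (fun ω => X ω • η ω) 2 P = eLpNorm X 2 P * eLpNorm η 2 P := by
  have h1 : eLpNorm (fun ω => X ω • η ω) 2 P ^ 2 = (eLpNorm X 2 P * eLpNorm η 2 P) ^ 2 := by
    rw [mul_pow, eLpNorm_two_sq, eLpNorm_two_sq, eLpNorm_two_sq]
    simp_rw [enorm_smul, mul_pow]
    exact lintegral_mul_eq_lintegral_mul_lintegral_of_indepFun'' (hX.enorm.pow_const 2).aemeasurable
      (hη.enorm.pow_const 2).aemeasurable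
      (h.comp (φ := fun x => ‖x‖ₑ ^ 2) (ψ := fun x => ‖x‖ₑ ^ 2) (by fun_prop) (by fun_prop))
  exact (ENNReal.pow_right_strictMono two_ne_zero).injective h1

lemma IsIntegrator.eLpNorm_sub (hW : IsIntegrator ℱ P W) {s t : ℝ≥0} (hst : s ≤ t) :
    eLpNorm (fun ω => W t ω - W s ω) 2 P = ENNReal.ofReal √((t : ℝ) - s) := by
  rw [(hW.memLp_sub s t hst).eLpNorm_eq_integral_rpow_norm (by norm_num) (by norm_num)]
  simp only [ENNReal.toReal_ofNat, Real.rpow_ofNat, Real.norm_eq_abs, sq_abs,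
    hW.integral_sub_sq s t hst]
  rw [Real.sqrt_eq_rpow]
  norm_num

lemma IsIntegrator.eLpNorm_sub_smul (hW : IsIntegrator ℱ P W) {s t : ℝ≥0} (hst : s ≤ t)
    {η : Ω → EuclideanSpace ℝ (Fin d)} (hη : Measurable[ℱ s] η) :
    eLpNorm (fun ω => (W t ω - W s ω) • η ω) 2 P
      = ENNReal.ofReal √((t : ℝ) - s) * eLpNorm η 2 P := by
  rw [eLpNorm_two_smul_of_indepFun (hW.measurable_sub s t) (hη.mono (ℱ.le s) le_rfl)
    (hW.indepFun hst hη).symm, hW.eLpNorm_sub hst]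

lemma IsIntegrator.eLpNorm_min_sub_smul_le (hW : IsIntegrator ℱ P W) (t : ℝ≥0) {a b : ℝ≥0}
    (hab : a ≤ b) {η : Ω → EuclideanSpace ℝ (Fin d)} (hη : Measurable[ℱ a] η) :
    eLpNorm (fun ω => (W (min t b) ω - W (min t a) ω) • η ω) 2 P
      ≤ ENNReal.ofReal √(t : ℝ) * eLpNorm η 2 P := by
  rcases le_or_gt t a with h | h
  · simp [min_eq_left h, min_eq_left (h.trans hab)]
  · rw [min_eq_right h.le, hW.eLpNorm_sub_smul (le_min h.le hab) hη]
    gcongr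
    have : ((min t b : ℝ≥0) : ℝ) ≤ t := by exact_mod_cast min_le_left t b
    linarith [a.coe_nonneg]

lemma eLpNorm_two_comp_fst [SFinite P] (t : ℝ≥0) {η : Ω → EuclideanSpace ℝ (Fin d)}
    (hη : Measurable η) :
    eLpNorm (fun z : Ω × ℝ => η z.1) 2 (P.prod (timeMeasure t))
      = ENNReal.ofReal √(t : ℝ) * eLpNorm η 2 P := by
  have h1 : eLpNorm (fun z : Ω × ℝ => η z.1) 2 (P.prod (timeMeasure t)) ^ 2
      = (ENNReal.ofReal √(t : ℝ) * eLpNorm η 2 P) ^ 2 := by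
    rw [mul_pow, eLpNorm_two_sq, eLpNorm_two_sq, lintegral_prod _ (by fun_prop),
      ← ENNReal.ofReal_pow (Real.sqrt_nonneg _), Real.sq_sqrt t.coe_nonneg]
    simp only [lintegral_const, Measure.restrict_apply MeasurableSet.univ, Set.univ_inter,
      Real.volume_Ioc, sub_zero]
    rw [lintegral_mul_const' _ _ ENNReal.ofReal_ne_top, mul_comm]
  exact (ENNReal.pow_right_strictMono two_ne_zero).injective h1

/-- A step process with square integrable coefficients. -/
structure StepProcess (ℱ : Filtration ℝ≥0 mΩ) (P : Measure Ω) (d : ℕ) where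
  n : ℕ
  time : ℕ → ℝ≥0
  mono : Monotone time
  coeff : ℕ → Ω → EuclideanSpace ℝ (Fin d)
  measurable_coeff : ∀ i, Measurable[ℱ (time i)] (coeff i)
  memLp_coeff : ∀ i, MemLp (coeff i) 2 P

/-- The value of a step process. -/
def StepProcess.eval (φ : StepProcess ℱ P d) (z : Ω × ℝ) : EuclideanSpace ℝ (Fin d) :=
  ∑ i ∈ Finset.range φ.n,
    (Set.Ioc (φ.time i) (φ.time (i + 1))).indicator (fun _ => φ.coeff i z.1) z.2.toNNReal

/-- The stochastic integral of a step process. -/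
def StepProcess.integral (φ : StepProcess ℱ P d) (W : ℝ≥0 → Ω → ℝ) (t : ℝ≥0) (ω : Ω) :
    EuclideanSpace ℝ (Fin d) :=
  ∑ i ∈ Finset.range φ.n, (W (min t (φ.time (i + 1))) ω - W (min t (φ.time i)) ω) • φ.coeff i ω

lemma measurable_indicator_Ioc {η : Ω → EuclideanSpace ℝ (Fin d)} (hη : Measurable η)
    (a b : ℝ≥0) : Measurable fun z : Ω × ℝ =>
      (Set.Ioc a b).indicator (fun _ => η z.1) z.2.toNNReal := by
  have : (fun z : Ω × ℝ => (Set.Ioc a b).indicator (fun _ => η z.1) z.2.toNNReal)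
      = (Prod.snd ⁻¹' {s : ℝ | s.toNNReal ∈ Set.Ioc a b}).indicator fun z : Ω × ℝ => η z.1 := by
    funext z
    by_cases h : z.2.toNNReal ∈ Set.Ioc a b <;> simp only [Set.indicator, Set.mem_preimage,
      Set.mem_ofPred_eq, h, if_true, if_false]
  rw [this]
  exact (hη.comp measurable_fst).indicator (measurable_snd (measurableSet_toNNReal_Ioc a b))

lemma eLpNorm_indicator_Ioc_le [SFinite P] (t : ℝ≥0) {η : Ω → EuclideanSpace ℝ (Fin d)}
    (hη : Measurable η) (a b : ℝ≥0) :
    eLpNorm (fun z : Ω × ℝ => (Set.Ioc a b).indicator (fun _ => η z.1) z.2.toNNReal) 2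
      (P.prod (timeMeasure t)) ≤ ENNReal.ofReal √(t : ℝ) * eLpNorm η 2 P := by
  rw [← eLpNorm_two_comp_fst t hη]
  refine eLpNorm_mono fun z => ?_
  by_cases h : z.2.toNNReal ∈ Set.Ioc a b <;> simp [Set.indicator, h]

lemma StepProcess.memLp_eval [IsFiniteMeasure P] (φ : StepProcess ℱ P d) (t : ℝ≥0) :
    MemLp φ.eval 2 (P.prod (timeMeasure t)) := by
  refine memLp_finsetSum _ fun i _ => ?_
  have hm := (φ.measurable_coeff i).mono (ℱ.le _) le_rfl
  exact ⟨(measurable_indicator_Ioc hm _ _).aestronglyMeasurable,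
    (eLpNorm_indicator_Ioc_le t hm _ _).trans_lt
      (ENNReal.mul_lt_top ENNReal.ofReal_lt_top (φ.memLp_coeff i).2)⟩

lemma StepProcess.memLp_integral (hW : IsIntegrator ℱ P W) (φ : StepProcess ℱ P d) (t : ℝ≥0) :
    MemLp (φ.integral W t) 2 P := by
  refine memLp_finsetSum _ fun i _ => ?_
  have hm := (φ.measurable_coeff i).mono (ℱ.le _) le_rfl
  exact ⟨((hW.measurable_sub _ _).smul hm).aestronglyMeasurable,
    (hW.eLpNorm_min_sub_smul_le t (φ.mono (Nat.le_succ i)) (φ.measurable_coeff i)).trans_lt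
      (ENNReal.mul_lt_top ENNReal.ofReal_lt_top (φ.memLp_coeff i).2)⟩

/-- Simple processes are step processes. -/
def SimpleProcess.toStep [IsFiniteMeasure P] (φ : SimpleProcess ℱ d) : StepProcess ℱ P d where
  n := φ.n
  time := φ.time
  mono := φ.mono
  coeff := φ.coeff
  measurable_coeff := φ.measurable_coeff
  memLp_coeff i := by
    obtain ⟨C, hC⟩ := φ.bounded_coeff i
    exact MemLp.of_bound ((φ.measurable_coeff i).mono (ℱ.le _) le_rfl).aestronglyMeasurable C
      (ae_of_all _ hC)

lemma SimpleProcess.memLp_eval [IsFiniteMeasure P] (φ : SimpleProcess ℱ d) (t : ℝ≥0) :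
    MemLp (fun z : Ω × ℝ => φ.eval z.2.toNNReal z.1) 2 (P.prod (timeMeasure t)) :=
  (φ.toStep (P := P)).memLp_eval t

lemma SimpleProcess.memLp_integral [IsFiniteMeasure P] (hW : IsIntegrator ℱ P W)
    (φ : SimpleProcess ℱ d) (t : ℝ≥0) : MemLp (φ.integral W t) 2 P :=
  (φ.toStep (P := P)).memLp_integral hW t

/-- The Itô isometry for the difference of two simple processes. -/
lemma SimpleProcess.eLpNorm_integral_sub [IsProbabilityMeasure P] (hW : IsIntegrator ℱ P W)
    (φ ψ : SimpleProcess ℱ d) (t : ℝ≥0) :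
    eLpNorm (fun ω => φ.integral W t ω - ψ.integral W t ω) 2 P
      = eLpNorm (fun z : Ω × ℝ => φ.eval z.2.toNNReal z.1 - ψ.eval z.2.toNNReal z.1) 2
          (P.prod (timeMeasure t)) := by
  refine eLpNorm_two_eq_of_integral_eq ((φ.memLp_integral hW t).sub (ψ.memLp_integral hW t))
    ((φ.memLp_eval t).sub (ψ.memLp_eval t)) ?_
  -- The two families are joined as a disjoint union, the second with reversed sign. As overlaps are
  -- allowed in `isometry`, no common refinement of the partitions is needed.
  have h := hW.isometry t ((Finset.range φ.n).disjSum (Finset.range ψ.n))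
    (Sum.elim φ.time ψ.time) (Sum.elim (fun i => φ.time (i + 1)) (fun i => ψ.time (i + 1)))
    (by rintro (i | i)
        · exact φ.mono (Nat.le_succ i)
        · exact ψ.mono (Nat.le_succ i))
    (Sum.elim φ.coeff (fun i ω => -ψ.coeff i ω))
    (by rintro (i | i)
        · exact φ.measurable_coeff i
        · exact (ψ.measurable_coeff i).neg)
    (by rintro (i | i)
        · exact φ.bounded_coeff i
        · simpa using ψ.bounded_coeff i)
  simp only [Finset.sum_disjSum, Sum.elim_inl, Sum.elim_inr, smul_neg, Finset.sum_neg_distrib,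
    ← sub_eq_add_neg] at h
  refine h.trans (integral_congr_ae (ae_of_all _ fun z => ?_))
  have h2 : ∀ i, (Set.Ioc (ψ.time i) (ψ.time (i + 1))).indicator (fun _ => -ψ.coeff i z.1)
      z.2.toNNReal = -(Set.Ioc (ψ.time i) (ψ.time (i + 1))).indicator (fun _ => ψ.coeff i z.1)
      z.2.toNNReal := fun i => by
    by_cases h : z.2.toNNReal ∈ Set.Ioc (ψ.time i) (ψ.time (i + 1)) <;> simp [Set.indicator, h]
  simp only [h2, Finset.sum_neg_distrib, ← sub_eq_add_neg]
  rfl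

/-- Cutting off where `‖η‖` is large is a small change in `L²`; the cut-off set is `ℱ s`-measurable,
so adaptedness survives. -/
lemma exists_bounded_approx [IsFiniteMeasure P] {s : ℝ≥0} {η : Ω → EuclideanSpace ℝ (Fin d)}
    (hη : Measurable[ℱ s] η) (hL : MemLp η 2 P) {ε : ℝ} (hε : 0 < ε) :
    ∃ ξ : Ω → EuclideanSpace ℝ (Fin d), Measurable[ℱ s] ξ ∧ (∃ C : ℝ, ∀ ω, ‖ξ ω‖ ≤ C) ∧
      eLpNorm (fun ω => ξ ω - η ω) 2 P ≤ ENNReal.ofReal ε := by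
  obtain ⟨M, hM⟩ := hL.eLpNorm_indicator_norm_ge_le
    (hη.mono (ℱ.le s) le_rfl).stronglyMeasurable hε
  set A : Set Ω := {ω | M ≤ ‖η ω‖₊} with hA
  have hAm : MeasurableSet[ℱ s] A :=
    hη (measurableSet_le measurable_const (measurable_coe_nnreal_real.comp measurable_nnnorm))
  refine ⟨Aᶜ.indicator η, hη.indicator hAm.compl, ⟨max M 0, fun ω => ?_⟩, ?_⟩
  · by_cases h : ω ∈ A
    · simp [h]
    · rw [Set.indicator_of_mem (show ω ∈ Aᶜ from h)]
      have : ‖η ω‖ < M := not_le.1 h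
      exact this.le.trans (le_max_left _ _)
  · refine le_trans (le_of_eq ?_) hM
    refine eLpNorm_congr_norm_ae (ae_of_all _ fun ω => ?_)
    by_cases h : ω ∈ A
    · simp [h]
    · rw [Set.indicator_of_mem (show ω ∈ Aᶜ from h), Set.indicator_of_notMem h]
      simp

/-- Step processes are approximated by simple processes, together with their integrals. -/
lemma StepProcess.exists_simple [IsProbabilityMeasure P] (hW : IsIntegrator ℱ P W)
    (φ : StepProcess ℱ P d) (t : ℝ≥0) {ε : ℝ} (hε : 0 < ε) :
    ∃ ψ : SimpleProcess ℱ d,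
      eLpNorm (fun z : Ω × ℝ => ψ.eval z.2.toNNReal z.1 - φ.eval z) 2 (P.prod (timeMeasure t))
        ≤ ENNReal.ofReal ε ∧
      eLpNorm (fun ω => ψ.integral W t ω - φ.integral W t ω) 2 P ≤ ENNReal.ofReal ε := by
  -- Each of the `φ.n` coefficients contributes at most `√t δ` to either error; the `+ 1` keeps the
  -- denominator positive when `φ.n = 0` or `t = 0`.
  set δ : ℝ := ε / (φ.n * √(t : ℝ) + 1) with hδ
  have hδ0 : 0 < δ := by positivity
  choose ξ hξm hξC hξ using fun i =>
    exists_bounded_approx (φ.measurable_coeff i) (φ.memLp_coeff i) hδ0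
  have hdm : ∀ i, Measurable[ℱ (φ.time i)] fun ω => ξ i ω - φ.coeff i ω :=
    fun i => (hξm i).sub (φ.measurable_coeff i)
  have hsum : ∑ _i ∈ Finset.range φ.n, ENNReal.ofReal √(t : ℝ) * ENNReal.ofReal δ
      ≤ ENNReal.ofReal ε := by
    rw [Finset.sum_const, Finset.card_range, ← ENNReal.ofReal_mul (Real.sqrt_nonneg _),
      ← ENNReal.ofReal_nsmul]
    refine ENNReal.ofReal_le_ofReal ?_
    rw [nsmul_eq_mul, hδ, ← mul_assoc, mul_div_assoc', div_le_iff₀ (by positivity)]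
    nlinarith
  refine ⟨⟨φ.n, φ.time, φ.mono, ξ, hξm, hξC⟩, ?_, ?_⟩
  · have h1 : (fun z : Ω × ℝ => SimpleProcess.eval ⟨φ.n, φ.time, φ.mono, ξ, hξm, hξC⟩
        z.2.toNNReal z.1 - φ.eval z) = ∑ i ∈ Finset.range φ.n, fun z : Ω × ℝ =>
        (Set.Ioc (φ.time i) (φ.time (i + 1))).indicator (fun _ => ξ i z.1 - φ.coeff i z.1)
          z.2.toNNReal := by
      funext z
      rw [Finset.sum_apply, SimpleProcess.eval, StepProcess.eval, ← Finset.sum_sub_distrib]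
      refine Finset.sum_congr rfl fun i _ => ?_
      by_cases h : z.2.toNNReal ∈ Set.Ioc (φ.time i) (φ.time (i + 1)) <;> simp [Set.indicator, h]
    rw [h1]
    refine (eLpNorm_sum_le (fun i _ => (measurable_indicator_Ioc
      ((hdm i).mono (ℱ.le _) le_rfl) _ _).aestronglyMeasurable) (by norm_num)).trans
      ((Finset.sum_le_sum fun i _ => ?_).trans hsum)
    refine (eLpNorm_indicator_Ioc_le t ((hdm i).mono (ℱ.le _) le_rfl) _ _).trans ?_
    gcongr
    exact hξ i
  · have h1 : (fun ω => SimpleProcess.integral ⟨φ.n, φ.time, φ.mono, ξ, hξm, hξC⟩ W t ω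
        - φ.integral W t ω) = ∑ i ∈ Finset.range φ.n, fun ω =>
        (W (min t (φ.time (i + 1))) ω - W (min t (φ.time i)) ω) • (ξ i ω - φ.coeff i ω) := by
      funext ω
      rw [Finset.sum_apply, SimpleProcess.integral, StepProcess.integral,
        ← Finset.sum_sub_distrib]
      exact Finset.sum_congr rfl fun i _ => by rw [smul_sub]
    rw [h1]
    refine (eLpNorm_sum_le (fun i _ => ((hW.measurable_sub _ _).smul
      ((hdm i).mono (ℱ.le _) le_rfl)).aestronglyMeasurable) (by norm_num)).trans
      ((Finset.sum_le_sum fun i _ => ?_).trans hsum)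
    refine (hW.eLpNorm_min_sub_smul_le t (φ.mono (Nat.le_succ i)) (hdm i)).trans ?_
    gcongr
    exact hξ i

lemma eLpNorm_sub_le_add {α E : Type*} {mα : MeasurableSpace α} {μ : Measure α}
    [NormedAddCommGroup E] {f g h : α → E} (hf : AEStronglyMeasurable f μ)
    (hg : AEStronglyMeasurable g μ) (hh : AEStronglyMeasurable h μ) :
    eLpNorm (fun x => f x - h x) 2 μ
      ≤ eLpNorm (fun x => f x - g x) 2 μ + eLpNorm (fun x => g x - h x) 2 μ := by
  have : (fun x => f x - h x) = (fun x => f x - g x) + fun x => g x - h x := by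
    funext x; simp
  rw [this]
  exact eLpNorm_add_le (hf.sub hg) (hg.sub hh) (by norm_num)

lemma eLpNorm_two_sub_comm {α E : Type*} {mα : MeasurableSpace α} {μ : Measure α}
    [NormedAddCommGroup E] (f g : α → E) :
    eLpNorm (fun x => f x - g x) 2 μ = eLpNorm (fun x => g x - f x) 2 μ :=
  eLpNorm_sub_comm f g 2 μ

lemma tendsto_eLpNorm_sub_trans {α ι E : Type*} {mα : MeasurableSpace α} {μ : Measure α}
    [NormedAddCommGroup E] {l : Filter ι} {f g h : ι → α → E}
    (hf : ∀ n, AEStronglyMeasurable (f n) μ) (hg : ∀ n, AEStronglyMeasurable (g n) μ)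
    (hh : ∀ n, AEStronglyMeasurable (h n) μ)
    (hfg : Tendsto (fun n => eLpNorm (fun x => f n x - g n x) 2 μ) l (𝓝 0))
    (hgh : Tendsto (fun n => eLpNorm (fun x => g n x - h n x) 2 μ) l (𝓝 0)) :
    Tendsto (fun n => eLpNorm (fun x => f n x - h n x) 2 μ) l (𝓝 0) := by
  have h0 := hfg.add hgh
  rw [add_zero] at h0
  exact tendsto_of_tendsto_of_tendsto_of_le_of_le tendsto_const_nhds h0 (fun _ => zero_le)
    fun n => eLpNorm_sub_le_add (hf n) (hg n) (hh n)

/-- By the isometry the elementary integrals form a Cauchy sequence, and `L²` is complete. -/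
lemma IsIntegrator.exists_isItoIntegral [IsProbabilityMeasure P] (hW : IsIntegrator ℱ P W)
    (t : ℝ≥0) {X : ℝ≥0 → Ω → EuclideanSpace ℝ (Fin d)}
    (hX : MemLp (fun z : Ω × ℝ => X z.2.toNNReal z.1) 2 (P.prod (timeMeasure t)))
    (φ : ℕ → SimpleProcess ℱ d)
    (hφ : Tendsto (fun n => eLpNorm (fun z : Ω × ℝ => (φ n).eval z.2.toNNReal z.1
      - X z.2.toNNReal z.1) 2 (P.prod (timeMeasure t))) atTop (𝓝 0)) :
    ∃ I, IsItoIntegral ℱ P W X t I := by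
  have hm := fun n => (φ n).memLp_integral hW t
  set u : ℕ → Lp (EuclideanSpace ℝ (Fin d)) 2 P := fun n => (hm n).toLp _ with hu
  have hcauchy : CauchySeq u := by
    rw [Lp.cauchySeq_Lp_iff_cauchySeq_eLpNorm]
    have h1 : ∀ n : ℕ × ℕ, eLpNorm (⇑(u n.1) - ⇑(u n.2)) 2 P
        = eLpNorm (fun z : Ω × ℝ => (φ n.1).eval z.2.toNNReal z.1
          - (φ n.2).eval z.2.toNNReal z.1) 2 (P.prod (timeMeasure t)) := by
      intro n
      rw [← SimpleProcess.eLpNorm_integral_sub hW]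
      exact eLpNorm_congr_ae ((hm n.1).coeFn_toLp.sub (hm n.2).coeFn_toLp)
    simp_rw [h1]
    rw [← prod_atTop_atTop_eq]
    have h2 : Tendsto (fun n : ℕ × ℕ => eLpNorm (fun z : Ω × ℝ => (φ n.1).eval z.2.toNNReal z.1
      - X z.2.toNNReal z.1) 2 (P.prod (timeMeasure t))) (atTop ×ˢ atTop) (𝓝 0) :=
      hφ.comp tendsto_fst
    have h3 : Tendsto (fun n : ℕ × ℕ => eLpNorm (fun z : Ω × ℝ => X z.2.toNNReal z.1
      - (φ n.2).eval z.2.toNNReal z.1) 2 (P.prod (timeMeasure t))) (atTop ×ˢ atTop) (𝓝 0) := by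
      simp_rw [eLpNorm_two_sub_comm (fun z : Ω × ℝ => X z.2.toNNReal z.1)]
      exact hφ.comp tendsto_snd
    exact tendsto_eLpNorm_sub_trans (f := fun (n : ℕ × ℕ) (z : Ω × ℝ) =>
      (φ n.1).eval z.2.toNNReal z.1) (g := fun _ z => X z.2.toNNReal z.1)
      (h := fun (n : ℕ × ℕ) (z : Ω × ℝ) => (φ n.2).eval z.2.toNNReal z.1)
      (fun n => ((φ n.1).memLp_eval t).1) (fun _ => hX.1) (fun n => ((φ n.2).memLp_eval t).1) h2 h3
  obtain ⟨v, hv⟩ := cauchySeq_tendsto_of_complete hcauchy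
  have hv2 : Tendsto u atTop (𝓝 ((Lp.memLp v).toLp v)) := by rwa [Lp.toLp_coeFn]
  refine ⟨v, hX, Lp.memLp v, φ, hφ, ?_⟩
  exact (Lp.tendsto_Lp_iff_tendsto_eLpNorm'' _ hm _ (Lp.memLp v)).1 hv2

/-- If step processes converge to `X` in `L²`, their integrals converge to the Itô integral
of `X`. -/
theorem IsIntegrator.tendsto_itoIntegral [IsProbabilityMeasure P] (hW : IsIntegrator ℱ P W)
    (t : ℝ≥0) {X : ℝ≥0 → Ω → EuclideanSpace ℝ (Fin d)}
    (hX : MemLp (fun z : Ω × ℝ => X z.2.toNNReal z.1) 2 (P.prod (timeMeasure t)))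
    (φ : ℕ → StepProcess ℱ P d)
    (hφ : Tendsto (fun n => eLpNorm (fun z : Ω × ℝ => (φ n).eval z
      - X z.2.toNNReal z.1) 2 (P.prod (timeMeasure t))) atTop (𝓝 0)) :
    MemLp (itoIntegral ℱ P W X t) 2 P ∧
    Tendsto (fun n => eLpNorm (fun ω => (φ n).integral W t ω - itoIntegral ℱ P W X t ω) 2 P)
      atTop (𝓝 0) := by
  choose ψ hψ1 hψ2 using fun n : ℕ => (φ n).exists_simple hW t (ε := 1 / ((n : ℝ) + 1))
    (by positivity)
  have hε : Tendsto (fun n : ℕ => ENNReal.ofReal (1 / ((n : ℝ) + 1))) atTop (𝓝 0) := by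
    simpa using ENNReal.tendsto_ofReal tendsto_one_div_add_atTop_nhds_zero_nat
  have hψ1' := tendsto_of_tendsto_of_tendsto_of_le_of_le tendsto_const_nhds hε
    (fun _ => zero_le) hψ1
  have hψ2' := tendsto_of_tendsto_of_tendsto_of_le_of_le tendsto_const_nhds hε
    (fun _ => zero_le) hψ2
  have hψX := tendsto_eLpNorm_sub_trans (fun n => ((ψ n).memLp_eval t).1)
    (fun n => ((φ n).memLp_eval t).1) (fun _ => hX.1) hψ1' hφ
  have hex := hW.exists_isItoIntegral t hX ψ hψX
  have hspec := hex.choose_spec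
  have hdef : itoIntegral ℱ P W X t = hex.choose := dif_pos hex
  rw [← hdef] at hspec
  obtain ⟨-, hI, χ, hχX, hχI⟩ := hspec
  refine ⟨hI, ?_⟩
  -- `itoIntegral` is a chosen element with its own approximating sequence `χ`. Since `ψ` and `χ`
  -- both approximate `X`, the isometry forces their integrals together.
  have hψχ : Tendsto (fun n => eLpNorm (fun ω => (ψ n).integral W t ω - (χ n).integral W t ω) 2 P)
      atTop (𝓝 0) := by
    simp_rw [SimpleProcess.eLpNorm_integral_sub hW]
    refine tendsto_eLpNorm_sub_trans (fun n => ((ψ n).memLp_eval t).1) (fun _ => hX.1)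
      (fun n => ((χ n).memLp_eval t).1) hψX ?_
    simp_rw [eLpNorm_two_sub_comm (fun z : Ω × ℝ => X z.2.toNNReal z.1)]
    exact hχX
  refine tendsto_eLpNorm_sub_trans (fun n => ((φ n).memLp_integral hW t).1)
    (fun n => ((ψ n).memLp_integral hW t).1) (fun _ => hI.1) ?_
    (tendsto_eLpNorm_sub_trans (fun n => ((ψ n).memLp_integral hW t).1)
      (fun n => ((χ n).memLp_integral hW t).1) (fun _ => hI.1) hψχ hχI)
  simp_rw [eLpNorm_two_sub_comm ((φ _).integral W t)]
  exact hψ2'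

lemma eLpNorm_add_sq_of_integral_inner_eq_zero {f g : Ω → EuclideanSpace ℝ (Fin d)}
    (hf : MemLp f 2 P) (hg : MemLp g 2 P) (h : ∫ ω, inner ℝ (f ω) (g ω) ∂P = 0) :
    eLpNorm (f + g) 2 P ^ 2 = eLpNorm f 2 P ^ 2 + eLpNorm g 2 P ^ 2 := by
  have key : ∀ {u : Ω → EuclideanSpace ℝ (Fin d)}, MemLp u 2 P →
      eLpNorm u 2 P ^ 2 = ENNReal.ofReal (∫ ω, ‖u ω‖ ^ 2 ∂P) := by
    intro u hu
    rw [eLpNorm_two_sq, ofReal_integral_eq_lintegral_ofReal hu.norm.integrable_sq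
      (ae_of_all _ fun _ => sq_nonneg _)]
    refine lintegral_congr fun ω => ?_
    rw [ENNReal.ofReal_pow (norm_nonneg _), ofReal_norm]
  rw [key hf, key hg, key (hf.add hg), ← ENNReal.ofReal_add
    (integral_nonneg fun _ => sq_nonneg _) (integral_nonneg fun _ => sq_nonneg _)]
  congr 1
  simp_rw [Pi.add_apply, norm_add_sq_real]
  have hfg : Integrable (fun ω => (inner ℝ (f ω) (g ω) : ℝ)) P := by
    refine (hf.norm.integrable_mul hg.norm).mono' (hf.1.inner hg.1) (ae_of_all _ fun ω => ?_)
    exact abs_real_inner_le_norm _ _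
  have h12 : Integrable (fun ω => ‖f ω‖ ^ 2 + 2 * inner ℝ (f ω) (g ω)) P :=
    hf.norm.integrable_sq.add (hfg.const_mul 2)
  rw [integral_add h12 hg.norm.integrable_sq,
    integral_add hf.norm.integrable_sq (hfg.const_mul 2), integral_const_mul, h]
  ring

end Limit

/-! ### Quadratic covariation of Brownian motion -/

section Covariation

variable {Ω : Type*} {mΩ : MeasurableSpace Ω} {P : Measure Ω} [IsProbabilityMeasure P]
  {ℱ : Filtration ℝ≥0 mΩ} {m d : ℕ} {B : ℝ≥0 → Ω → (Fin m → ℝ)}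

lemma IsBrownianMotion.integral_comp_sub (hB : IsBrownianMotion ℱ P B) {s t : ℝ≥0} (hst : s ≤ t)
    {ψ : (Fin m → ℝ) → ℝ} (hψ : Measurable ψ) :
    ∫ ω, ψ (B t ω - B s ω) ∂P = ∫ z, ψ (√((t : ℝ) - s) • z) ∂(stdGauss m) := by
  rw [← integral_map (hB.measurable_sub s t).aemeasurable hψ.aestronglyMeasurable,
    hB.map_sub hst, integral_map (by fun_prop) hψ.aestronglyMeasurable]

lemma IsBrownianMotion.eLpNorm_comp_sub (hB : IsBrownianMotion ℱ P B) {s t : ℝ≥0} (hst : s ≤ t)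
    {ψ : (Fin m → ℝ) → ℝ} (hψ : Measurable ψ) :
    eLpNorm (fun ω => ψ (B t ω - B s ω)) 2 P
      = eLpNorm (fun z => ψ (√((t : ℝ) - s) • z)) 2 (stdGauss m) := by
  have h1 := eLpNorm_map_measure (p := 2) (μ := P) hψ.aestronglyMeasurable
    (hB.measurable_sub s t).aemeasurable
  have h2 := eLpNorm_map_measure (p := 2) (μ := stdGauss m)
    (f := fun z : Fin m → ℝ => √((t : ℝ) - s) • z) hψ.aestronglyMeasurable (by fun_prop)
  rw [← hB.map_sub hst, h1] at h2
  exact h2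

lemma IsBrownianMotion.isIntegrator (hB : IsBrownianMotion ℱ P B) (j : Fin m) :
    IsIntegrator ℱ P (fun t ω => B t ω j) where
  adapted t := (measurable_pi_apply j).comp (hB.adapted t)
  indep s t hst := by
    refine indep_of_indep_of_le_left (hB.indep_increment s t hst) ?_
    have : (fun ω => B t ω j - B s ω j) = (fun b : Fin m → ℝ => b j) ∘ fun ω => B t ω - B s ω := rfl
    rw [this, ← MeasurableSpace.comap_comp]
    exact MeasurableSpace.comap_mono (measurable_pi_apply j).comap_le
  memLp_sub s t hst := by
    refine ⟨((measurable_pi_apply j).comp (hB.measurable_sub s t)).aestronglyMeasurable, ?_⟩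
    have := hB.eLpNorm_comp_sub hst (ψ := fun b => b j) (measurable_pi_apply j)
    refine lt_of_eq_of_lt this ?_
    exact ((memLp_eval_stdGauss j 2 (by simp)).const_mul _).2
  integral_sub s t hst := by
    refine (hB.integral_comp_sub hst (ψ := fun b => b j) (measurable_pi_apply j)).trans ?_
    simp [integral_const_mul, integral_eval_stdGauss]
  integral_sub_sq s t hst := by
    refine (hB.integral_comp_sub hst (ψ := fun b => b j ^ 2) (by fun_prop)).trans ?_
    have h0 : (0 : ℝ) ≤ t - s := sub_nonneg.2 (by exact_mod_cast hst)
    simp only [Pi.smul_apply, smul_eq_mul, mul_pow, Real.sq_sqrt h0, integral_const_mul]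
    have := integral_eval_mul_eval_stdGauss j j
    simp_rw [← sq] at this
    rw [this]; simp

/-- The centered product of two coordinates of an increment over a time interval of length `τ`. -/
def covDefect (i j : Fin m) (τ : ℝ) (b : Fin m → ℝ) : ℝ := b i * b j - if i = j then τ else 0

lemma measurable_covDefect (i j : Fin m) (τ : ℝ) : Measurable (covDefect i j τ) := by
  unfold covDefect; fun_prop

lemma covDefect_smul (i j : Fin m) {τ : ℝ} (hτ : 0 ≤ τ) (z : Fin m → ℝ) :
    covDefect i j τ (√τ • z) = τ * covDefect i j 1 z := by
  unfold covDefect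
  simp only [Pi.smul_apply, smul_eq_mul]
  have := Real.mul_self_sqrt hτ
  split_ifs <;> linear_combination (z i * z j) * this

lemma memLp_covDefect (i j : Fin m) : MemLp (covDefect i j 1) 2 (stdGauss m) := by
  have hm := (measurable_covDefect i j 1).aestronglyMeasurable (μ := stdGauss m)
  refine (memLp_two_iff_integrable_sq hm).2 ?_
  refine ((integrable_wt_pow 4).const_mul 4).mono' (hm.pow 2) (ae_of_all _ fun z => ?_)
  have hz : ∀ j, |z j| ≤ wt z := fun j => by
    have := Finset.single_le_sum (f := fun j => |z j|) (fun j _ => abs_nonneg _)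
      (Finset.mem_univ j)
    unfold wt; linarith
  have hw := one_le_wt z
  have h1 : |covDefect i j 1 z| ≤ 2 * wt z ^ 2 := by
    unfold covDefect
    refine (abs_sub _ _).trans ?_
    rw [abs_mul]
    have h2 : |z i| * |z j| ≤ wt z * wt z :=
      mul_le_mul (hz i) (hz j) (abs_nonneg _) (by linarith)
    have h3 : |if i = j then (1 : ℝ) else 0| ≤ 1 := by split_ifs <;> simp
    nlinarith
  rw [Real.norm_eq_abs, abs_pow]
  calc |covDefect i j 1 z| ^ 2 ≤ (2 * wt z ^ 2) ^ 2 := by gcongr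
    _ = 4 * wt z ^ 4 := by ring

/-- The norm is linear in the length of the interval, so orthogonal sums of defects over a mesh have
squared norm of the order of the mesh size. -/
lemma IsBrownianMotion.eLpNorm_covDefect (hB : IsBrownianMotion ℱ P B) {s t : ℝ≥0} (hst : s ≤ t)
    (i j : Fin m) :
    eLpNorm (fun ω => covDefect i j ((t : ℝ) - s) (B t ω - B s ω)) 2 P
      = ENNReal.ofReal ((t : ℝ) - s) * eLpNorm (covDefect i j 1) 2 (stdGauss m) := by
  have h0 : (0 : ℝ) ≤ t - s := sub_nonneg.2 (by exact_mod_cast hst)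
  rw [hB.eLpNorm_comp_sub hst (measurable_covDefect i j _)]
  simp_rw [covDefect_smul i j h0]
  have := eLpNorm_const_smul ((t : ℝ) - s) (covDefect i j 1) 2 (stdGauss m)
  rw [Real.enorm_of_nonneg h0] at this
  exact this

lemma IsBrownianMotion.integral_covDefect (hB : IsBrownianMotion ℱ P B) {s t : ℝ≥0} (hst : s ≤ t)
    (i j : Fin m) : ∫ ω, covDefect i j ((t : ℝ) - s) (B t ω - B s ω) ∂P = 0 := by
  have h0 : (0 : ℝ) ≤ t - s := sub_nonneg.2 (by exact_mod_cast hst)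
  rw [hB.integral_comp_sub hst (measurable_covDefect i j _)]
  simp_rw [covDefect_smul i j h0, integral_const_mul, covDefect]
  rw [integral_sub (integrable_eval_mul_eval_stdGauss i j) (integrable_const _),
    integral_eval_mul_eval_stdGauss]
  simp

/-- Weighted sums of covariation defects over a partition are orthogonal. -/
lemma IsBrownianMotion.eLpNorm_sum_covDefect_sq (hB : IsBrownianMotion ℱ P B) {σ : ℕ → ℝ≥0}
    (hσ : Monotone σ) (i j : Fin m) {η : ℕ → Ω → EuclideanSpace ℝ (Fin d)}
    (hη : ∀ q, Measurable[ℱ (σ q)] (η q)) (hη2 : ∀ q, MemLp (η q) 2 P) (N : ℕ) :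
    eLpNorm (fun ω => ∑ q ∈ Finset.range N,
        covDefect i j ((σ (q + 1) : ℝ) - σ q) (B (σ (q + 1)) ω - B (σ q) ω) • η q ω) 2 P ^ 2
      = ∑ q ∈ Finset.range N, (ENNReal.ofReal ((σ (q + 1) : ℝ) - σ q)
          * eLpNorm (covDefect i j 1) 2 (stdGauss m) * eLpNorm (η q) 2 P) ^ 2 := by
  set c : ℕ → Ω → ℝ := fun q ω =>
    covDefect i j ((σ (q + 1) : ℝ) - σ q) (B (σ (q + 1)) ω - B (σ q) ω) with hc
  have hle : ∀ q, σ q ≤ σ (q + 1) := fun q => hσ (Nat.le_succ q)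
  have hcm : ∀ q, Measurable (c q) := fun q =>
    (measurable_covDefect i j _).comp (hB.measurable_sub _ _)
  have hcF : ∀ q, Measurable[ℱ (σ (q + 1))] (c q) := fun q =>
    (measurable_covDefect i j _).comp
      ((hB.adapted _).sub ((hB.adapted _).mono (ℱ.mono (hle q)) le_rfl))
  have hηm : ∀ q, Measurable (η q) := fun q => (hη q).mono (ℱ.le _) le_rfl
  have hind : ∀ q {E : Type} [MeasurableSpace E] {X : Ω → E}, Measurable[ℱ (σ q)] X →
      IndepFun (c q) X P := fun q E _ X hX => by
    have := (hB.indepFun_sub (hle q) hX).symm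
    exact this.comp (ψ := id) (measurable_covDefect i j _) measurable_id
  have hnorm : ∀ q, eLpNorm (fun ω => c q ω • η q ω) 2 P
      = ENNReal.ofReal ((σ (q + 1) : ℝ) - σ q)
          * eLpNorm (covDefect i j 1) 2 (stdGauss m) * eLpNorm (η q) 2 P := fun q => by
    rw [eLpNorm_two_smul_of_indepFun (hcm q) (hηm q) (hind q (hη q)), hc]
    simp only
    rw [hB.eLpNorm_covDefect (hle q) i j]
  have hmem : ∀ q, MemLp (fun ω => c q ω • η q ω) 2 P := fun q =>
    ⟨((hcm q).smul (hηm q)).aestronglyMeasurable, by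
      rw [hnorm]
      exact ENNReal.mul_lt_top (ENNReal.mul_lt_top ENNReal.ofReal_lt_top (memLp_covDefect i j).2)
        (hη2 q).2⟩
  have hS : ∀ N, Measurable[ℱ (σ N)] fun ω => ∑ q ∈ Finset.range N, c q ω • η q ω := by
    intro N
    refine Finset.measurable_sum _ fun q hq => ?_
    have hq' : σ (q + 1) ≤ σ N := hσ (Finset.mem_range.1 hq)
    exact ((hcF q).mono (ℱ.mono hq') le_rfl).smul
      ((hη q).mono (ℱ.mono ((hle q).trans hq')) le_rfl)
  induction N with
  | zero => simp
  | succ N ih =>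
    have h1 : (fun ω => ∑ q ∈ Finset.range (N + 1), c q ω • η q ω)
        = (fun ω => ∑ q ∈ Finset.range N, c q ω • η q ω) + fun ω => c N ω • η N ω := by
      funext ω; simp [Finset.sum_range_succ]
    -- Pythagoras: the new defect is centred and independent of `ℱ (σ N)`, with respect to which the
    -- earlier sum and `η N` are measurable.
    rw [h1, Finset.sum_range_succ, eLpNorm_add_sq_of_integral_inner_eq_zero
      (memLp_finsetSum _ fun q _ => hmem q) (hmem N), ih, hnorm]
    have h2 : Measurable[ℱ (σ N)] fun ω =>
        (inner ℝ (∑ q ∈ Finset.range N, c q ω • η q ω) (η N ω) : ℝ) := (hS N).inner (hη N)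
    simp_rw [inner_smul_right]
    rw [(hind N h2).integral_fun_mul_eq_mul_integral (hcm N).aestronglyMeasurable
      (h2.mono (ℱ.le _) le_rfl).aestronglyMeasurable, hc]
    simp only
    rw [hB.integral_covDefect (hle N), zero_mul]

end Covariation

/-! ### Joint measurability in time and chance. -/

section JointMeasurability

variable {Ω : Type*} {mΩ : MeasurableSpace Ω} {P : Measure Ω} {ℱ : Filtration ℝ≥0 mΩ} {m : ℕ}
  {B : ℝ≥0 → Ω → (Fin m → ℝ)}

/-- Brownian motion is jointly measurable, up to a null set. -/
lemma IsBrownianMotion.aestronglyMeasurable_uncurry (hB : IsBrownianMotion ℱ P B) (j : Fin m)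
    (t : ℝ≥0) : AEStronglyMeasurable (fun z : Ω × ℝ => B z.2.toNNReal z.1 j)
      (P.prod (timeMeasure t)) := by
  refine AEMeasurable.aestronglyMeasurable ?_
  -- The path is sampled at the grid points `⌊s n⌋ / n` to the left of `s`. Convergence uses path
  -- continuity, which holds only almost surely.
  refine aemeasurable_of_tendsto_metrizable_ae (atTop : Filter ℕ)
    (f := fun (n : ℕ) (z : Ω × ℝ) => B ((⌊z.2 * (n : ℝ)⌋₊ : ℝ≥0) / (n : ℝ≥0)) z.1 j) (fun n => ?_) ?_
  · have h1 : Measurable fun y : Ω × ℕ => B ((y.2 : ℝ≥0) / n) y.1 j :=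
      measurable_from_prod_countable_left fun k =>
        (measurable_pi_apply j).comp (hB.measurable ((k : ℝ≥0) / n))
    have h2 : Measurable fun z : Ω × ℝ => (z.1, ⌊z.2 * (n : ℝ)⌋₊) :=
      measurable_fst.prodMk (Nat.measurable_floor.comp
        (measurable_snd.mul_const _))
    exact (h1.comp h2).aemeasurable
  · have h1 := Measure.quasiMeasurePreserving_fst (μ := P) (ν := timeMeasure t)
    filter_upwards [h1.ae (hB.isBrownianReal j).cont] with z hz
    have h2 : Tendsto (fun n : ℕ => (⌊z.2 * (n : ℝ)⌋₊ : ℝ≥0) / n) atTop (𝓝 z.2.toNNReal) := by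
      rw [← NNReal.tendsto_coe]
      push_cast
      rcases le_total 0 z.2 with h0 | h0
      · rw [Real.coe_toNNReal _ h0]
        exact (tendsto_nat_floor_mul_div_atTop h0).comp tendsto_natCast_atTop_atTop
      · rw [Real.toNNReal_of_nonpos h0]
        refine tendsto_const_nhds.congr fun n => ?_
        rw [Nat.floor_of_nonpos (mul_nonpos_of_nonpos_of_nonneg h0 n.cast_nonneg)]
        simp
    exact (hz.tendsto _).comp h2

end JointMeasurability

/-! ### Summation by parts -/

section SummationByParts

variable {m : ℕ} {E : Type*} [AddCommGroup E] [Module ℝ E]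

/-- A discrete Itô product formula: the products of increments telescope, with `σ` as compensator.
Symmetry of `lm` pairs the two cross terms; an antisymmetric part would leave a Lévy area that the
total increment does not determine. -/
lemma sum_block (x : ℕ → Fin m → ℝ) (σ : ℕ → ℝ) {lm : Fin m → Fin m → E}
    (hsymm : ∀ i j, lm i j = lm j i) (r : ℕ) :
    ∑ q ∈ Finset.range r, (∑ i, (x (q + 1) i - x q i) • ∑ j, (x q j - x 0 j) • lm i j
      + (1 / 2 : ℝ) • ∑ i, ∑ j, covDefect i j (σ (q + 1) - σ q) (x (q + 1) - x q) • lm i j)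
    = (1 / 2 : ℝ) • ∑ i, ∑ j, covDefect i j (σ r - σ 0) (x r - x 0) • lm i j := by
  induction r with
  | zero => simp [covDefect]
  | succ r ih =>
    rw [Finset.sum_range_succ, ih]
    have h1 : ∑ i, (x (r + 1) i - x r i) • ∑ j, (x r j - x 0 j) • lm i j
        = (1 / 2 : ℝ) • ∑ i, ∑ j, ((x (r + 1) i - x r i) * (x r j - x 0 j)
          + (x r i - x 0 i) * (x (r + 1) j - x r j)) • lm i j := by
      simp_rw [add_smul, Finset.sum_add_distrib]
      have h2 : ∑ i, ∑ j, ((x r i - x 0 i) * (x (r + 1) j - x r j)) • lm i j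
          = ∑ i, ∑ j, ((x (r + 1) i - x r i) * (x r j - x 0 j)) • lm i j := by
        rw [Finset.sum_comm]
        refine Finset.sum_congr rfl fun i _ => Finset.sum_congr rfl fun j _ => ?_
        rw [hsymm j i, mul_comm]
      rw [h2, ← two_smul ℝ, smul_smul]
      norm_num
      simp_rw [Finset.smul_sum, smul_smul]
    rw [h1, ← smul_add, ← smul_add]
    congr 1
    simp_rw [← Finset.sum_add_distrib, ← add_smul]
    refine Finset.sum_congr rfl fun i _ => Finset.sum_congr rfl fun j _ => ?_
    congr 1
    simp only [covDefect, Pi.sub_apply]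
    split_ifs <;> ring

/-- Summation by parts on a grid of blocks of length `n`. -/
lemma sum_grid (x : ℕ → Fin m → ℝ) (σ : ℕ → ℝ) {lm : ℕ → Fin m → Fin m → E}
    (hsymm : ∀ l i j, lm l i j = lm l j i) {n : ℕ} (hn : 0 < n) (M : ℕ) :
    ∑ q ∈ Finset.range (M * n), (∑ i, (x (q + 1) i - x q i) •
        ∑ j, (x q j - x (q / n * n) j) • lm (q / n) i j
      + (1 / 2 : ℝ) • ∑ i, ∑ j,
        covDefect i j (σ (q + 1) - σ q) (x (q + 1) - x q) • lm (q / n) i j)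
    = ∑ l ∈ Finset.range M, (1 / 2 : ℝ) • ∑ i, ∑ j,
        covDefect i j (σ ((l + 1) * n) - σ (l * n)) (x ((l + 1) * n) - x (l * n)) • lm l i j := by
  induction M with
  | zero => simp
  | succ M ih =>
    rw [add_mul, one_mul, Finset.sum_range_add, ih, Finset.sum_range_succ]
    congr 1
    have h := sum_block (fun q => x (M * n + q)) (fun q => σ (M * n + q)) (hsymm M) n
    simp only [add_zero] at h
    rw [add_mul, one_mul, ← h]
    refine Finset.sum_congr rfl fun q hq => ?_
    have hdiv : (M * n + q) / n = M := by
      rw [mul_comm, Nat.mul_add_div hn, Nat.div_eq_of_lt (Finset.mem_range.1 hq), add_zero]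
    rw [hdiv, add_assoc]

end SummationByParts

/-! ### Processes on a grid -/

section Grid

variable {Ω : Type*} {mΩ : MeasurableSpace Ω} {P : Measure Ω} {ℱ : Filtration ℝ≥0 mΩ} {d : ℕ}

/-- Step processes live on intervals `(a, b]`, while the scheme's interpolation is constant on `[a,
b)`. They can disagree only at grid points, which form a null set. -/
lemma ae_mem_grid_interior (t : ℝ≥0) {δ : ℝ≥0} (hδ : 0 < δ) :
    ∀ᵐ (s : ℝ) ∂(timeMeasure t), 0 < s ∧ s ≤ (t : ℝ) ∧
      ((⌊s.toNNReal / δ⌋₊ : ℝ≥0) * δ) < s.toNNReal ∧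
        s.toNNReal < ((⌊s.toNNReal / δ⌋₊ + 1 : ℕ) : ℝ≥0) * δ := by
  have h1 : ∀ᵐ (s : ℝ) ∂(timeMeasure t), s ∈ Set.Ioc 0 (t : ℝ) := ae_restrict_mem measurableSet_Ioc
  have hc : (Set.range fun q : ℕ => (((q : ℝ≥0) * δ : ℝ≥0) : ℝ)).Countable :=
    Set.countable_range _
  have h2 : ∀ᵐ (s : ℝ) ∂(timeMeasure t), s ∉ Set.range fun q : ℕ => (((q : ℝ≥0) * δ : ℝ≥0) : ℝ) :=
    hc.ae_notMem _
  filter_upwards [h1, h2] with s hs hs2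
  refine ⟨hs.1, hs.2, lt_of_le_of_ne ?_ fun h => hs2 ⟨⌊s.toNNReal / δ⌋₊, ?_⟩, ?_⟩
  · rw [← le_div_iff₀ hδ]
    exact Nat.floor_le zero_le
  · simp only
    rw [h, Real.coe_toNNReal _ hs.1.le]
  · rw [← div_lt_iff₀ hδ]
    push_cast
    exact Nat.lt_floor_add_one _

lemma StepProcess.eval_grid (φ : StepProcess ℱ P d) (t : ℝ≥0) {δ : ℝ≥0} (hδ : 0 < δ)
    (htime : ∀ q, φ.time q = q * δ) (hn : t < φ.n * δ) :
    ∀ᵐ z ∂(P.prod (timeMeasure t)),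
      φ.eval z = φ.coeff ⌊z.2.toNNReal / δ⌋₊ z.1 := by
  have h1 := Measure.quasiMeasurePreserving_snd (μ := P) (ν := timeMeasure t)
  filter_upwards [h1.ae (ae_mem_grid_interior t hδ)] with z hz
  obtain ⟨h0, hzt, hlo, hhi⟩ := hz
  have hst : z.2.toNNReal ≤ t := Real.toNNReal_le_iff_le_coe.2 hzt
  rw [StepProcess.eval, Finset.sum_eq_single ⌊z.2.toNNReal / δ⌋₊]
  · rw [Set.indicator_of_mem]
    rw [htime, htime]
    exact ⟨hlo, hhi.le⟩
  · intro q _ hq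
    rw [Set.indicator_of_notMem]
    rw [htime, htime]
    rintro ⟨h3, h4⟩
    have h5 : (q : ℝ≥0) * δ < ((⌊z.2.toNNReal / δ⌋₊ + 1 : ℕ) : ℝ≥0) * δ := h3.trans hhi
    have h6 : (⌊z.2.toNNReal / δ⌋₊ : ℝ≥0) * δ < ((q + 1 : ℕ) : ℝ≥0) * δ := hlo.trans_le h4
    have h7 := lt_of_mul_lt_mul_right h5 zero_le
    have h8 := lt_of_mul_lt_mul_right h6 zero_le
    norm_cast at h7 h8
    omega
  · intro hq
    exfalso
    apply hq
    have : (⌊z.2.toNNReal / δ⌋₊ : ℝ≥0) * δ < φ.n * δ := hlo.trans_le (hst.trans hn.le)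
    have := lt_of_mul_lt_mul_right this zero_le
    exact Finset.mem_range.2 (by exact_mod_cast this)

end Grid

/-! ### The explicit form of the scheme at time `t` -/

section Explicit

variable {Ω : Type*} {m d : ℕ}
  {f : EuclideanSpace ℝ (Fin d) → EuclideanSpace ℝ (Fin d)}
  {g : Fin m → EuclideanSpace ℝ (Fin d) → EuclideanSpace ℝ (Fin d)}
  {r : ℝ} {Δ : ℝ≥0} {x₀ : EuclideanSpace ℝ (Fin d)} {B : ℝ≥0 → Ω → (Fin m → ℝ)}

lemma milstein_eq_sum (k : ℕ) (ω : Ω) :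
    milstein f g r Δ x₀ B k ω = x₀ + ∑ l ∈ Finset.range k,
      (step (trunc r f) (fun j => trunc r (g j)) (truncLop r g) Δ (milstein f g r Δ x₀ B l ω)
          (B (((l + 1 : ℕ) : ℝ≥0) * Δ) ω - B ((l : ℝ≥0) * Δ) ω)
        - milstein f g r Δ x₀ B l ω) := by
  induction k with
  | zero => simp [milstein]
  | succ k ih =>
    rw [Finset.sum_range_succ, ← add_assoc, ← ih, milstein_succ]
    abel

lemma floor_div_mul_le (hΔ : 0 < Δ) (t : ℝ≥0) : (⌊t / Δ⌋₊ : ℝ≥0) * Δ ≤ t := by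
  rw [← le_div_iff₀ hΔ]
  exact Nat.floor_le zero_le

lemma lt_floor_div_succ_mul (hΔ : 0 < Δ) (t : ℝ≥0) : t < ((⌊t / Δ⌋₊ + 1 : ℕ) : ℝ≥0) * Δ := by
  rw [← div_lt_iff₀ hΔ]
  push_cast
  exact Nat.lt_floor_add_one _

lemma min_natCast_mul (hΔ : 0 < Δ) (t : ℝ≥0) {l : ℕ} (hl : l ≤ ⌊t / Δ⌋₊) :
    min t ((l : ℝ≥0) * Δ) = (l : ℝ≥0) * Δ := by
  refine min_eq_right (le_trans ?_ (floor_div_mul_le hΔ t))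
  gcongr

/-- Stopping all grid times at `t` puts the full steps and the last, shortened one in the same form,
which is also that of `StepProcess.integral`. -/
lemma step_eq_sum (hΔ : 0 < Δ) (t : ℝ≥0) (ω : Ω) :
    step (trunc r f) (fun j => trunc r (g j)) (truncLop r g)
        ((t : ℝ) - ((⌊t / Δ⌋₊ : ℝ≥0) * Δ : ℝ≥0)) (milstein f g r Δ x₀ B ⌊t / Δ⌋₊ ω)
        (B t ω - B ((⌊t / Δ⌋₊ : ℝ≥0) * Δ) ω)
      = x₀
        + ∑ l ∈ Finset.range (⌊t / Δ⌋₊ + 1), ((min t (((l + 1 : ℕ) : ℝ≥0) * Δ) : ℝ≥0)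
            - (min t ((l : ℝ≥0) * Δ) : ℝ≥0) : ℝ) • trunc r f (milstein f g r Δ x₀ B l ω)
        + ∑ j, ∑ l ∈ Finset.range (⌊t / Δ⌋₊ + 1), (B (min t (((l + 1 : ℕ) : ℝ≥0) * Δ)) ω j
            - B (min t ((l : ℝ≥0) * Δ)) ω j) • trunc r (g j) (milstein f g r Δ x₀ B l ω)
        + ∑ l ∈ Finset.range (⌊t / Δ⌋₊ + 1), (1 / 2 : ℝ) • ∑ i, ∑ j,
            covDefect i j ((min t (((l + 1 : ℕ) : ℝ≥0) * Δ) : ℝ≥0)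
              - (min t ((l : ℝ≥0) * Δ) : ℝ≥0) : ℝ)
            (B (min t (((l + 1 : ℕ) : ℝ≥0) * Δ)) ω - B (min t ((l : ℝ≥0) * Δ)) ω) •
              truncLop r g i j (milstein f g r Δ x₀ B l ω) := by
  set k := ⌊t / Δ⌋₊ with hk
  set Y := fun l => milstein f g r Δ x₀ B l ω with hY
  set inc : ℕ → EuclideanSpace ℝ (Fin d) := fun l =>
    step (trunc r f) (fun j => trunc r (g j)) (truncLop r g)
      ((min t (((l + 1 : ℕ) : ℝ≥0) * Δ) : ℝ≥0) - (min t ((l : ℝ≥0) * Δ) : ℝ≥0) : ℝ) (Y l)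
      (B (min t (((l + 1 : ℕ) : ℝ≥0) * Δ)) ω - B (min t ((l : ℝ≥0) * Δ)) ω) - Y l with hinc
  have h1 : step (trunc r f) (fun j => trunc r (g j)) (truncLop r g)
        ((t : ℝ) - ((k : ℝ≥0) * Δ : ℝ≥0)) (Y k) (B t ω - B ((k : ℝ≥0) * Δ) ω)
      = x₀ + ∑ l ∈ Finset.range (k + 1), inc l := by
    have h2 : ∀ l ∈ Finset.range k, inc l = step (trunc r f) (fun j => trunc r (g j))
        (truncLop r g) Δ (Y l) (B (((l + 1 : ℕ) : ℝ≥0) * Δ) ω - B ((l : ℝ≥0) * Δ) ω) - Y l := by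
      intro l hl
      have hl' := Finset.mem_range.1 hl
      simp only [hinc]
      rw [min_natCast_mul hΔ t (l := l + 1) hl', min_natCast_mul hΔ t (l := l) hl'.le,
        succ_mul_sub]
    have h3 : inc k = step (trunc r f) (fun j => trunc r (g j)) (truncLop r g)
        ((t : ℝ) - ((k : ℝ≥0) * Δ : ℝ≥0)) (Y k) (B t ω - B ((k : ℝ≥0) * Δ) ω) - Y k := by
      simp only [hinc]
      rw [min_natCast_mul hΔ t (l := k) le_rfl, min_eq_left (lt_floor_div_succ_mul hΔ t).le]
    rw [Finset.sum_range_succ, Finset.sum_congr rfl h2, ← add_assoc, h3]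
    have := milstein_eq_sum (f := f) (g := g) (r := r) (Δ := Δ) (x₀ := x₀) (B := B) k ω
    rw [← this]
    simp only [hY]
    abel
  refine h1.trans ?_
  have h4 : ∀ l, inc l = ((min t (((l + 1 : ℕ) : ℝ≥0) * Δ) : ℝ≥0)
            - (min t ((l : ℝ≥0) * Δ) : ℝ≥0) : ℝ) • trunc r f (Y l)
      + ∑ j, (B (min t (((l + 1 : ℕ) : ℝ≥0) * Δ)) ω j
            - B (min t ((l : ℝ≥0) * Δ)) ω j) • trunc r (g j) (Y l)
      + (1 / 2 : ℝ) • ∑ i, ∑ j, covDefect i j ((min t (((l + 1 : ℕ) : ℝ≥0) * Δ) : ℝ≥0)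
              - (min t ((l : ℝ≥0) * Δ) : ℝ≥0) : ℝ)
            (B (min t (((l + 1 : ℕ) : ℝ≥0) * Δ)) ω - B (min t ((l : ℝ≥0) * Δ)) ω) •
              truncLop r g i j (Y l) := by
    intro l
    simp only [hinc, step, covDefect, Pi.sub_apply]
    abel
  simp_rw [h4, Finset.sum_add_distrib]
  rw [Finset.sum_comm (s := Finset.range (k + 1)) (t := (Finset.univ : Finset (Fin m)))]
  abel

/-- The drift part of the continuous-time interpolation. -/
lemma integral_trunc_milsteinStep (hΔ : 0 < Δ) (t : ℝ≥0) (ω : Ω) :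
    ∫ s in (0 : ℝ)..(t : ℝ), trunc r f (milsteinStep f g r Δ x₀ B s.toNNReal ω)
      = ∑ l ∈ Finset.range (⌊t / Δ⌋₊ + 1), ((min t (((l + 1 : ℕ) : ℝ≥0) * Δ) : ℝ≥0)
            - (min t ((l : ℝ≥0) * Δ) : ℝ≥0) : ℝ) • trunc r f (milstein f g r Δ x₀ B l ω) := by
  set a : ℕ → ℝ := fun l => ((min t ((l : ℝ≥0) * Δ) : ℝ≥0) : ℝ) with ha
  have hmono : ∀ l, a l ≤ a (l + 1) := fun l =>
    NNReal.coe_le_coe.2 (min_le_min_left t (natCast_mul_le_succ Δ l))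
  have heq : ∀ l, Set.EqOn (fun s : ℝ => trunc r f (milsteinStep f g r Δ x₀ B s.toNNReal ω))
      (fun _ => trunc r f (milstein f g r Δ x₀ B l ω)) (Set.Ioo (a l) (a (l + 1))) := by
    intro l s hs
    obtain ⟨h1, h2⟩ := hs
    have h0 : 0 ≤ s := le_trans (NNReal.coe_nonneg _) h1.le
    lift s to ℝ≥0 using h0
    have h1' : min t ((l : ℝ≥0) * Δ) < s := NNReal.coe_lt_coe.1 h1
    have h2' : s < min t (((l + 1 : ℕ) : ℝ≥0) * Δ) := NNReal.coe_lt_coe.1 h2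
    obtain ⟨h3, h4⟩ := lt_min_iff.1 h2'
    have h5 : (l : ℝ≥0) * Δ < s := by
      rcases min_lt_iff.1 h1' with h | h
      · exact absurd h (not_lt.2 h3.le)
      · exact h
    have hfl : ⌊s / Δ⌋₊ = l := by
      rw [Nat.floor_eq_iff zero_le]
      refine ⟨(le_div_iff₀ hΔ).2 h5.le, (div_lt_iff₀ hΔ).2 ?_⟩
      exact_mod_cast h4
    simp only [milsteinStep, Real.toNNReal_coe, hfl]
  have hint : ∀ l < ⌊t / Δ⌋₊ + 1, IntervalIntegrable
      (fun s : ℝ => trunc r f (milsteinStep f g r Δ x₀ B s.toNNReal ω)) volume (a l) (a (l + 1)) := by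
    intro l _
    refine (intervalIntegrable_const (c := trunc r f (milstein f g r Δ x₀ B l ω))).congr_uIoo ?_
    rw [Set.uIoo_of_le (hmono l)]
    exact (heq l).symm
  have h0 : a 0 = 0 := by simp [ha]
  have hN : a (⌊t / Δ⌋₊ + 1) = t := by
    simp only [ha]
    rw [min_eq_left (lt_floor_div_succ_mul hΔ t).le]
  rw [← h0, ← hN, ← intervalIntegral.sum_integral_adjacent_intervals hint]
  refine Finset.sum_congr rfl fun l _ => ?_
  rw [intervalIntegral.integral_congr_Ioo_of_le (hmono l) (heq l), intervalIntegral.integral_const]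

end Explicit

/-! ### Identification of the continuous-time interpolation -/

section Identification

lemma ae_eq_of_tendsto_eLpNorm {α E : Type*} {mα : MeasurableSpace α} {μ : Measure α}
    [NormedAddCommGroup E] {f g : α → E} {u : ℕ → α → E} (hf : AEStronglyMeasurable f μ)
    (hg : AEStronglyMeasurable g μ) (hu : ∀ n, AEStronglyMeasurable (u n) μ)
    (huf : Tendsto (fun n => eLpNorm (fun x => u n x - f x) 2 μ) atTop (𝓝 0))
    (hug : Tendsto (fun n => eLpNorm (fun x => u n x - g x) 2 μ) atTop (𝓝 0)) : f =ᵐ[μ] g := by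
  simp_rw [eLpNorm_two_sub_comm (u _) f] at huf
  have h := tendsto_eLpNorm_sub_trans (fun _ => hf) hu (fun _ => hg) huf hug
  have h0 : eLpNorm (f - g) 2 μ = 0 := tendsto_nhds_unique tendsto_const_nhds h
  rw [eLpNorm_eq_zero_iff (hf.sub hg) (by norm_num)] at h0
  filter_upwards [h0] with x hx
  exact sub_eq_zero.1 hx

lemma tendsto_ofReal_sqrt_div_mul (c : ℝ) {C : ℝ≥0∞} (hC : C ≠ ∞) :
    Tendsto (fun n : ℕ => ENNReal.ofReal √(c / ((n : ℝ) + 1)) * C) atTop (𝓝 0) := by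
  have h1 : Tendsto (fun n : ℕ => c / ((n : ℝ) + 1)) atTop (𝓝 0) := by
    simpa [div_eq_mul_inv] using tendsto_one_div_add_atTop_nhds_zero_nat.const_mul c
  have h2 := ENNReal.tendsto_ofReal ((Real.continuous_sqrt.tendsto 0).comp h1)
  rw [Real.sqrt_zero, ENNReal.ofReal_zero] at h2
  have h3 := ENNReal.Tendsto.mul_const (b := C) h2 (Or.inr hC)
  rwa [zero_mul] at h3

variable {Ω : Type*} {mΩ : MeasurableSpace Ω} {P : Measure Ω} {ℱ : Filtration ℝ≥0 mΩ} {m d : ℕ}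
  {B : ℝ≥0 → Ω → (Fin m → ℝ)}

lemma measurable_comp_floor {E : Type*} [MeasurableSpace E] {u : ℕ → Ω → E}
    (hu : ∀ k, Measurable (u k)) (δ : ℝ≥0) :
    Measurable fun z : Ω × ℝ => u ⌊z.2.toNNReal / δ⌋₊ z.1 := by
  have h1 : Measurable fun y : Ω × ℕ => u y.2 y.1 := measurable_from_prod_countable_left hu
  have h2 : Measurable fun z : Ω × ℝ => (z.1, ⌊z.2.toNNReal / δ⌋₊) :=
    measurable_fst.prodMk (Nat.measurable_floor.comp
      ((measurable_real_toNNReal.comp measurable_snd).div_const _))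
  exact h1.comp h2

/-- The fine mesh. -/
def mesh (Δ : ℝ≥0) (n : ℕ) : ℝ≥0 := Δ / ((n + 1 : ℕ) : ℝ≥0)

lemma mesh_pos {Δ : ℝ≥0} (hΔ : 0 < Δ) (n : ℕ) : 0 < mesh Δ n := by
  unfold mesh; positivity

lemma mul_mesh (Δ : ℝ≥0) (l n : ℕ) :
    ((l * (n + 1) : ℕ) : ℝ≥0) * mesh Δ n = (l : ℝ≥0) * Δ := by
  unfold mesh
  have : ((n + 1 : ℕ) : ℝ≥0) ≠ 0 := by positivity
  rw [Nat.cast_mul, mul_assoc, mul_div_cancel₀ _ this]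

/-- Each step is cut into `n + 1` cells, so integer division by `n + 1` sends a fine index to the
index of its step. -/
lemma floor_div_mesh (Δ : ℝ≥0) (n : ℕ) (s : ℝ≥0) : ⌊s / mesh Δ n⌋₊ / (n + 1) = ⌊s / Δ⌋₊ := by
  rw [← Nat.floor_div_natCast]
  congr 1
  unfold mesh
  have : ((n + 1 : ℕ) : ℝ≥0) ≠ 0 := by positivity
  rw [div_div, div_mul_cancel₀ _ this]

lemma coe_mesh (Δ : ℝ≥0) (n : ℕ) : (mesh Δ n : ℝ) = Δ / ((n : ℝ) + 1) := by
  unfold mesh; push_cast; ring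

/-- This is the error of freezing the path at the left end of its fine cell. At each time the
increment is independent of `η`, so the squared norm is at most the mesh size times `H²`;
integration over `(0, t]` gives the bound. -/
lemma eLpNorm_increment_le [IsProbabilityMeasure P] (hB : IsBrownianMotion ℱ P B) (j : Fin m)
    (t : ℝ≥0) {Δ : ℝ≥0} (hΔ : 0 < Δ) (n : ℕ) {η : ℕ → Ω → EuclideanSpace ℝ (Fin d)}
    (hη : ∀ l : ℕ, Measurable[ℱ ((l : ℝ≥0) * Δ)] (η l)) {H : ℝ≥0∞}
    (hH : ∀ l ≤ ⌊t / Δ⌋₊, eLpNorm (η l) 2 P ≤ H) :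
    AEStronglyMeasurable (fun z : Ω × ℝ => (B z.2.toNNReal z.1 j
        - B ((⌊z.2.toNNReal / mesh Δ n⌋₊ : ℝ≥0) * mesh Δ n) z.1 j) • η ⌊z.2.toNNReal / Δ⌋₊ z.1)
      (P.prod (timeMeasure t)) ∧
    eLpNorm (fun z : Ω × ℝ => (B z.2.toNNReal z.1 j
        - B ((⌊z.2.toNNReal / mesh Δ n⌋₊ : ℝ≥0) * mesh Δ n) z.1 j) • η ⌊z.2.toNNReal / Δ⌋₊ z.1) 2
      (P.prod (timeMeasure t)) ≤ ENNReal.ofReal √(t * Δ / ((n : ℝ) + 1)) * H := by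
  have hδ := mesh_pos hΔ n
  have hm : AEStronglyMeasurable (fun z : Ω × ℝ => (B z.2.toNNReal z.1 j
        - B ((⌊z.2.toNNReal / mesh Δ n⌋₊ : ℝ≥0) * mesh Δ n) z.1 j) • η ⌊z.2.toNNReal / Δ⌋₊ z.1)
      (P.prod (timeMeasure t)) := by
    refine ((hB.aestronglyMeasurable_uncurry j t).sub ?_).smul ?_
    · exact (measurable_comp_floor (u := fun k ω => B ((k : ℝ≥0) * mesh Δ n) ω j)
        (fun k => (measurable_pi_apply j).comp (hB.measurable _)) (mesh Δ n)).aestronglyMeasurable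
    · exact (measurable_comp_floor (fun l => (hη l).mono (ℱ.le _) le_rfl) Δ).aestronglyMeasurable
  refine ⟨hm, ?_⟩
  refine (ENNReal.pow_right_strictMono two_ne_zero).le_iff_le.1 ?_
  rw [eLpNorm_two_sq, lintegral_prod_symm _ (hm.enorm.pow_const 2)]
  have hs : ∀ᵐ (s : ℝ) ∂(timeMeasure t), ∫⁻ ω, ‖(B s.toNNReal ω j
        - B ((⌊s.toNNReal / mesh Δ n⌋₊ : ℝ≥0) * mesh Δ n) ω j) • η ⌊s.toNNReal / Δ⌋₊ ω‖ₑ ^ 2 ∂P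
      ≤ (ENNReal.ofReal √(mesh Δ n : ℝ) * H) ^ 2 := by
    filter_upwards [ae_mem_grid_interior t hδ] with s hs
    obtain ⟨h0, hst, hlo, hhi⟩ := hs
    have hst' : s.toNNReal ≤ t := Real.toNNReal_le_iff_le_coe.2 hst
    have hle : (⌊s.toNNReal / Δ⌋₊ : ℝ≥0) * Δ ≤ (⌊s.toNNReal / mesh Δ n⌋₊ : ℝ≥0) * mesh Δ n := by
      rw [← floor_div_mesh Δ n, ← mul_mesh]
      gcongr
      exact Nat.div_mul_le_self _ _
    have h1 := (hB.isIntegrator j).eLpNorm_sub_smul hlo.le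
      ((hη ⌊s.toNNReal / Δ⌋₊).mono (ℱ.mono hle) le_rfl)
    rw [← eLpNorm_two_sq, h1]
    gcongr
    · have h2 : (s.toNNReal : ℝ) < ((⌊s.toNNReal / mesh Δ n⌋₊ + 1 : ℕ) : ℝ≥0) * mesh Δ n := by
        exact_mod_cast hhi
      push_cast at h2 ⊢
      linarith
    · exact hH _ (Nat.floor_mono (by gcongr))
  refine (lintegral_mono_ae hs).trans (le_of_eq ?_)
  rw [lintegral_const, Measure.restrict_apply MeasurableSet.univ, Set.univ_inter, Real.volume_Ioc,
    sub_zero, mul_pow, mul_pow, ← ENNReal.ofReal_pow (Real.sqrt_nonneg _),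
    ← ENNReal.ofReal_pow (Real.sqrt_nonneg _), Real.sq_sqrt (NNReal.coe_nonneg _),
    Real.sq_sqrt (by positivity), mul_comm, ← mul_assoc, ← ENNReal.ofReal_mul t.coe_nonneg,
    coe_mesh, mul_div_assoc]

variable {f : EuclideanSpace ℝ (Fin d) → EuclideanSpace ℝ (Fin d)}
  {g : Fin m → EuclideanSpace ℝ (Fin d) → EuclideanSpace ℝ (Fin d)}
  {r : ℝ} {Δ : ℝ≥0} {x₀ : EuclideanSpace ℝ (Fin d)} {K : ℝ}

lemma memLp_comp_milstein [IsProbabilityMeasure P] (hB : IsBrownianMotion ℱ P B)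
    (hL : LinearGrowth (trunc r f) (fun j => trunc r (g j)) (truncLop r g) K) (hK : 0 ≤ K)
    (hΔ1 : Δ ≤ 1) {H : EuclideanSpace ℝ (Fin d) → EuclideanSpace ℝ (Fin d)} (hH : Measurable H)
    (hHK : ∀ y, ‖H y‖ ≤ K * ‖y‖) (l : ℕ) :
    MemLp (fun ω => H (milstein f g r Δ x₀ B l ω)) 2 P :=
  (memLp_milstein hB hL hK hΔ1 l).of_le_mul
    (hH.comp ((measurable_milstein hB hL l).mono (ℱ.le _) le_rfl)).aestronglyMeasurable
    (ae_of_all _ fun _ => hHK _)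

/-- The integrand of the first stochastic integral, as a step process. -/
def diffusionStep [IsProbabilityMeasure P] (hB : IsBrownianMotion ℱ P B)
    (hL : LinearGrowth (trunc r f) (fun j => trunc r (g j)) (truncLop r g) K) (hK : 0 ≤ K)
    (hΔ1 : Δ ≤ 1) (x₀ : EuclideanSpace ℝ (Fin d)) (t : ℝ≥0) (j : Fin m) : StepProcess ℱ P d where
  n := ⌊t / Δ⌋₊ + 1
  time q := q * Δ
  mono := monotone_nat_of_le_succ fun q => natCast_mul_le_succ Δ q
  coeff l ω := trunc r (g j) (milstein f g r Δ x₀ B l ω)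
  measurable_coeff l := (hL.measurable_diffusion j).comp (measurable_milstein hB hL l)
  memLp_coeff l :=
    memLp_comp_milstein hB hL hK hΔ1 (hL.measurable_diffusion j) (hL.norm_diffusion_le j) l

/-- The integrand is almost everywhere a step process, so a constant approximating sequence
suffices. -/
lemma itoIntegral_diffusion [IsProbabilityMeasure P] (hB : IsBrownianMotion ℱ P B)
    (hL : LinearGrowth (trunc r f) (fun j => trunc r (g j)) (truncLop r g) K) (hK : 0 ≤ K)
    (hΔ : 0 < Δ) (hΔ1 : Δ ≤ 1) (t : ℝ≥0) (j : Fin m) :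
    (fun ω => ∑ l ∈ Finset.range (⌊t / Δ⌋₊ + 1), (B (min t (((l + 1 : ℕ) : ℝ≥0) * Δ)) ω j
            - B (min t ((l : ℝ≥0) * Δ)) ω j) • trunc r (g j) (milstein f g r Δ x₀ B l ω))
      =ᵐ[P] itoIntegral ℱ P (fun s ω' => B s ω' j)
        (fun s ω' => trunc r (g j) (milsteinStep f g r Δ x₀ B s ω')) t := by
  set φ := diffusionStep hB hL hK hΔ1 x₀ t j with hφ
  have hW := hB.isIntegrator j
  have heq : φ.eval =ᵐ[P.prod (timeMeasure t)]
      fun z => trunc r (g j) (milsteinStep f g r Δ x₀ B z.2.toNNReal z.1) :=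
    φ.eval_grid t hΔ (fun _ => rfl) (lt_floor_div_succ_mul hΔ t)
  have hX := (φ.memLp_eval t).ae_eq heq
  have h0 : eLpNorm (fun z => φ.eval z
      - trunc r (g j) (milsteinStep f g r Δ x₀ B z.2.toNNReal z.1)) 2 (P.prod (timeMeasure t))
      = 0 := by
    refine (eLpNorm_eq_zero_iff (f := fun z => φ.eval z
      - trunc r (g j) (milsteinStep f g r Δ x₀ B z.2.toNNReal z.1))
      ((φ.memLp_eval t).1.sub hX.1) (by norm_num)).2 ?_
    filter_upwards [heq] with z hz
    rw [hz]; simp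
  obtain ⟨hI, hlim⟩ := hW.tendsto_itoIntegral t (X := fun s ω' =>
    trunc r (g j) (milsteinStep f g r Δ x₀ B s ω')) hX (fun _ => φ) (by
      simp only [h0]; exact tendsto_const_nhds)
  refine ae_eq_of_tendsto_eLpNorm (u := fun _ => φ.integral (fun s ω' => B s ω' j) t)
    (φ.memLp_integral hW t).1 hI.1 (fun _ => (φ.memLp_integral hW t).1) ?_ hlim
  have : ∀ ω, φ.integral (fun s ω' => B s ω' j) t ω
      - ∑ l ∈ Finset.range (⌊t / Δ⌋₊ + 1), (B (min t (((l + 1 : ℕ) : ℝ≥0) * Δ)) ω j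
        - B (min t ((l : ℝ≥0) * Δ)) ω j) • trunc r (g j) (milstein f g r Δ x₀ B l ω) = 0 :=
    fun ω => sub_self _
  simp_rw [this]
  simp

/-- Riemann sum approximation of the integrand of the second stochastic integral. -/
def secondStep [IsProbabilityMeasure P] (hB : IsBrownianMotion ℱ P B)
    (hL : LinearGrowth (trunc r f) (fun j => trunc r (g j)) (truncLop r g) K) (hK : 0 ≤ K)
    (hΔ1 : Δ ≤ 1) (x₀ : EuclideanSpace ℝ (Fin d)) (t : ℝ≥0) (n : ℕ) (i : Fin m) :
    StepProcess ℱ P d where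
  n := (⌊t / Δ⌋₊ + 1) * (n + 1)
  time q := q * mesh Δ n
  mono := monotone_nat_of_le_succ fun q => natCast_mul_le_succ _ q
  -- Stopping at `t` changes nothing for the cells that matter on `(0, t]`, and makes `sum_grid`
  -- applicable to the stopped path.
  coeff q ω := ∑ j, (B (min t ((q : ℝ≥0) * mesh Δ n)) ω j
    - B (min t (((q / (n + 1) * (n + 1) : ℕ) : ℝ≥0) * mesh Δ n)) ω j) •
      truncLop r g i j (milstein f g r Δ x₀ B (q / (n + 1)) ω)
  measurable_coeff q := by
    have hle : ((q / (n + 1) * (n + 1) : ℕ) : ℝ≥0) * mesh Δ n ≤ (q : ℝ≥0) * mesh Δ n := by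
      gcongr
      exact Nat.div_mul_le_self _ _
    have hY := (measurable_milstein (Δ := Δ) (x₀ := x₀) hB hL (q / (n + 1)))
    rw [← mul_mesh Δ _ n] at hY
    refine Finset.measurable_sum _ fun j _ => ?_
    exact ((hB.isIntegrator j).measurable_sub_le ((min_le_right _ _).trans hle)
      (min_le_right _ _)).smul ((hL.measurable_second i j).comp (hY.mono (ℱ.mono hle) le_rfl))
  memLp_coeff q := by
    have hle : ((q / (n + 1) * (n + 1) : ℕ) : ℝ≥0) * mesh Δ n ≤ (q : ℝ≥0) * mesh Δ n := by
      gcongr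
      exact Nat.div_mul_le_self _ _
    have hY := (measurable_milstein (Δ := Δ) (x₀ := x₀) hB hL (q / (n + 1)))
    rw [← mul_mesh Δ _ n] at hY
    refine memLp_finsetSum _ fun j _ => ?_
    have hη := (hL.measurable_second i j).comp hY
    exact ⟨(((hB.isIntegrator j).measurable_sub _ _).smul
      (hη.mono (ℱ.le _) le_rfl)).aestronglyMeasurable,
      ((hB.isIntegrator j).eLpNorm_min_sub_smul_le t hle hη).trans_lt
        (ENNReal.mul_lt_top ENNReal.ofReal_lt_top (memLp_comp_milstein hB hL hK hΔ1
          (hL.measurable_second i j) (hL.norm_second_le i j) _).2)⟩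

lemma tendsto_integral_secondStep [IsProbabilityMeasure P] (hB : IsBrownianMotion ℱ P B)
    (hL : LinearGrowth (trunc r f) (fun j => trunc r (g j)) (truncLop r g) K) (hK : 0 ≤ K)
    (hΔ : 0 < Δ) (hΔ1 : Δ ≤ 1) (t : ℝ≥0) (i : Fin m) :
    MemLp (itoIntegral ℱ P (fun s ω' => B s ω' i)
        (fun s ω' => ∑ j : Fin m, stepIncrement Δ B j s ω' •
          truncLop r g i j (milsteinStep f g r Δ x₀ B s ω')) t) 2 P ∧
    Tendsto (fun n => eLpNorm (fun ω => (secondStep hB hL hK hΔ1 x₀ t n i).integral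
        (fun s ω' => B s ω' i) t ω - itoIntegral ℱ P (fun s ω' => B s ω' i)
        (fun s ω' => ∑ j : Fin m, stepIncrement Δ B j s ω' •
          truncLop r g i j (milsteinStep f g r Δ x₀ B s ω')) t ω) 2 P) atTop (𝓝 0) := by
  set φ := fun n => secondStep hB hL hK hΔ1 x₀ t n i with hφ
  set X : ℝ≥0 → Ω → EuclideanSpace ℝ (Fin d) := fun s ω' => ∑ j : Fin m,
    stepIncrement Δ B j s ω' • truncLop r g i j (milsteinStep f g r Δ x₀ B s ω') with hX
  set η : Fin m → ℕ → Ω → EuclideanSpace ℝ (Fin d) :=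
    fun j l ω => truncLop r g i j (milstein f g r Δ x₀ B l ω) with hη
  have hηm : ∀ j (l : ℕ), Measurable[ℱ ((l : ℝ≥0) * Δ)] (η j l) := fun j l =>
    (hL.measurable_second i j).comp (measurable_milstein hB hL l)
  have hη2 : ∀ j l, MemLp (η j l) 2 P := fun j l =>
    memLp_comp_milstein hB hL hK hΔ1 (hL.measurable_second i j) (hL.norm_second_le i j) l
  set H : Fin m → ℝ≥0∞ := fun j => ∑ l ∈ Finset.range (⌊t / Δ⌋₊ + 1), eLpNorm (η j l) 2 P with hH
  have hHtop : ∀ j, H j ≠ ∞ := fun j => by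
    rw [hH]; exact ENNReal.sum_ne_top.2 fun l _ => (hη2 j l).2.ne
  have hHle : ∀ j, ∀ l ≤ ⌊t / Δ⌋₊, eLpNorm (η j l) 2 P ≤ H j := fun j l hl =>
    Finset.single_le_sum (f := fun l => eLpNorm (η j l) 2 P) (fun _ _ => zero_le)
      (Finset.mem_range.2 (Nat.lt_succ_of_le hl))
  set V : ℕ → Fin m → Ω × ℝ → EuclideanSpace ℝ (Fin d) := fun n j z => (B z.2.toNNReal z.1 j
        - B ((⌊z.2.toNNReal / mesh Δ n⌋₊ : ℝ≥0) * mesh Δ n) z.1 j) •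
          η j ⌊z.2.toNNReal / Δ⌋₊ z.1 with hV
  have hVb := fun n j => eLpNorm_increment_le hB j t hΔ n (hηm j) (hHle j)
  have hdiff : ∀ n, (fun z : Ω × ℝ => (φ n).eval z - X z.2.toNNReal z.1)
      =ᵐ[P.prod (timeMeasure t)] fun z => -∑ j, V n j z := by
    intro n
    have hδ := mesh_pos hΔ n
    have h1 := (φ n).eval_grid t hδ (fun _ => rfl) (by
      have := lt_floor_div_succ_mul hΔ t
      rw [← mul_mesh Δ _ n] at this
      exact this)
    have h2 := Measure.quasiMeasurePreserving_snd (μ := P) (ν := timeMeasure t)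
    filter_upwards [h1, h2.ae (ae_mem_grid_interior t hδ)] with z hz hz2
    obtain ⟨h0, hst, hlo, hhi⟩ := hz2
    have hst' : z.2.toNNReal ≤ t := Real.toNNReal_le_iff_le_coe.2 hst
    have hlo' : (⌊z.2.toNNReal / Δ⌋₊ : ℝ≥0) * Δ ≤ t := (floor_div_mul_le hΔ _).trans hst'
    rw [hz, ← sub_eq_zero, sub_neg_eq_add]
    change ∑ j, (B (min t ((⌊z.2.toNNReal / mesh Δ n⌋₊ : ℝ≥0) * mesh Δ n)) z.1 j
      - B (min t (((⌊z.2.toNNReal / mesh Δ n⌋₊ / (n + 1) * (n + 1) : ℕ) : ℝ≥0) * mesh Δ n)) z.1 j) •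
      truncLop r g i j (milstein f g r Δ x₀ B (⌊z.2.toNNReal / mesh Δ n⌋₊ / (n + 1)) z.1)
      - ∑ j : Fin m, (B z.2.toNNReal z.1 j - B ((⌊z.2.toNNReal / Δ⌋₊ : ℝ≥0) * Δ) z.1 j) •
        truncLop r g i j (milstein f g r Δ x₀ B ⌊z.2.toNNReal / Δ⌋₊ z.1) + ∑ j, V n j z = 0
    rw [floor_div_mesh, mul_mesh, min_eq_right hlo', min_eq_right (hlo.le.trans hst'),
      ← Finset.sum_sub_distrib, ← Finset.sum_add_distrib]
    refine Finset.sum_eq_zero fun j _ => ?_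
    simp only [hV, hη]
    rw [← sub_smul, ← add_smul]
    convert zero_smul ℝ _ using 2
    ring
  have hdm : ∀ n, AEStronglyMeasurable (fun z => -∑ j, V n j z) (P.prod (timeMeasure t)) :=
    fun n => by
      have := Finset.aestronglyMeasurable_sum (f := V n) Finset.univ fun j _ => (hVb n j).1
      refine (this.neg).congr (ae_of_all _ fun z => ?_)
      simp
  have hdb : ∀ n, eLpNorm (fun z : Ω × ℝ => (φ n).eval z - X z.2.toNNReal z.1) 2
      (P.prod (timeMeasure t)) ≤ ENNReal.ofReal √(t * Δ / ((n : ℝ) + 1)) * ∑ j, H j := by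
    intro n
    rw [eLpNorm_congr_ae (hdiff n)]
    have h1 : (fun z => -∑ j, V n j z) = -∑ j, V n j := by funext z; simp
    rw [h1, eLpNorm_neg, Finset.mul_sum]
    exact (eLpNorm_sum_le (fun j _ => (hVb n j).1) (by norm_num)).trans
      (Finset.sum_le_sum fun j _ => (hVb n j).2)
  have hHs : ∑ j, H j ≠ ∞ := ENNReal.sum_ne_top.2 fun j _ => hHtop j
  -- Square integrability of the integrand follows from that of one approximation and of its error.
  have hXm : MemLp (fun z : Ω × ℝ => X z.2.toNNReal z.1) 2 (P.prod (timeMeasure t)) := by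
    have h1 : MemLp (fun z : Ω × ℝ => (φ 0).eval z - X z.2.toNNReal z.1) 2
        (P.prod (timeMeasure t)) :=
      ⟨(hdm 0).congr (hdiff 0).symm, (hdb 0).trans_lt
        (ENNReal.mul_lt_top ENNReal.ofReal_lt_top hHs.lt_top)⟩
    have h2 := ((φ 0).memLp_eval t).sub h1
    refine h2.ae_eq (ae_of_all _ fun z => ?_)
    simp
  exact (hB.isIntegrator i).tendsto_itoIntegral t hXm φ
    (tendsto_of_tendsto_of_tendsto_of_le_of_le tendsto_const_nhds
      (tendsto_ofReal_sqrt_div_mul _ hHs) (fun _ => zero_le) hdb)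

end Identification

/-! ### The interpolation as a single shortened Milstein step. -/

section Interpolation

variable {Ω : Type*} {mΩ : MeasurableSpace Ω} {P : Measure Ω} {ℱ : Filtration ℝ≥0 mΩ} {m d : ℕ}
  {B : ℝ≥0 → Ω → (Fin m → ℝ)}
  {f : EuclideanSpace ℝ (Fin d) → EuclideanSpace ℝ (Fin d)}
  {g : Fin m → EuclideanSpace ℝ (Fin d) → EuclideanSpace ℝ (Fin d)}
  {r : ℝ} {Δ : ℝ≥0} {x₀ : EuclideanSpace ℝ (Fin d)} {K : ℝ}

/-- The covariation defects accumulated over the fine mesh. -/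
def meshDefect (g : Fin m → EuclideanSpace ℝ (Fin d) → EuclideanSpace ℝ (Fin d)) (r : ℝ)
    (Δ : ℝ≥0) (B : ℝ≥0 → Ω → (Fin m → ℝ)) (Y : ℕ → Ω → EuclideanSpace ℝ (Fin d))
    (t : ℝ≥0) (n : ℕ) (i j : Fin m) (ω : Ω) : EuclideanSpace ℝ (Fin d) :=
  ∑ q ∈ Finset.range ((⌊t / Δ⌋₊ + 1) * (n + 1)),
    covDefect i j ((min t (((q + 1 : ℕ) : ℝ≥0) * mesh Δ n) : ℝ≥0)
        - (min t ((q : ℝ≥0) * mesh Δ n) : ℝ≥0) : ℝ)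
      (B (min t (((q + 1 : ℕ) : ℝ≥0) * mesh Δ n)) ω - B (min t ((q : ℝ≥0) * mesh Δ n)) ω) •
    truncLop r g i j (Y (q / (n + 1)) ω)

/-- There are `(k + 1)(n + 1)` orthogonal terms, each of squared norm at most `(Δ / (n + 1))²` up to
a constant, which gives order `(k + 1) Δ² / (n + 1)` in total. -/
lemma meshDefect_bound [IsProbabilityMeasure P] (hB : IsBrownianMotion ℱ P B)
    (hL : LinearGrowth (trunc r f) (fun j => trunc r (g j)) (truncLop r g) K) (hK : 0 ≤ K)
    (hΔ : 0 < Δ) (hΔ1 : Δ ≤ 1) (t : ℝ≥0) (i j : Fin m) :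
    ∃ (c : ℝ) (M : ℝ≥0∞), M ≠ ∞ ∧ ∀ n,
      AEStronglyMeasurable (meshDefect g r Δ B (milstein f g r Δ x₀ B) t n i j) P ∧
      eLpNorm (meshDefect g r Δ B (milstein f g r Δ x₀ B) t n i j) 2 P
        ≤ ENNReal.ofReal √(c / ((n : ℝ) + 1)) * M := by
  set k := ⌊t / Δ⌋₊ with hk
  set Y := milstein f g r Δ x₀ B with hY
  set η : ℕ → Ω → EuclideanSpace ℝ (Fin d) := fun l ω => truncLop r g i j (Y l ω) with hη
  have hη2 : ∀ l, MemLp (η l) 2 P := fun l =>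
    memLp_comp_milstein hB hL hK hΔ1 (hL.measurable_second i j) (hL.norm_second_le i j) l
  set H : ℝ≥0∞ := ∑ l ∈ Finset.range (k + 1), eLpNorm (η l) 2 P with hH
  have hHtop : H ≠ ∞ := ENNReal.sum_ne_top.2 fun l _ => (hη2 l).2.ne
  set κ := eLpNorm (covDefect i j 1) 2 (stdGauss m) with hκ
  refine ⟨(k + 1) * (Δ : ℝ) ^ 2, κ * H, ENNReal.mul_ne_top (memLp_covDefect i j).2.ne hHtop, ?_⟩
  intro n
  set σ : ℕ → ℝ≥0 := fun q => min t ((q : ℝ≥0) * mesh Δ n) with hσ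
  have hσm : Monotone σ := monotone_nat_of_le_succ fun q =>
    min_le_min_left t (natCast_mul_le_succ _ q)
  -- Without the cap at `k`, indices past the range would give values determined only after `t`,
  -- hence not measurable at the stopped time `σ q ≤ t`.
  set ζ : ℕ → Ω → EuclideanSpace ℝ (Fin d) := fun q => η (min (q / (n + 1)) k) with hζ
  have hζm : ∀ q, Measurable[ℱ (σ q)] (ζ q) := by
    intro q
    refine Measurable.mono ((hL.measurable_second i j).comp
      (measurable_milstein hB hL (min (q / (n + 1)) k))) (ℱ.mono ?_) le_rfl
    refine le_min ?_ ?_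
    · refine le_trans ?_ (floor_div_mul_le hΔ t)
      gcongr
      exact min_le_right _ _
    · rw [← mul_mesh Δ _ n]
      gcongr
      exact (Nat.mul_le_mul_right _ (min_le_left _ _)).trans (Nat.div_mul_le_self _ _)
  have heq : meshDefect g r Δ B Y t n i j = fun ω => ∑ q ∈ Finset.range ((k + 1) * (n + 1)),
      covDefect i j ((σ (q + 1) : ℝ) - σ q) (B (σ (q + 1)) ω - B (σ q) ω) • ζ q ω := by
    funext ω
    refine Finset.sum_congr rfl fun q hq => ?_
    have hq' : q / (n + 1) ≤ k := Nat.lt_succ_iff.1 <|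
      (Nat.div_lt_iff_lt_mul (Nat.succ_pos n)).2 (Finset.mem_range.1 hq)
    simp only [hζ, hη, min_eq_left hq']
    rfl
  have hmeas : Measurable (meshDefect g r Δ B Y t n i j) := by
    rw [heq]
    exact Finset.measurable_sum _ fun q _ =>
      ((measurable_covDefect i j _).comp (hB.measurable_sub _ _)).smul
        ((hζm q).mono (ℱ.le _) le_rfl)
  refine ⟨hmeas.aestronglyMeasurable, ?_⟩
  refine (ENNReal.pow_right_strictMono two_ne_zero).le_iff_le.1 ?_
  rw [heq]
  refine (hB.eLpNorm_sum_covDefect_sq hσm i j hζm (fun q => hη2 _) _).trans_le ?_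
  have hinc : ∀ q, (σ (q + 1) : ℝ) - σ q ≤ mesh Δ n := by
    intro q
    simp only [hσ, NNReal.coe_min, NNReal.coe_mul, NNReal.coe_natCast]
    have h0 := (mesh_pos hΔ n).le
    have h0' : (0 : ℝ) ≤ mesh Δ n := h0
    push_cast
    rw [add_mul, one_mul]
    rcases le_total (t : ℝ) (q * mesh Δ n) with h | h
    · rw [min_eq_left h]
      linarith [min_le_left (t : ℝ) (q * mesh Δ n + mesh Δ n)]
    · rw [min_eq_right h]
      linarith [min_le_right (t : ℝ) (q * mesh Δ n + mesh Δ n)]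
  have hterm : ∀ q ∈ Finset.range ((k + 1) * (n + 1)),
      (ENNReal.ofReal ((σ (q + 1) : ℝ) - σ q) * κ * eLpNorm (ζ q) 2 P) ^ 2
        ≤ (ENNReal.ofReal (mesh Δ n) * (κ * H)) ^ 2 := by
    intro q _
    rw [mul_assoc]
    gcongr
    · exact hinc q
    · exact Finset.single_le_sum (f := fun l => eLpNorm (η l) 2 P) (fun _ _ => zero_le)
        (Finset.mem_range.2 (Nat.lt_succ_of_le (min_le_right _ _)))
  refine (Finset.sum_le_sum hterm).trans (le_of_eq ?_)
  rw [Finset.sum_const, Finset.card_range, nsmul_eq_mul, mul_pow (ENNReal.ofReal (mesh Δ n : ℝ)),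
    mul_pow (ENNReal.ofReal (√_)), ← ENNReal.ofReal_pow (Real.sqrt_nonneg _), ← ENNReal.ofReal_pow (NNReal.coe_nonneg _),
    Real.sq_sqrt (by positivity), ← mul_assoc, ← ENNReal.ofReal_natCast,
    ← ENNReal.ofReal_mul (Nat.cast_nonneg _), coe_mesh]
  congr 2
  have : ((n : ℝ) + 1) ≠ 0 := by positivity
  push_cast
  field_simp

/-- The identity is exact for every `n`, and its right side does not depend on `n`: the Riemann sums
miss the Milstein correction only by half the defects. -/
lemma sum_integral_secondStep [IsProbabilityMeasure P] (hB : IsBrownianMotion ℱ P B)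
    (hL : LinearGrowth (trunc r f) (fun j => trunc r (g j)) (truncLop r g) K) (hK : 0 ≤ K)
    (hΔ1 : Δ ≤ 1) (hsymm : ∀ i j y, truncLop r g i j y = truncLop r g j i y)
    (t : ℝ≥0) (n : ℕ) (ω : Ω) :
    ∑ i, (secondStep hB hL hK hΔ1 x₀ t n i).integral (fun s ω' => B s ω' i) t ω
      + (1 / 2 : ℝ) • ∑ i, ∑ j, meshDefect g r Δ B (milstein f g r Δ x₀ B) t n i j ω
    = ∑ l ∈ Finset.range (⌊t / Δ⌋₊ + 1), (1 / 2 : ℝ) • ∑ i, ∑ j,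
            covDefect i j ((min t (((l + 1 : ℕ) : ℝ≥0) * Δ) : ℝ≥0)
              - (min t ((l : ℝ≥0) * Δ) : ℝ≥0) : ℝ)
            (B (min t (((l + 1 : ℕ) : ℝ≥0) * Δ)) ω - B (min t ((l : ℝ≥0) * Δ)) ω) •
              truncLop r g i j (milstein f g r Δ x₀ B l ω) := by
  have h := sum_grid (fun q => B (min t ((q : ℝ≥0) * mesh Δ n)) ω)
    (fun q => ((min t ((q : ℝ≥0) * mesh Δ n) : ℝ≥0) : ℝ))
    (lm := fun l i j => truncLop r g i j (milstein f g r Δ x₀ B l ω))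
    (fun l i j => hsymm i j _) (Nat.succ_pos n) (⌊t / Δ⌋₊ + 1)
  simp only [Nat.succ_eq_add_one, mul_mesh] at h
  rw [← h, Finset.sum_add_distrib]
  congr 1
  · rw [Finset.sum_comm]
    refine Finset.sum_congr rfl fun i _ => ?_
    simp only [StepProcess.integral, secondStep, mul_mesh]
  · have h1 : ∀ {u : ℕ → Fin m → Fin m → EuclideanSpace ℝ (Fin d)} {s : Finset ℕ},
        ∑ i, ∑ j, ∑ q ∈ s, u q i j = ∑ q ∈ s, ∑ i, ∑ j, u q i j := fun {u s} => by
      rw [Finset.sum_comm (s := s)]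
      exact Finset.sum_congr rfl fun i _ => Finset.sum_comm
    simp only [meshDefect]
    rw [h1, Finset.smul_sum]

/-- The same Riemann sums tend in `L²` to the iterated Itô integrals and, as the defects vanish, to
the Milstein correction. The remaining integrands are step processes. -/
lemma milsteinCont_ae_eq [IsProbabilityMeasure P] (hB : IsBrownianMotion ℱ P B)
    (hL : LinearGrowth (trunc r f) (fun j => trunc r (g j)) (truncLop r g) K) (hK : 0 ≤ K)
    (hΔ : 0 < Δ) (hΔ1 : Δ ≤ 1) (hsymm : ∀ i j y, truncLop r g i j y = truncLop r g j i y)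
    (t : ℝ≥0) :
    milsteinCont ℱ P f g r Δ x₀ B t =ᵐ[P] fun ω =>
      step (trunc r f) (fun j => trunc r (g j)) (truncLop r g)
        ((t : ℝ) - ((⌊t / Δ⌋₊ : ℝ≥0) * Δ : ℝ≥0)) (milstein f g r Δ x₀ B ⌊t / Δ⌋₊ ω)
        (B t ω - B ((⌊t / Δ⌋₊ : ℝ≥0) * Δ) ω) := by
  set D : Fin m → Fin m → ℕ → Ω → EuclideanSpace ℝ (Fin d) :=
    fun i j n => meshDefect g r Δ B (milstein f g r Δ x₀ B) t n i j with hD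
  set S : ℕ → Fin m → Ω → EuclideanSpace ℝ (Fin d) := fun n i =>
    (secondStep hB hL hK hΔ1 x₀ t n i).integral (fun s ω' => B s ω' i) t with hS
  set I : Fin m → Ω → EuclideanSpace ℝ (Fin d) := fun i =>
    itoIntegral ℱ P (fun s ω' => B s ω' i)
        (fun s ω' => ∑ j : Fin m, stepIncrement Δ B j s ω' •
          truncLop r g i j (milsteinStep f g r Δ x₀ B s ω')) t with hI
  set C : Ω → EuclideanSpace ℝ (Fin d) := fun ω =>
    ∑ l ∈ Finset.range (⌊t / Δ⌋₊ + 1), (1 / 2 : ℝ) • ∑ i, ∑ j,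
            covDefect i j ((min t (((l + 1 : ℕ) : ℝ≥0) * Δ) : ℝ≥0)
              - (min t ((l : ℝ≥0) * Δ) : ℝ≥0) : ℝ)
            (B (min t (((l + 1 : ℕ) : ℝ≥0) * Δ)) ω - B (min t ((l : ℝ≥0) * Δ)) ω) •
              truncLop r g i j (milstein f g r Δ x₀ B l ω) with hC
  have hCeq : ∀ n ω, ∑ i, S n i ω + (1 / 2 : ℝ) • ∑ i, ∑ j, D i j n ω = C ω := fun n ω =>
    sum_integral_secondStep hB hL hK hΔ1 hsymm t n ω
  have hDlim : ∀ i j, Tendsto (fun n => eLpNorm (D i j n) 2 P) atTop (𝓝 0) := fun i j => by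
    obtain ⟨c, M, hM, h⟩ := meshDefect_bound (x₀ := x₀) hB hL hK hΔ hΔ1 t i j
    exact tendsto_of_tendsto_of_tendsto_of_le_of_le tendsto_const_nhds
      (tendsto_ofReal_sqrt_div_mul c hM) (fun _ => zero_le) fun n => (h n).2
  have hDm : ∀ i j n, AEStronglyMeasurable (D i j n) P := fun i j n => by
    obtain ⟨c, M, hM, h⟩ := meshDefect_bound (x₀ := x₀) hB hL hK hΔ hΔ1 t i j
    exact (h n).1
  have hSm : ∀ n i, AEStronglyMeasurable (S n i) P := fun n i =>
    ((secondStep hB hL hK hΔ1 x₀ t n i).memLp_integral (hB.isIntegrator i) t).1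
  have hIm : ∀ i, AEStronglyMeasurable (I i) P := fun i =>
    (tendsto_integral_secondStep (x₀ := x₀) hB hL hK hΔ hΔ1 t i).1.1
  have hSum : ∀ {u : Fin m → Ω → EuclideanSpace ℝ (Fin d)},
      (∀ i, AEStronglyMeasurable (u i) P) → AEStronglyMeasurable (fun ω => ∑ i, u i ω) P :=
    fun {u} hu => (Finset.aestronglyMeasurable_sum (f := u) Finset.univ fun i _ => hu i).congr
      (ae_of_all _ fun ω => by simp)
  have hNorm : ∀ {u : Fin m → Ω → EuclideanSpace ℝ (Fin d)},
      (∀ i, AEStronglyMeasurable (u i) P) →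
        eLpNorm (fun ω => ∑ i, u i ω) 2 P ≤ ∑ i, eLpNorm (u i) 2 P := fun {u} hu => by
      have h1 : (fun ω => ∑ i, u i ω) = ∑ i, u i := by funext ω; simp
      rw [h1]
      exact eLpNorm_sum_le (fun i _ => hu i) (by norm_num)
  have hDD : ∀ n, AEStronglyMeasurable (fun ω => ∑ i, ∑ j, D i j n ω) P := fun n =>
    hSum fun i => hSum fun j => hDm i j n
  have hCm : AEStronglyMeasurable C P := by
    have h1 := (hSum (hSm 0)).add ((hDD 0).const_smul (1 / 2 : ℝ))
    exact h1.congr (ae_of_all _ fun ω => hCeq 0 ω)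
  have hCI : C =ᵐ[P] fun ω => ∑ i, I i ω := by
    refine ae_eq_of_tendsto_eLpNorm (u := fun n ω => ∑ i, S n i ω) hCm (hSum hIm)
      (fun n => hSum (hSm n)) ?_ ?_
    · have h1 : ∀ n, eLpNorm (fun ω => ∑ i, S n i ω - C ω) 2 P
          ≤ ∑ i, ∑ j, eLpNorm (D i j n) 2 P := by
        intro n
        have h2 : (fun ω => ∑ i, S n i ω - C ω) = (-(1 / 2 : ℝ)) • fun ω => ∑ i, ∑ j, D i j n ω := by
          funext ω
          rw [← hCeq n ω]
          simp
        rw [h2, eLpNorm_const_smul]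
        have h3 : ‖(-(1 / 2 : ℝ))‖ₑ ≤ 1 := by
          rw [enorm_neg, Real.enorm_eq_ofReal (by norm_num)]
          exact ENNReal.ofReal_le_one.2 (by norm_num)
        refine (mul_le_of_le_one_left' h3).trans ((hNorm fun i => hSum fun j => hDm i j n).trans ?_)
        exact Finset.sum_le_sum fun i _ => hNorm fun j => hDm i j n
      have h4 : Tendsto (fun n => ∑ i, ∑ j, eLpNorm (D i j n) 2 P) atTop (𝓝 0) := by
        have := tendsto_finsetSum Finset.univ fun i (_ : i ∈ Finset.univ) =>
          tendsto_finsetSum Finset.univ fun j (_ : j ∈ Finset.univ) => hDlim i j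
        simpa using this
      exact tendsto_of_tendsto_of_tendsto_of_le_of_le tendsto_const_nhds h4 (fun _ => zero_le) h1
    · have h1 : ∀ n, eLpNorm (fun ω => ∑ i, S n i ω - ∑ i, I i ω) 2 P
          ≤ ∑ i, eLpNorm (fun ω => S n i ω - I i ω) 2 P := by
        intro n
        simp_rw [← Finset.sum_sub_distrib]
        exact hNorm fun i => (hSm n i).sub (hIm i)
      have h4 : Tendsto (fun n => ∑ i, eLpNorm (fun ω => S n i ω - I i ω) 2 P) atTop (𝓝 0) := by
        have := tendsto_finsetSum Finset.univ fun i (_ : i ∈ Finset.univ) =>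
          (tendsto_integral_secondStep (x₀ := x₀) hB hL hK hΔ hΔ1 t i).2
        simpa using this
      exact tendsto_of_tendsto_of_tendsto_of_le_of_le tendsto_const_nhds h4 (fun _ => zero_le) h1
  have hdiff := ae_all_iff.2 fun j => itoIntegral_diffusion (x₀ := x₀) hB hL hK hΔ hΔ1 t j
  filter_upwards [hCI, hdiff] with ω h1 h2
  rw [step_eq_sum hΔ t ω, milsteinCont, integral_trunc_milsteinStep hΔ t ω]
  congr 1
  · congr 1
    exact Finset.sum_congr rfl fun j _ => (h2 j).symm
  · exact h1.symm

end Interpolation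

/-! ### Exponential rates -/

section Rate

/-- The prefactor contributes only a constant over `s i`. Taking `c = log (A + 1)` rather than `log
A` also covers `A = 0`. -/
lemma limsup_log_div_le {ι : Type*} {l : Filter ι} [l.NeBot] {u : ι → ℝ≥0∞} {s : ι → ℝ} {A : ℝ≥0∞}
    (hA : A ≠ ∞) {a : ℝ} (hs : Tendsto s l atTop)
    (h : ∀ i, u i ≤ A * ENNReal.ofReal (Real.exp (a * s i))) :
    limsup (fun i => ENNReal.log (u i) / ((s i : ℝ) : EReal)) l ≤ (a : EReal) := by
  set c := Real.log (A.toReal + 1) with hc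
  have hc1 : A ≤ ENNReal.ofReal (Real.exp c) := by
    rw [hc, Real.exp_log (by positivity)]
    exact (ENNReal.ofReal_toReal hA).symm.le.trans (ENNReal.ofReal_le_ofReal (by linarith))
  have hlim : Tendsto (fun i => ((c / s i + a : ℝ) : EReal)) l (𝓝 (a : EReal)) := by
    have h1 : Tendsto (fun i => c / s i + a) l (𝓝 (0 + a)) :=
      (tendsto_const_nhds.div_atTop hs).add tendsto_const_nhds
    rw [zero_add] at h1
    exact (continuous_coe_real_ereal.tendsto a).comp h1
  rw [← hlim.limsup_eq]
  refine limsup_le_limsup ?_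
  filter_upwards [hs.eventually_gt_atTop 0] with i hi
  have h1 : ENNReal.log (u i) ≤ ((c + a * s i : ℝ) : EReal) := by
    have h2 : u i ≤ ENNReal.ofReal (Real.exp (c + a * s i)) := by
      rw [Real.exp_add, ENNReal.ofReal_mul (Real.exp_nonneg _)]
      exact (h i).trans (by gcongr)
    refine (ENNReal.log_monotone h2).trans_eq ?_
    rw [ENNReal.log_ofReal_of_pos (Real.exp_pos _), Real.log_exp]
  refine (EReal.div_le_div_right_of_nonneg (by exact_mod_cast hi.le) h1).trans_eq ?_
  rw [← EReal.coe_div]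
  congr 1
  field_simp

/-- The sixth power appears because `(K √Δ)³ = (K³ √Δ) Δ` and `(K³ √Δ)² = K⁶ Δ`. Dividing by `C + 1`
allows `C = 0`. -/
lemma discretization_error_le {C η K Δ : ℝ} (hC : 0 ≤ C) (hη : 0 < η) (hK : 1 ≤ K) (hΔ : 0 < Δ)
    (h1 : K ^ 6 * Δ ≤ 1) (h2 : K ^ 6 * Δ ≤ (η / (C + 1)) ^ 2) :
    K * √Δ ≤ 1 ∧ C * (K * √Δ) ^ 3 ≤ η * Δ := by
  have hs := Real.sq_sqrt hΔ.le
  have hs0 := Real.sqrt_nonneg Δ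
  constructor
  · have h3 : (K * √Δ) ^ 2 ≤ 1 := by
      rw [mul_pow, hs]
      refine le_trans ?_ h1
      have : K ^ 2 ≤ K ^ 6 := pow_le_pow_right₀ hK (by norm_num)
      gcongr
    nlinarith [mul_nonneg (zero_le_one.trans hK) hs0]
  · have h3 : K ^ 3 * √Δ ≤ η / (C + 1) := by
      refine (sq_le_sq₀ (by positivity) (by positivity)).1 ?_
      rw [mul_pow, hs]
      refine le_trans (le_of_eq (by ring)) h2
    calc C * (K * √Δ) ^ 3 = C * (K ^ 3 * √Δ) * √Δ ^ 2 := by ring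
      _ = C * (K ^ 3 * √Δ) * Δ := by rw [hs]
      _ ≤ C * (η / (C + 1)) * Δ := by gcongr
      _ ≤ η * Δ := by
          gcongr
          rw [mul_div_assoc', div_le_iff₀ (by positivity)]
          nlinarith

end Rate

/-! ### Coefficients of the truncated scheme and its stability -/

section Stability

variable {Ω : Type*} {mΩ : MeasurableSpace Ω} {P : Measure Ω} {ℱ : Filtration ℝ≥0 mΩ} {m d : ℕ}
  {B : ℝ≥0 → Ω → (Fin m → ℝ)}
  {f : EuclideanSpace ℝ (Fin d) → EuclideanSpace ℝ (Fin d)}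
  {g : Fin m → EuclideanSpace ℝ (Fin d) → EuclideanSpace ℝ (Fin d)}
  {r : ℝ} {Δ : ℝ≥0} {x₀ : EuclideanSpace ℝ (Fin d)} {K : ℝ}

lemma linearGrowth_trunc (hr : 0 < r) (hf0 : f 0 = 0) (hg0 : ∀ j, g j 0 = 0)
    (hf : ∀ x y, ‖x‖ ≤ r → ‖y‖ ≤ r → ‖f x - f y‖ ≤ K * ‖x - y‖)
    (hg : ∀ j x y, ‖x‖ ≤ r → ‖y‖ ≤ r → ‖g j x - g j y‖ ≤ K * ‖x - y‖)
    (hL : ∀ i j x y, ‖x‖ ≤ r → ‖y‖ ≤ r → ‖Lop g i j x - Lop g i j y‖ ≤ K * ‖x - y‖) :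
    LinearGrowth (trunc r f) (fun j => trunc r (g j)) (truncLop r g) K where
  measurable_drift := measurable_trunc hr hf
  measurable_diffusion j := measurable_trunc hr (hg j)
  measurable_second i j := by
    rw [truncLop_eq_trunc]
    exact measurable_trunc hr (hL i j)
  norm_drift_le := norm_trunc_le hr hf0 hf
  norm_diffusion_le j := norm_trunc_le hr (hg0 j) (hg j)
  norm_second_le i j := by
    rw [truncLop_eq_trunc]
    exact norm_trunc_le hr (by simp [Lop, hg0]) (hL i j)

/-- The moments of the continuous-time interpolation are controlled by those of the scheme. -/
lemma exists_lintegral_milsteinCont_le [IsProbabilityMeasure P] (hB : IsBrownianMotion ℱ P B)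
    (hL : LinearGrowth (trunc r f) (fun j => trunc r (g j)) (truncLop r g) K) (hK : 0 ≤ K)
    (hΔ : 0 < Δ) (hΔ1 : Δ ≤ 1) (hsymm : ∀ i j y, truncLop r g i j y = truncLop r g j i y)
    {p : ℝ} (hp : 0 ≤ p) :
    ∃ M : ℝ≥0∞, M ≠ ∞ ∧ ∀ t, ∫⁻ ω, ‖milsteinCont ℱ P f g r Δ x₀ B t ω‖ₑ ^ p ∂P
      ≤ M * ∫⁻ ω, ‖milstein f g r Δ x₀ B ⌊t / Δ⌋₊ ω‖ₑ ^ p ∂P := by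
  obtain ⟨M, hM, h⟩ := hL.exists_moment_bound hK hB hp
  refine ⟨M, hM, fun t => ?_⟩
  have h1 := milsteinCont_ae_eq (x₀ := x₀) hB hL hK hΔ hΔ1 hsymm t
  refine (lintegral_congr_ae (h1.fun_comp fun y => ‖y‖ₑ ^ p)).trans_le ?_
  refine h _ t _ (floor_div_mul_le hΔ t) ?_ (measurable_milstein hB hL _)
  have h2 : (t : ℝ) < ((⌊t / Δ⌋₊ + 1 : ℕ) : ℝ≥0) * Δ := by
    exact_mod_cast lt_floor_div_succ_mul hΔ t
  have h3 : (Δ : ℝ) ≤ 1 := by exact_mod_cast hΔ1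
  push_cast at h2 ⊢
  linarith

/-- Exponential stability in `p`-th moment of the scheme and of its interpolation. -/
lemma limsup_log_moment_le [IsProbabilityMeasure P] (hB : IsBrownianMotion ℱ P B)
    (hL : LinearGrowth (trunc r f) (fun j => trunc r (g j)) (truncLop r g) K) (hK : 0 ≤ K)
    (hΔ : 0 < Δ) (hΔ1 : Δ ≤ 1) (hsymm : ∀ i j y, truncLop r g i j y = truncLop r g j i y)
    {p a : ℝ} (hp : 0 ≤ p)
    (hY : ∀ k : ℕ, ∫⁻ ω, ‖milstein f g r Δ x₀ B k ω‖ₑ ^ p ∂P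
      ≤ ‖x₀‖ₑ ^ p * ENNReal.ofReal (Real.exp (a * ((k : ℝ) * (Δ : ℝ))))) :
    limsup (fun k : ℕ => ENNReal.log (∫⁻ ω, ‖milstein f g r Δ x₀ B k ω‖ₑ ^ p ∂P) /
        (((k : ℝ) * (Δ : ℝ) : ℝ) : EReal)) atTop ≤ (a : EReal) ∧
    limsup (fun t : ℝ≥0 => ENNReal.log (∫⁻ ω, ‖milsteinCont ℱ P f g r Δ x₀ B t ω‖ₑ ^ p ∂P) /
        (((t : ℝ) : ℝ) : EReal)) atTop ≤ (a : EReal) := by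
  have hx : ‖x₀‖ₑ ^ p ≠ ∞ := ENNReal.rpow_ne_top_of_nonneg hp enorm_ne_top
  refine ⟨limsup_log_div_le hx
    (tendsto_natCast_atTop_atTop.atTop_mul_const (NNReal.coe_pos.2 hΔ)) hY, ?_⟩
  obtain ⟨M, hM, h⟩ := exists_lintegral_milsteinCont_le (x₀ := x₀) hB hL hK hΔ hΔ1 hsymm hp
  -- The factor `exp |a|` pays for replacing `⌊t / Δ⌋ Δ` by `t`, which differ by less than `Δ ≤ 1`.
  refine limsup_log_div_le (A := M * (‖x₀‖ₑ ^ p * ENNReal.ofReal (Real.exp |a|)))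
    (ENNReal.mul_ne_top hM (ENNReal.mul_ne_top hx ENNReal.ofReal_ne_top))
    (NNReal.tendsto_coe_atTop.2 tendsto_id) fun t => ?_
  refine (h t).trans ?_
  rw [mul_assoc, mul_assoc, ← ENNReal.ofReal_mul (Real.exp_nonneg _), ← Real.exp_add]
  gcongr
  refine (hY _).trans ?_
  gcongr
  have h1 : (⌊t / Δ⌋₊ : ℝ) * (Δ : ℝ) ≤ t := by exact_mod_cast floor_div_mul_le hΔ t
  have h2 : (t : ℝ) < ((⌊t / Δ⌋₊ : ℝ) + 1) * (Δ : ℝ) := by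
    exact_mod_cast lt_floor_div_succ_mul hΔ t
  have h3 : (Δ : ℝ) ≤ 1 := by exact_mod_cast hΔ1
  have h4 : |a * ((⌊t / Δ⌋₊ : ℝ) * (Δ : ℝ) - t)| ≤ |a| := by
    rw [abs_mul]
    refine mul_le_of_le_one_right (abs_nonneg a) (abs_le.2 ⟨?_, ?_⟩) <;> linarith
  linarith [le_abs_self (a * ((⌊t / Δ⌋₊ : ℝ) * (Δ : ℝ) - t)), mul_sub a ((⌊t / Δ⌋₊ : ℝ) * (Δ : ℝ)) t]

end Stability

end MTMilstein

end

/-! ### Choice of the step-size threshold and conclusion. -/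

theorem mainTheorem3
    {Ω : Type*} {mΩ : MeasurableSpace Ω} (P : Measure Ω) [IsProbabilityMeasure P]
    (ℱ : Filtration ℝ≥0 mΩ) {m d : ℕ}
    (B : ℝ≥0 → Ω → (Fin m → ℝ)) (hB : MTMilstein.IsBrownianMotion ℱ P B)
    (x₀ : EuclideanSpace ℝ (Fin d))
    (f : EuclideanSpace ℝ (Fin d) → EuclideanSpace ℝ (Fin d))
    (g : Fin m → EuclideanSpace ℝ (Fin d) → EuclideanSpace ℝ (Fin d))
    -- the partial derivatives of the columns `g_j` exist
    (hg_diff : ∀ j l x, LineDifferentiableAt ℝ (g j) x (EuclideanSpace.single l (1 : ℝ)))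
    -- `g` is commutative
    (hcomm : ∀ j₁ j₂ x, MTMilstein.Lop g j₁ j₂ x = MTMilstein.Lop g j₂ j₁ x)
    (hf0 : f 0 = 0) (hg0 : ∀ j, g j 0 = 0)
    -- local Lipschitz condition
    (K : ℝ → ℝ) (hK : ∀ R : ℝ, 0 < R → 0 < K R)
    (hf_lip : ∀ R : ℝ, 0 < R → ∀ x y, ‖x‖ ≤ R → ‖y‖ ≤ R → ‖f x - f y‖ ≤ K R * ‖x - y‖)
    (hg_lip : ∀ R : ℝ, 0 < R → ∀ x y, ‖x‖ ≤ R → ‖y‖ ≤ R → ∀ j,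
      ‖g j x - g j y‖ ≤ K R * ‖x - y‖)
    (hL_lip : ∀ R : ℝ, 0 < R → ∀ x y, ‖x‖ ≤ R → ‖y‖ ≤ R → ∀ j₁ j₂,
      ‖MTMilstein.Lop g j₁ j₂ x - MTMilstein.Lop g j₁ j₂ y‖ ≤ K R * ‖x - y‖)
    -- dissipativity condition
    (lam p : ℝ) (hlam : 0 < lam) (hp : 0 < p) (hpd : 2 ≤ p ∨ d = 1)
    (hdiss : ∀ x, inner ℝ x (f x) + (p - 1) / 2 * ∑ j, ‖g j x‖ ^ 2 ≤ -lam * ‖x‖ ^ 2)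
    -- truncation radius
    (Δ₀ : ℝ≥0) (hΔ₀ : 0 < Δ₀) (hΔ₀_le : Δ₀ ≤ 1) (h : ℝ≥0 → ℝ)
    (hh_pos : ∀ Δ ∈ Set.Ioc 0 Δ₀, 0 < h Δ) (hh_anti : StrictAntiOn h (Set.Ioc 0 Δ₀))
    (hh_top : Tendsto h (𝓝[>] 0) atTop)
    (hhK : Tendsto (fun Δ : ℝ≥0 => K (h Δ) ^ 6 * (Δ : ℝ)) (𝓝[>] 0) (𝓝 0)) :
    ∀ ε : ℝ, 0 < ε → ∃ Δs : ℝ≥0, 0 < Δs ∧ Δs ≤ Δ₀ ∧ ∀ Δ : ℝ≥0, 0 < Δ → Δ < Δs →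
      limsup (fun k : ℕ =>
          ENNReal.log (∫⁻ ω, ‖MTMilstein.milstein f g (h Δ) Δ x₀ B k ω‖ₑ ^ p ∂P) /
            (((k : ℝ) * (Δ : ℝ) : ℝ) : EReal)) atTop
        ≤ ((-p * (lam - ε) : ℝ) : EReal) ∧
      limsup (fun t : ℝ≥0 =>
          ENNReal.log (∫⁻ ω, ‖MTMilstein.milsteinCont ℱ P f g (h Δ) Δ x₀ B t ω‖ₑ ^ p ∂P) /
            (((t : ℝ) : ℝ) : EReal)) atTop
        ≤ ((-p * (lam - ε) : ℝ) : EReal) := by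
  intro ε hε
  -- `C` is fixed before `Δ` and the truncation radius, so the smallness condition on `Δ` may depend
  -- on it.
  obtain ⟨C, hC, hmom⟩ := MTMilstein.lintegral_milstein_le (P := P) (ℱ := ℱ) hp m d hpd
  set η : ℝ := min 1 ((p * ε / (C + 1)) ^ 2) with hη
  have hη0 : 0 < η := by positivity
  -- The two halves of `η` add up in `κ ^ 6 * Δ ≤ K (h Δ) ^ 6 * Δ + Δ`.
  have hev : ∀ᶠ Δ : ℝ≥0 in 𝓝[>] 0, K (h Δ) ^ 6 * (Δ : ℝ) < η / 2 ∧ (Δ : ℝ) < η / 2 := by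
    refine (hhK.eventually_lt_const (by positivity)).and ?_
    have h1 : Tendsto (fun Δ : ℝ≥0 => (Δ : ℝ)) (𝓝[>] 0) (𝓝 0) :=
      (NNReal.continuous_coe.tendsto 0).mono_left nhdsWithin_le_nhds
    exact h1.eventually_lt_const (by positivity)
  obtain ⟨u, hu, hsub⟩ := mem_nhdsGT_iff_exists_Ioo_subset.1 hev
  refine ⟨min u Δ₀, lt_min hu hΔ₀, min_le_right _ _, fun Δ hΔ hΔs => ?_⟩
  obtain ⟨h1, h2⟩ := hsub ⟨hΔ, hΔs.trans_le (min_le_left _ _)⟩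
  have hΔle : Δ ≤ Δ₀ := (hΔs.trans_le (min_le_right _ _)).le
  have hΔ1 : Δ ≤ 1 := hΔle.trans hΔ₀_le
  have hr : 0 < h Δ := hh_pos Δ ⟨hΔ, hΔle⟩
  -- The one-step estimate requires a growth constant at least `1`, and enlarging a Lipschitz
  -- constant is harmless.
  set κ := max (K (h Δ)) 1 with hκ
  have hκ1 : 1 ≤ κ := le_max_right _ _
  have hKκ : ∀ s : ℝ, 0 ≤ s → K (h Δ) * s ≤ κ * s := fun s hs =>
    mul_le_mul_of_nonneg_right (le_max_left _ _) hs
  have hκΔ : κ ^ 6 * (Δ : ℝ) ≤ η := by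
    have h3 : κ ^ 6 ≤ K (h Δ) ^ 6 + 1 := by
      rcases max_choice (K (h Δ)) 1 with h4 | h4 <;> rw [hκ, h4]
      · linarith
      · have : 0 ≤ K (h Δ) ^ 6 := by positivity
        linarith
    nlinarith [mul_le_mul_of_nonneg_right h3 Δ.coe_nonneg]
  obtain ⟨h3, h4⟩ := MTMilstein.discretization_error_le hC (mul_pos hp hε) hκ1
    (NNReal.coe_pos.2 hΔ) (hκΔ.trans (min_le_left _ _)) (hκΔ.trans (min_le_right _ _))
  have hL : MTMilstein.LinearGrowth (MTMilstein.trunc (h Δ) f)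
      (fun j => MTMilstein.trunc (h Δ) (g j)) (MTMilstein.truncLop (h Δ) g) κ :=
    MTMilstein.linearGrowth_trunc hr hf0 hg0
      (fun x y hx hy => (hf_lip _ hr x y hx hy).trans (hKκ _ (norm_nonneg _)))
      (fun j x y hx hy => (hg_lip _ hr x y hx hy j).trans (hKκ _ (norm_nonneg _)))
      (fun i j x y hx hy => (hL_lip _ hr x y hx hy i j).trans (hKκ _ (norm_nonneg _)))
  have hsymm : ∀ i j y, MTMilstein.truncLop (h Δ) g i j y = MTMilstein.truncLop (h Δ) g j i y := by
    intro i j y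
    rw [MTMilstein.truncLop_eq_trunc, MTMilstein.truncLop_eq_trunc,
      funext (f := MTMilstein.Lop g i j) (hcomm i j)]
  refine MTMilstein.limsup_log_moment_le hB hL (zero_le_one.trans hκ1) hΔ hΔ1 hsymm hp.le
    fun k => ?_
  refine (hmom B x₀ f g (h Δ) κ lam Δ hB hL hκ1 hΔ1 h3
    (MTMilstein.trunc_dissipative hr hdiss) k).trans ?_
  refine mul_le_mul_right (ENNReal.ofReal_le_ofReal (Real.exp_le_exp.2 ?_)) _
  calc (k : ℝ) * (-p * lam * Δ + C * (κ * √(Δ : ℝ)) ^ 3)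
      ≤ k * (-p * lam * Δ + p * ε * Δ) := by gcongr
    _ = -p * (lam - ε) * (k * Δ) := by ring
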